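/- **Setting.** Let $d\ge 1$, let $\xi,\xi_1,\xi_2,\dots$ be i.i.d. random elements with law $\Pi$, let $g(\beta,\xi)$ be a real-valued loss on $\mathbb R^d$, $G(\beta)=\mathbb E\,g(\beta,\xi)$, and let $\beta^*$ be a global minimizer of $G$. For a constant learning rate $\alpha>0$ put $\beta_k=\beta_{k-1}-\alpha\nabla g(\beta_{k-1},\xi_k)$ and $\bar\beta_k=\frac1k\sum_{i=1}^k\beta_i$, $k\ge1$. Write $|x|_s=(\sum_i|x_i|^s)^{1/s}$, $|x|_\infty=\max_i|x_i|$, $\|X\|_q=(\mathbb E|X|^q)^{1/q}$, and $s_d=2\min\{\ell\in\mathbb N:2\ell>\log d\}$. **Assumptions.** Let $q\ge2$, $s=s_d$, $\mu>0$, $L>0$, $K\ge0$, and suppose: (a) $G(\beta_n)\to\infty$ along every sequence with $|\beta_n|_s\to\infty$; (b) $\sum_i(\beta_i-\beta_i')^{s-1}\,(\partial_iG(\beta)-\partial_iG(\beta'))\ge\mu|\beta-\beta'|_s^s$ for all $\beta,\beta'$; (c) $M:=\||\nabla g(\beta^*,\xi)|_s\|_q<\infty$ and $\||\nabla g(\beta,\xi)-\nabla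 g(\beta',\xi)|_s\|_q\le L|\beta-\beta'|_s$ for all $\beta,\beta'$; (d) $g(\cdot,\xi)$ is twice differentiable, $G$ is three times differentiable, $\nabla^2G(\beta^*)$ is positive definite, and $\max_{l}\sum_r|\partial_i\partial_l\partial_rG(\beta)|\le K$ for all $i$ and $\beta$. Put $$\alpha_{s_d,q}=\frac{2\mu}{\max\{q,s_d\}L^2},\qquad V=LM\sqrt{\max\{q,s_d\}}+\frac{M}{\sqrt\alpha},\qquad B=M^2\max\{q,s_d\}\,d^{\frac q{q-1}\left(1-\frac2{s_d}\right)},$$ so that $V^2\alpha=M^2\big(L\sqrt{\alpha\max\{q,s_d\}}+1\big)^2$. **Proposition (complexity bound).** There are positive constants $c_q$ depending only on $q$, $C_1,C_2$ depending only on $\mu$, and $C_3$ depending only on $\mu$ and $K$ (in particular none of them depends on $d$, $\alpha$, $\varepsilon$, $k$, $L$, $M$, $\Pi$ or the initialization) such that, under the assumptions above, the following hold. 1. Let $\pi_\alpha$ be a stationary distribution, with finite $q$-th moment, of the SGD recursion with learning rate $\alpha$, let $\beta_0^\circ\sim\pi_\alpha$, let $(\beta_0,\beta_0^\circ)$ be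 independent of $(\xi_k)_{k\ge1}$, and let $\Delta_0=\||\beta_0-\beta_0^\circ|_\infty\|_q$. If $\varepsilon>0$, $$0<\alpha\le\min\Big\{\frac{\varepsilon}{3C_3B},\frac{\alpha_{s_d,q}}7\Big\}\quad\text{and}\quad k\ge\max\Big\{1,\ \frac{9C_1^2c_qs_dV^2\alpha}{\varepsilon^2},\ \frac{3C_2\Delta_0}{\alpha\varepsilon}\Big\},$$ then $\||\bar\beta_k-\beta^*|_\infty\|_q\le\varepsilon$ (where $\varepsilon/(3C_3B)=\infty$ if $B=0$). 2. Consequently the iteration complexity is of order $1/\varepsilon^2$: for each fixed problem as above (in particular fixed $d$) and each deterministic $\beta_0$ there is $A>0$ such that for every $\varepsilon\in(0,1]$ some learning rate $\alpha>0$ satisfying the restriction in 1 gives $\||\bar\beta_k-\beta^*|_\infty\|_q\le\varepsilon$ for all integers $k\ge\max\{1,A/\varepsilon^2\}$. -/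

import Mathlib

open MeasureTheory ProbabilityTheory Filter

open scoped ENNReal Topology

noncomputable section

namespace ASGD

/-- The `ℓ^s`-norm `|x|_s = (∑ |x_i|^s)^{1/s}` on `ℝ^d`.  (The norm `‖x‖` that Mathlib puts on
`Fin d → ℝ` is the max-norm `|x|_∞`.) -/
def lsNorm {d : ℕ} (s : ℕ) (x : Fin d → ℝ) : ℝ :=
  (∑ i, |x i| ^ s) ^ ((1 : ℝ) / (s : ℝ))

/-- The `L^q`-norm `‖X‖_q = (E |X|^q)^{1/q}` of a random variable, with value in `[0, ∞]`. -/
def momentNorm {Ω : Type*} [MeasurableSpace Ω] (q : ℝ) (P : Measure Ω) (X : Ω → ℝ) : ℝ≥0∞ :=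
  eLpNorm X (ENNReal.ofReal q) P

/-- `s_d = 2 min {ℓ ∈ ℕ : 2ℓ > log d}`. -/
def sDim (d : ℕ) : ℕ := 2 * sInf {l : ℕ | Real.log (d : ℝ) < 2 * (l : ℝ)}

/-- The partial derivative `∂_i f`. -/
def pd {d : ℕ} (i : Fin d) (f : (Fin d → ℝ) → ℝ) : (Fin d → ℝ) → ℝ :=
  fun b => fderiv ℝ f b (Pi.single i 1)

/-- The gradient `∇f(b)`, as the vector of partial derivatives. -/
def grad {d : ℕ} (f : (Fin d → ℝ) → ℝ) (b : Fin d → ℝ) : Fin d → ℝ :=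
  fun i => pd i f b

/-- The Hessian matrix `∇²f(b)`. -/
def hessian {d : ℕ} (f : (Fin d → ℝ) → ℝ) (b : Fin d → ℝ) : Matrix (Fin d) (Fin d) ℝ :=
  Matrix.of fun i j => pd i (pd j f) b

section Model

variable {d : ℕ} {Ξ : Type*} [MeasurableSpace Ξ]

/-- The stochastic gradient `∇g(b, x)`, taken in the variable `b`. -/
def stochGrad (g : (Fin d → ℝ) → Ξ → ℝ) (b : Fin d → ℝ) (x : Ξ) : Fin d → ℝ :=
  grad (fun b' => g b' x) b

/-- The objective `G(b) = E_{ξ ∼ Q} g(b, ξ)`. -/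
def risk (Q : Measure Ξ) (g : (Fin d → ℝ) → Ξ → ℝ) (b : Fin d → ℝ) : ℝ :=
  ∫ x, g b x ∂Q

/-- `b` is a global minimizer of `G`. -/
def IsGlobalMin (G : (Fin d → ℝ) → ℝ) (b : Fin d → ℝ) : Prop := ∀ b', G b ≤ G b'

/-- Coercivity: `G(b_n) → ∞` along every sequence with `|b_n|_s → ∞`. -/
def Coercive (s : ℕ) (G : (Fin d → ℝ) → ℝ) : Prop :=
  ∀ b : ℕ → Fin d → ℝ, Tendsto (fun n => lsNorm s (b n)) atTop atTop →
    Tendsto (fun n => G (b n)) atTop atTop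

/-- Strong convexity in the `ℓ^s`-norm (`s` even):
`⟨(b - b')^{⊙(s-1)}, ∇G(b) - ∇G(b')⟩ ≥ μ |b - b'|_s^s`. -/
def StronglyConvex (s : ℕ) (μ : ℝ) (G : (Fin d → ℝ) → ℝ) : Prop :=
  ∀ b b' : Fin d → ℝ,
    μ * lsNorm s (b - b') ^ s ≤ ∑ i, (b i - b' i) ^ (s - 1) * (grad G b i - grad G b' i)

/-- `M_{s,q} = ‖ |∇g(b, ξ)|_s ‖_q` with value in `[0, ∞]`; it is used at the minimizer. -/
def noiseMoment (Q : Measure Ξ) (g : (Fin d → ℝ) → Ξ → ℝ) (s : ℕ) (q : ℝ) (b : Fin d → ℝ) : ℝ≥0∞ :=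
  momentNorm q Q (fun x => lsNorm s (stochGrad g b x))

/-- Stochastic Lipschitz continuity in the `ℓ^s`-norm with constant `L`. -/
def StochLipschitz (Q : Measure Ξ) (g : (Fin d → ℝ) → Ξ → ℝ) (s : ℕ) (q L : ℝ) : Prop :=
  ∀ b b' : Fin d → ℝ,
    momentNorm q Q (fun x => lsNorm s (stochGrad g b x - stochGrad g b' x)) ≤
      ENNReal.ofReal (L * lsNorm s (b - b'))

/-- `f` is twice differentiable on `ℝ^d`. -/
def TwiceDiff (f : (Fin d → ℝ) → ℝ) : Prop :=
  Differentiable ℝ f ∧ ∀ i, Differentiable ℝ (pd i f)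

/-- `f` is three times differentiable on `ℝ^d`. -/
def ThriceDiff (f : (Fin d → ℝ) → ℝ) : Prop :=
  TwiceDiff f ∧ ∀ i j, Differentiable ℝ (pd i (pd j f))

/-- `‖∇³G_i(b)‖_∞ = max_l ∑_r |∂_i ∂_l ∂_r G(b)| ≤ K` for all `i` and all `b`. -/
def ThirdDerivBound (K : ℝ) (G : (Fin d → ℝ) → ℝ) : Prop :=
  ∀ b : Fin d → ℝ, ∀ i l : Fin d, ∑ r, |pd i (pd l (pd r G)) b| ≤ K

/-- The standing assumptions on the loss `g`, the law `Q` of the data and the minimizer `bstar`,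
for the exponents `s`, `q` and with the constants `μ`, `L`, `K`. -/
structure Assumptions (Q : Measure Ξ) (g : (Fin d → ℝ) → Ξ → ℝ) (s : ℕ) (q μ L K : ℝ)
    (bstar : Fin d → ℝ) : Prop where
  measurable : ∀ b, Measurable (g b)
  integrable : ∀ b, Integrable (g b) Q
  isMin : IsGlobalMin (risk Q g) bstar
  coercive : Coercive s (risk Q g)
  stronglyConvex : StronglyConvex s μ (risk Q g)
  noiseMoment_lt_top : noiseMoment Q g s q bstar < ∞
  stochLipschitz : StochLipschitz Q g s q L
  loss_twiceDiff : ∀ x, TwiceDiff (fun b => g b x)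
  risk_thriceDiff : ThriceDiff (risk Q g)
  hessian_posDef : (hessian (risk Q g) bstar).PosDef
  thirdDerivBound : ThirdDerivBound K (risk Q g)

/-- One step of SGD with learning rate `α` and sample `x`. -/
def sgdStep (g : (Fin d → ℝ) → Ξ → ℝ) (α : ℝ) (b : Fin d → ℝ) (x : Ξ) : Fin d → ℝ :=
  b - α • stochGrad g b x

/-- The SGD iterates started at `b`; the sample used in the step from `k` to `k + 1`
is `x k`. -/
def sgd (g : (Fin d → ℝ) → Ξ → ℝ) (α : ℝ) (b : Fin d → ℝ) (x : ℕ → Ξ) : ℕ → Fin d → ℝ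
  | 0 => b
  | k + 1 => sgdStep g α (sgd g α b x k) (x k)

/-- The averaged iterate `(1/k) ∑_{i=1}^k b_i`. -/
def asgd (g : (Fin d → ℝ) → Ξ → ℝ) (α : ℝ) (b : Fin d → ℝ) (x : ℕ → Ξ) (k : ℕ) : Fin d → ℝ :=
  ((k : ℝ)⁻¹) • ∑ i ∈ Finset.Icc 1 k, sgd g α b x i

/-- `π` is a stationary distribution with finite `q`-th moment of the SGD chain with
learning rate `α`. -/
structure IsStationaryLaw (Q : Measure Ξ) (g : (Fin d → ℝ) → Ξ → ℝ) (α : ℝ) (s : ℕ) (q : ℝ)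
    (π : Measure (Fin d → ℝ)) : Prop where
  prob : IsProbabilityMeasure π
  invariant : (π.prod Q).map (fun p => sgdStep g α p.1 p.2) = π
  moment_lt_top : momentNorm q π (fun u => lsNorm s u) < ∞

/-- `ξ_0, ξ_1, …` are i.i.d. random elements with law `Q`. -/
structure IsIIDSample {Ω : Type*} [MeasurableSpace Ω] (P : Measure Ω) (Q : Measure Ξ)
    (ξ : ℕ → Ω → Ξ) : Prop where
  measurable : ∀ k, Measurable (ξ k)
  law : ∀ k, P.map (ξ k) = Q
  indep : iIndepFun ξ P

end Model

/-- `α_{s,q} = 2μ / (max{q,s} L²)`. -/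
def alphaMax (s : ℕ) (q μ L : ℝ) : ℝ := 2 * μ / (max q (s : ℝ) * L ^ 2)

/-- The factor `V = L M √(max{q,s}) + M / √α` of the stochastic variance, so that
`V √α = M (L √(α max{q,s}) + 1)`. -/
def varFactor (s : ℕ) (q L M α : ℝ) : ℝ :=
  L * M * √(max q (s : ℝ)) + M / √α

/-- The factor `B = M² max{q,s} d^{(q/(q-1)) (1 - 2/s)}` of the bias. -/
def biasFactor (d s : ℕ) (q M : ℝ) : ℝ :=
  M ^ 2 * max q (s : ℝ) * (d : ℝ) ^ (q / (q - 1) * (1 - 2 / (s : ℝ)))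

end ASGD

end

/-!
Averaged SGD with a constant learning rate, measured in `L^q(ℓ^s)` with `s` the smallest admissible
even exponent above `log d`, so that `|·|_s` and the max-norm differ at most by the factor `e < 3`.

The analytic basis is the smoothness of the squared norm of `L^q(ℓ^s)`: for a deterministic point
`x` and a random vector `Y`, the squared norm of `x + Y` exceeds `|x|_s²` at most by a linear term
in `E Y` and by `20/3 · max{q, s}` times the squared norm of `Y` (`lpNorm_lsNorm_add_sq_le`).  It
follows from a Taylor bound for `|·|^r`, used once for `r = s` and once for `r = q`.  Conditionally
on the past, every step of the chain is of this form.

* With strong convexity in the linear term and the Lipschitz condition in the quadratic one, a step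
  contracts distances by `1 - αμ/21`, where `α ≤ alphaMax / 7` is what makes the quadratic term
  lose.  Hence chains driven by the same samples merge geometrically
  (`Assumptions.lpNorm_sgd_sub_sgd_le`), and the squared distance of the stationary chain to the
  minimizer is of order `max{q, s} α M² / μ` (`Assumptions.lpNorm_stationary_le`).
* The sum of the iterates is decomposed by the martingale of its conditional expectations
  (`condSum`).  By the contraction its increments are fluctuations of functions that are Lipschitz
  with constant `21 / (αμ)`, composed with one step of length `O(α)`; so they are bounded uniformly
  in `α`, and the same smoothness inequality, now with vanishing linear term, sums them up to
  `√(k max{q, s})` (`Assumptions.lpNorm_sum_sgd_sub_le`).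
* The bias comes from the mean gradients, which telescope along the chain.  Linearizing the
  gradient at the minimizer leaves a remainder that is quadratic in the distance and controlled by
  the third derivatives; strong convexity bounds the Hessian from below in `|·|_s`
  (`Assumptions.lsNorm_sum_integral_sgd_sub_le`).

For the stationary chain the telescoping sum vanishes, and the deviation and the bias are each at
most `ε / 3`; the dependence of the conditional mean on the starting point is `O(1 / (√α k))`,
which is dominated by `1 / √k` once `αk ≥ 1`, while for `αk ≤ 1` already a single iterate is
accurate enough (`Assumptions.lpNorm_asgd_stationary_le`).  The coupling of an arbitrary start with
the stationary one costs the last `ε / 3`.  For a deterministic start the same bounds hold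
with explicit transients of order `1 / (αk)`, and `α` proportional to `ε` gives the rate `1 / ε²`
(`Assumptions.exists_complexity_const`); no stationary law is needed there.
-/

namespace ASGD

/-! ### Scalar inequalities -/

theorem rpow_sub_rpow_le {p x y : ℝ} (hp : 1 ≤ p) (hy : 0 ≤ y) (hyx : y ≤ x) :
    x ^ p - y ^ p ≤ p * x ^ (p - 1) * (x - y) := by
  rcases eq_or_lt_of_le (hy.trans hyx) with h | hx
  · have : y = 0 := by linarith
    simp [this, ← h]
  have h1 := one_add_mul_self_le_rpow_one_add (s := y / x - 1)
    (by have := div_nonneg hy hx.le; linarith) hp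
  have h2 : 1 + (y / x - 1) = y / x := by ring
  rw [h2, Real.div_rpow hy hx.le, le_div_iff₀ (Real.rpow_pos_of_pos hx p)] at h1
  have h3 : x ^ p = x ^ (p - 1) * x := by
    rw [← Real.rpow_add_one hx.ne']; ring_nf
  have h4 : (1 + p * (y / x - 1)) * x ^ p = x ^ p - p * x ^ (p - 1) * (x - y) := by
    rw [h3]; field_simp; ring
  linarith

/-- The odd power `|x|^{r-2} x` is Lipschitz on `[-W, W]` with constant `(r-1) W^{r-2}`. -/
theorem abs_rpow_mul_self_sub_le {r W x y : ℝ} (hr : 2 ≤ r) (hx : |x| ≤ W) (hy : |y| ≤ W)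
    (hyx : y ≤ x) :
    |x| ^ (r - 2) * x - |y| ^ (r - 2) * y ≤ (r - 1) * W ^ (r - 2) * (x - y) := by
  have key : ∀ u : ℝ, 0 ≤ u → u ^ (r - 2) * u = u ^ (r - 1) := fun u hu => by
    rw [← Real.rpow_add_one' hu (by linarith)]; ring_nf
  have pos : ∀ u v : ℝ, 0 ≤ v → v ≤ u → u ≤ W →
      u ^ (r - 2) * u - v ^ (r - 2) * v ≤ (r - 1) * W ^ (r - 2) * (u - v) := by
    intro u v hv hvu hu
    rw [key u (hv.trans hvu), key v hv]
    refine (rpow_sub_rpow_le (by linarith) hv hvu).trans ?_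
    have h1 : r - 1 - 1 = r - 2 := by ring
    rw [h1]
    have h2 : u ^ (r - 2) ≤ W ^ (r - 2) :=
      Real.rpow_le_rpow (hv.trans hvu) hu (by linarith)
    exact mul_le_mul_of_nonneg_right (mul_le_mul_of_nonneg_left h2 (by linarith)) (by linarith)
  rcases le_total 0 y with h0 | h0
  · rw [abs_of_nonneg h0, abs_of_nonneg (h0.trans hyx)]
    exact pos x y h0 hyx ((le_abs_self x).trans hx)
  rcases le_total x 0 with h1 | h1
  · rw [abs_of_nonpos h0, abs_of_nonpos h1]
    have := pos (-y) (-x) (by linarith) (by linarith) (by rwa [abs_of_nonpos h0] at hy)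
    linarith
  · have hW : 0 ≤ W := (abs_nonneg x).trans hx
    have a1 : |x| ^ (r - 2) * x ≤ W ^ (r - 2) * x :=
      mul_le_mul_of_nonneg_right (Real.rpow_le_rpow (abs_nonneg x) hx (by linarith)) h1
    have a2 : |y| ^ (r - 2) * (-y) ≤ W ^ (r - 2) * (-y) :=
      mul_le_mul_of_nonneg_right (Real.rpow_le_rpow (abs_nonneg y) hy (by linarith)) (by linarith)
    have a3 : 0 ≤ W ^ (r - 2) * (x - y) :=
      mul_nonneg (Real.rpow_nonneg hW _) (by linarith)
    nlinarith

/-- Second-order Taylor estimate for `|·|^r`. -/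
theorem abs_add_rpow_le {r : ℝ} (hr : 2 ≤ r) (a b : ℝ) :
    |a + b| ^ r ≤ |a| ^ r + r * (|a| ^ (r - 2) * a * b)
      + r * (r - 1) / 2 * (b ^ 2 * (|a| + |b|) ^ (r - 2)) := by
  set W := |a| + |b| with hW
  set F : ℝ → ℝ := fun t => |a| ^ r + r * (|a| ^ (r - 2) * a * b) * t
      + r * (r - 1) / 2 * (b ^ 2 * W ^ (r - 2)) * t ^ 2 - |a + t * b| ^ r with hF
  have hd : ∀ t, HasDerivAt F (r * (|a| ^ (r - 2) * a * b)
      + r * (r - 1) * (b ^ 2 * W ^ (r - 2)) * t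
      - r * |a + t * b| ^ (r - 2) * (a + t * b) * b) t := by
    intro t
    have h1 := (hasDerivAt_abs_rpow (a + t * b) (p := r) (by linarith)).comp t
      (((hasDerivAt_id t).mul_const b).const_add a)
    have h2 := ((((hasDerivAt_id t).const_mul (r * (|a| ^ (r - 2) * a * b))).const_add
      (|a| ^ r)).add (((hasDerivAt_id t).pow 2).const_mul
        (r * (r - 1) / 2 * (b ^ 2 * W ^ (r - 2))))).sub h1
    refine h2.congr_deriv ?_
    simp
    ring
  have hmono : MonotoneOn F (Set.Icc 0 1) := by
    refine monotoneOn_of_deriv_nonneg (convex_Icc 0 1)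
      (fun t _ => (hd t).continuousAt.continuousWithinAt)
      (fun t _ => (hd t).differentiableAt.differentiableWithinAt) ?_
    intro t ht
    rw [interior_Icc] at ht
    rw [(hd t).deriv]
    have ha : |a| ≤ W := by rw [hW]; linarith [abs_nonneg b]
    have hab : |a + t * b| ≤ W := by
      refine (abs_add_le _ _).trans ?_
      rw [abs_mul, abs_of_pos ht.1, hW]
      nlinarith [abs_nonneg b, ht.2]
    rcases le_total 0 b with hb | hb
    · have := abs_rpow_mul_self_sub_le hr hab ha (by nlinarith [ht.1])
      have h3 := mul_le_mul_of_nonneg_left this (mul_nonneg (by linarith : (0:ℝ) ≤ r) hb)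
      nlinarith
    · have := abs_rpow_mul_self_sub_le hr ha hab (by nlinarith [ht.1])
      have h3 := mul_le_mul_of_nonneg_left this
        (mul_nonneg (by linarith : (0:ℝ) ≤ r) (neg_nonneg.2 hb))
      nlinarith
  have := hmono (by simp) (by simp) zero_le_one
  simp only [hF, zero_mul, mul_zero, add_zero, one_mul, mul_one, one_pow] at this
  norm_num at this
  linarith

theorem exp_six_fifths_le : Real.exp (6 / 5) ≤ 10 / 3 := by
  refine le_of_pow_le_pow_left₀ (n := 5) (by norm_num) (by norm_num) ?_
  rw [← Real.exp_nat_mul]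
  have h1 : ((5 : ℕ) : ℝ) * (6 / 5) = ((6 : ℕ) : ℝ) * 1 := by norm_num
  rw [h1, Real.exp_nat_mul]
  calc Real.exp 1 ^ 6 ≤ 2.7182818286 ^ 6 :=
        pow_le_pow_left₀ (Real.exp_pos 1).le Real.exp_one_lt_d9.le 6
    _ ≤ _ := by norm_num

/-- The arithmetic behind the smoothness inequality: a second-order Taylor bound for the `r`-th
power of a norm `w` gives a bound for `w²` whose constant is linear in `r`.  A perturbation `β`
that is large compared with `c / r` is handled by the triangle inequality. -/
theorem sq_le_of_rpow_taylor {r w c β m : ℝ} (hr : 2 ≤ r) (hw : 0 ≤ w) (hc : 0 < c) (hβ : 0 ≤ β)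
    (hwc : w ≤ c + β) (hm : -(c * β) ≤ m)
    (h : w ^ r ≤ c ^ r + r * (c ^ (r - 2) * m)
      + r * (r - 1) / 2 * (β ^ 2 * (c + β) ^ (r - 2))) :
    w ^ 2 ≤ c ^ 2 + 2 * m + 10 / 3 * (r - 1) * β ^ 2 := by
  by_cases hcase : 4 * c + β ≤ 10 / 3 * (r - 1) * β
  · have h1 : w ^ 2 ≤ (c + β) ^ 2 := pow_le_pow_left₀ hw hwc 2
    have h2 := mul_le_mul_of_nonneg_right hcase hβ
    nlinarith
  push Not at hcase
  have hx : (r - 2) * (β / c) ≤ 6 / 5 := by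
    rw [← mul_div_assoc, div_le_iff₀ hc]
    nlinarith
  have hpow : (c + β) ^ (r - 2) ≤ c ^ (r - 2) * (10 / 3) := by
    have e1 : c + β = c * (1 + β / c) := by field_simp
    have hb : 0 ≤ β / c := by positivity
    rw [e1, Real.mul_rpow hc.le (by positivity)]
    refine mul_le_mul_of_nonneg_left ?_ (by positivity)
    calc (1 + β / c) ^ (r - 2) ≤ (Real.exp (β / c)) ^ (r - 2) :=
          Real.rpow_le_rpow (by positivity) (by linarith [Real.add_one_le_exp (β / c)])
            (by linarith)
      _ = Real.exp ((r - 2) * (β / c)) := by rw [← Real.exp_mul]; ring_nf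
      _ ≤ Real.exp (6 / 5) := Real.exp_le_exp.2 hx
      _ ≤ _ := exp_six_fifths_le
  have hcr : c ^ r = c ^ (r - 2) * c ^ 2 := by
    rw [← Real.rpow_natCast c 2, ← Real.rpow_add hc]; norm_num
  have h3 : w ^ r ≤ c ^ (r - 2) * (c ^ 2 + r * (m + 5 / 3 * (r - 1) * β ^ 2)) := by
    have := mul_le_mul_of_nonneg_left hpow
      (mul_nonneg (div_nonneg (mul_nonneg (by linarith) (by linarith)) two_pos.le) (sq_nonneg β) :
        (0:ℝ) ≤ r * (r - 1) / 2 * β ^ 2)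
    rw [hcr] at h
    nlinarith
  have h4 := one_add_mul_self_le_rpow_one_add (s := w ^ 2 / c ^ 2 - 1)
    (by have : 0 ≤ w ^ 2 / c ^ 2 := by positivity
        linarith) (p := r / 2) (by linarith)
  have h5 : 1 + (w ^ 2 / c ^ 2 - 1) = (w / c) ^ 2 := by rw [div_pow]; ring
  have h6 : ((w / c) ^ 2) ^ (r / 2) = w ^ r / c ^ r := by
    rw [← Real.rpow_natCast, ← Real.rpow_mul (by positivity), ← Real.div_rpow hw hc.le]
    congr 1; push_cast; ring
  rw [h5, h6, le_div_iff₀ (Real.rpow_pos_of_pos hc r)] at h4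
  have h7 : (1 + r / 2 * (w ^ 2 / c ^ 2 - 1)) * c ^ r
      = c ^ (r - 2) * (c ^ 2 + r / 2 * (w ^ 2 - c ^ 2)) := by
    rw [hcr]; field_simp
  have h8 : c ^ 2 + r / 2 * (w ^ 2 - c ^ 2) ≤ c ^ 2 + r * (m + 5 / 3 * (r - 1) * β ^ 2) :=
    le_of_mul_le_mul_left (h7 ▸ h4.trans h3) (Real.rpow_pos_of_pos hc _)
  have h9 : r * ((w ^ 2 - c ^ 2) / 2) ≤ r * (m + 5 / 3 * (r - 1) * β ^ 2) := by linarith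
  have h10 := le_of_mul_le_mul_left h9 (by linarith)
  linarith

/-! ### Smoothness of the `L^r`-norm -/

section Lr
variable {α : Type*} [MeasurableSpace α] {μ : Measure α} {r : ℝ} {X Y : α → ℝ}

theorem lintegral_enorm_rpow_eq (hr : 0 < r) (X : α → ℝ) :
    ∫⁻ a, ‖X a‖ₑ ^ r ∂μ = eLpNorm X (ENNReal.ofReal r) μ ^ r := by
  rw [eLpNorm_eq_lintegral_rpow_enorm_toReal (by simpa using hr) ENNReal.ofReal_ne_top,
    ENNReal.toReal_ofReal hr.le, ← ENNReal.rpow_mul, one_div, inv_mul_cancel₀ hr.ne',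
    ENNReal.rpow_one]

theorem lintegral_mul_rpow_le (hr : 0 < r) {t : ℝ} (ht : 0 ≤ t) (htr : t ≤ r)
    (hX : AEStronglyMeasurable X μ) (hY : AEStronglyMeasurable Y μ) :
    ∫⁻ a, ‖X a‖ₑ ^ t * ‖Y a‖ₑ ^ (r - t) ∂μ ≤
      eLpNorm X (ENNReal.ofReal r) μ ^ t * eLpNorm Y (ENNReal.ofReal r) μ ^ (r - t) := by
  have h := ENNReal.lintegral_mul_norm_pow_le (μ := μ) (f := fun a => ‖X a‖ₑ ^ r)
    (g := fun a => ‖Y a‖ₑ ^ r) (hX.enorm.pow_const _) (hY.enorm.pow_const _)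
    (p := t / r) (q := (r - t) / r) (by positivity) (div_nonneg (by linarith) hr.le)
    (by field_simp; ring)
  rw [lintegral_enorm_rpow_eq hr, lintegral_enorm_rpow_eq hr] at h
  simpa only [← ENNReal.rpow_mul, mul_div_cancel₀ _ hr.ne'] using h

theorem integrable_mul_rpow (hr : 0 < r) {t : ℝ} (ht : 0 ≤ t) (htr : t ≤ r)
    (hX : MemLp X (ENNReal.ofReal r) μ) (hY : MemLp Y (ENNReal.ofReal r) μ) :
    Integrable (fun a => |X a| ^ t * |Y a| ^ (r - t)) μ := by
  refine ⟨?_, ?_⟩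
  · exact ((hX.1.norm.aemeasurable.pow_const t).mul
      (hY.1.norm.aemeasurable.pow_const (r - t))).aestronglyMeasurable
  · refine lt_of_le_of_lt (le_of_eq ?_) ((lintegral_mul_rpow_le hr ht htr hX.1 hY.1).trans_lt
      (ENNReal.mul_lt_top (ENNReal.rpow_lt_top_of_nonneg ht hX.2.ne)
        (ENNReal.rpow_lt_top_of_nonneg (by linarith) hY.2.ne)))
    refine lintegral_congr fun a => ?_
    rw [enorm_mul, Real.enorm_rpow_of_nonneg (abs_nonneg _) ht,
      Real.enorm_rpow_of_nonneg (abs_nonneg _) (by linarith), Real.enorm_abs, Real.enorm_abs]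

/-- Hölder's inequality for `|X|^t |Y|^{r-t}`, in terms of the `L^r`-norms. -/
theorem integral_mul_rpow_le (hr : 0 < r) {t : ℝ} (ht : 0 ≤ t) (htr : t ≤ r)
    (hX : MemLp X (ENNReal.ofReal r) μ) (hY : MemLp Y (ENNReal.ofReal r) μ) :
    ∫ a, |X a| ^ t * |Y a| ^ (r - t) ∂μ ≤
      lpNorm X (ENNReal.ofReal r) μ ^ t * lpNorm Y (ENNReal.ofReal r) μ ^ (r - t) := by
  rw [← toReal_eLpNorm hX.1, ← toReal_eLpNorm hY.1, ENNReal.toReal_rpow, ENNReal.toReal_rpow,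
    ← ENNReal.toReal_mul, integral_eq_lintegral_of_nonneg_ae
      (ae_of_all _ fun a => by positivity) (integrable_mul_rpow hr ht htr hX hY).1]
  refine ENNReal.toReal_mono (ENNReal.mul_ne_top (ENNReal.rpow_ne_top_of_nonneg ht hX.2.ne)
        (ENNReal.rpow_ne_top_of_nonneg (by linarith) hY.2.ne)) ?_
  refine le_trans (le_of_eq ?_) (lintegral_mul_rpow_le hr ht htr hX.1 hY.1)
  refine lintegral_congr fun a => ?_
  rw [ENNReal.ofReal_mul (by positivity), ← ENNReal.ofReal_rpow_of_nonneg (abs_nonneg _) ht,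
    ← ENNReal.ofReal_rpow_of_nonneg (abs_nonneg _) (by linarith), ← Real.enorm_eq_ofReal_abs,
    ← Real.enorm_eq_ofReal_abs]

theorem lpNorm_rpow_eq_integral (hr : 0 < r) (hX : AEStronglyMeasurable X μ) :
    lpNorm X (ENNReal.ofReal r) μ ^ r = ∫ a, |X a| ^ r ∂μ := by
  rw [lpNorm_eq_integral_norm_rpow_toReal (by simpa using hr) ENNReal.ofReal_ne_top hX,
    ENNReal.toReal_ofReal hr.le, ← Real.rpow_mul (integral_nonneg fun a => by positivity),
    inv_mul_cancel₀ hr.ne', Real.rpow_one]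
  rfl

theorem integrable_abs_rpow (hr : 0 < r) (hX : MemLp X (ENNReal.ofReal r) μ) :
    Integrable (fun a => |X a| ^ r) μ := by
  simpa using integrable_mul_rpow hr le_rfl hr.le hX hX

theorem integrable_dualPairing (hr : 2 ≤ r) (hX : MemLp X (ENNReal.ofReal r) μ)
    (hY : MemLp Y (ENNReal.ofReal r) μ) :
    Integrable (fun a => |X a| ^ (r - 2) * X a * Y a) μ := by
  refine (integrable_mul_rpow (by linarith) zero_le_one (by linarith) hY hX).mono'
    (((hX.1.norm.aemeasurable.pow_const (r - 2)).mul hX.1.aemeasurable).mul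
      hY.1.aemeasurable).aestronglyMeasurable (ae_of_all _ fun a => ?_)
  rw [Real.norm_eq_abs, abs_mul, abs_mul, abs_of_nonneg (by positivity : 0 ≤ |X a| ^ (r - 2)),
    ← Real.rpow_add_one' (abs_nonneg _) (by linarith), Real.rpow_one, mul_comm]
  ring_nf; rfl

/-- Hölder's inequality for the derivative of `‖·‖_r^r / r` at `X` in direction `Y`. -/
theorem abs_dualPairing_le (hr : 2 ≤ r) (hX : MemLp X (ENNReal.ofReal r) μ)
    (hY : MemLp Y (ENNReal.ofReal r) μ) :
    |∫ a, |X a| ^ (r - 2) * X a * Y a ∂μ| ≤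
      lpNorm X (ENNReal.ofReal r) μ ^ (r - 1) * lpNorm Y (ENNReal.ofReal r) μ := by
  have h := integral_mul_rpow_le (by linarith) zero_le_one (by linarith) hY hX
  rw [Real.rpow_one, mul_comm] at h
  refine le_trans ?_ h
  refine (abs_integral_le_integral_abs).trans (le_of_eq (integral_congr_ae (ae_of_all _ ?_)))
  intro a
  simp only
  rw [abs_mul, abs_mul, abs_of_nonneg (by positivity : 0 ≤ |X a| ^ (r - 2)),
    ← Real.rpow_add_one' (abs_nonneg _) (by linarith), Real.rpow_one, mul_comm]
  ring_nf

/-- Smoothness of the `L^r`-norm for `r ≥ 2`: the square of the norm is, up to the constant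
`10/3`, as smooth as in the sharp inequality with constant `r - 1`. -/
theorem lpNorm_add_sq_le (hr : 2 ≤ r) (hX : MemLp X (ENNReal.ofReal r) μ)
    (hY : MemLp Y (ENNReal.ofReal r) μ) :
    lpNorm (X + Y) (ENNReal.ofReal r) μ ^ 2 ≤ lpNorm X (ENNReal.ofReal r) μ ^ 2
      + 2 * ((∫ a, |X a| ^ (r - 2) * X a * Y a ∂μ) / lpNorm X (ENNReal.ofReal r) μ ^ (r - 2))
      + 10 / 3 * (r - 1) * lpNorm Y (ENNReal.ofReal r) μ ^ 2 := by
  have hr0 : 0 < r := by linarith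
  have hp1 : 1 ≤ ENNReal.ofReal r := by
    rw [← ENNReal.ofReal_one]; exact ENNReal.ofReal_le_ofReal (by linarith)
  set c := lpNorm X (ENNReal.ofReal r) μ with hc
  set β := lpNorm Y (ENNReal.ofReal r) μ with hβ
  set I := ∫ a, |X a| ^ (r - 2) * X a * Y a ∂μ with hI
  have hc0 : 0 ≤ c := lpNorm_nonneg
  have hβ0 : 0 ≤ β := lpNorm_nonneg
  have hwc : lpNorm (X + Y) (ENNReal.ofReal r) μ ≤ c + β := lpNorm_add_le hX hp1
  have hIb : |I| ≤ c ^ (r - 1) * β := abs_dualPairing_le hr hX hY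
  rcases eq_or_lt_of_le hc0 with h0 | hcpos
  · have hI0 : I = 0 := by
      rw [← h0, Real.zero_rpow (by linarith), zero_mul] at hIb
      exact abs_nonpos_iff.1 hIb
    rw [hI0, ← h0, zero_div]
    rw [← h0] at hwc
    have : lpNorm (X + Y) (ENNReal.ofReal r) μ ^ 2 ≤ β ^ 2 :=
      pow_le_pow_left₀ lpNorm_nonneg (by linarith) 2
    nlinarith [mul_le_mul_of_nonneg_right hr (sq_nonneg β), sq_nonneg β]
  have hcr : 0 < c ^ (r - 2) := Real.rpow_pos_of_pos hcpos _
  refine sq_le_of_rpow_taylor hr lpNorm_nonneg hcpos hβ0 hwc ?_ ?_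
  · rw [neg_le, ← neg_div, div_le_iff₀ hcr]
    have e : c * β * c ^ (r - 2) = c ^ (r - 1) * β := by
      have : r - 1 = (r - 2) + 1 := by ring
      rw [this, Real.rpow_add_one hcpos.ne']; ring
    rw [e]
    exact (neg_le_abs I).trans hIb
  have hZ : MemLp (fun a => |X a| + |Y a|) (ENNReal.ofReal r) μ := hX.abs.add hY.abs
  have hZn : lpNorm (fun a => |X a| + |Y a|) (ENNReal.ofReal r) μ ≤ c + β := by
    refine (lpNorm_add_le hX.abs hp1).trans ?_
    exact le_of_eq (congrArg₂ (· + ·) (lpNorm_fun_abs hX.1 _) (lpNorm_fun_abs hY.1 _))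
  have i1 := integrable_abs_rpow hr0 hX
  have i2 := integrable_dualPairing hr hX hY
  have i3 := integrable_mul_rpow hr0 zero_le_two hr hY hZ
  have i12 : Integrable (fun a => |X a| ^ r + r * (|X a| ^ (r - 2) * X a * Y a)) μ :=
    i1.add (i2.const_mul r)
  have i3' : Integrable (fun a => Y a ^ 2 * (|X a| + |Y a|) ^ (r - 2)) μ := by
    refine i3.congr (ae_of_all _ fun a => ?_)
    simp only
    rw [abs_of_nonneg (by positivity : 0 ≤ |X a| + |Y a|), Real.rpow_two, sq_abs]
  have h3 : ∫ a, Y a ^ 2 * (|X a| + |Y a|) ^ (r - 2) ∂μ ≤ β ^ 2 * (c + β) ^ (r - 2) := by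
    have := integral_mul_rpow_le hr0 zero_le_two hr hY hZ
    rw [Real.rpow_two] at this
    refine le_trans (le_of_eq (integral_congr_ae (ae_of_all _ fun a => ?_))) (this.trans
      (mul_le_mul_of_nonneg_left (Real.rpow_le_rpow lpNorm_nonneg hZn (by linarith))
        (sq_nonneg _)))
    simp only
    rw [abs_of_nonneg (by positivity : 0 ≤ |X a| + |Y a|), Real.rpow_two, sq_abs]
  rw [lpNorm_rpow_eq_integral hr0 (hX.1.add hY.1), lpNorm_rpow_eq_integral hr0 hX.1,
    mul_div_cancel₀ _ hcr.ne']
  calc ∫ a, |(X + Y) a| ^ r ∂μ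
      ≤ ∫ a, (|X a| ^ r + r * (|X a| ^ (r - 2) * X a * Y a)
        + r * (r - 1) / 2 * (Y a ^ 2 * (|X a| + |Y a|) ^ (r - 2))) ∂μ :=
        integral_mono (integrable_abs_rpow hr0 (hX.add hY))
          (i12.add (i3'.const_mul _))
          fun a => abs_add_rpow_le hr (X a) (Y a)
    _ = ∫ a, |X a| ^ r ∂μ + r * I
        + r * (r - 1) / 2 * ∫ a, Y a ^ 2 * (|X a| + |Y a|) ^ (r - 2) ∂μ := by
        rw [integral_add i12 (i3'.const_mul _),
          integral_add i1 (i2.const_mul r), integral_const_mul, integral_const_mul]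
    _ ≤ _ := by
        have : 0 ≤ r * (r - 1) / 2 :=
          div_nonneg (mul_nonneg (by linarith) (by linarith)) two_pos.le
        exact add_le_add_right (mul_le_mul_of_nonneg_left h3 this) _
end Lr

/-! ### The `ℓ^s`-norm and smoothness of `L^q(ℓ^s)` -/

section LsNorm
variable {d : ℕ} {s : ℕ}

theorem lsNorm_eq_norm (hs : 1 ≤ s) (x : Fin d → ℝ) :
    lsNorm s x = ‖(WithLp.toLp (s : ℝ≥0∞) x : PiLp (s : ℝ≥0∞) fun _ : Fin d => ℝ)‖ := by
  rw [PiLp.norm_eq_sum (by simp; omega)]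
  simp [lsNorm]

theorem lsNorm_nonneg (s : ℕ) (x : Fin d → ℝ) : 0 ≤ lsNorm s x :=
  Real.rpow_nonneg (Finset.sum_nonneg fun i _ => by positivity) _

theorem lsNorm_pow (hs : 1 ≤ s) (x : Fin d → ℝ) : lsNorm s x ^ s = ∑ i, |x i| ^ s := by
  rw [lsNorm, ← Real.rpow_natCast, ← Real.rpow_mul (Finset.sum_nonneg fun i _ => by positivity),
    one_div, inv_mul_cancel₀ (by positivity), Real.rpow_one]

theorem lsNorm_add_le (hs : 1 ≤ s) (x y : Fin d → ℝ) :
    lsNorm s (x + y) ≤ lsNorm s x + lsNorm s y := by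
  have : Fact (1 ≤ (s : ℝ≥0∞)) := ⟨by exact_mod_cast hs⟩
  simp only [lsNorm_eq_norm hs, WithLp.toLp_add]
  exact norm_add_le _ _

theorem lsNorm_smul (hs : 1 ≤ s) (c : ℝ) (x : Fin d → ℝ) :
    lsNorm s (c • x) = |c| * lsNorm s x := by
  have : Fact (1 ≤ (s : ℝ≥0∞)) := ⟨by exact_mod_cast hs⟩
  simp only [lsNorm_eq_norm hs, WithLp.toLp_smul, norm_smul, Real.norm_eq_abs]

theorem lsNorm_neg (s : ℕ) (x : Fin d → ℝ) : lsNorm s (-x) = lsNorm s x := by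
  simp [lsNorm]

theorem lsNorm_sub_le (hs : 1 ≤ s) (x y : Fin d → ℝ) :
    lsNorm s (x - y) ≤ lsNorm s x + lsNorm s y := by
  rw [sub_eq_add_neg, ← lsNorm_neg s y]; exact lsNorm_add_le hs _ _

theorem lsNorm_zero (hs : 1 ≤ s) : lsNorm s (0 : Fin d → ℝ) = 0 := by
  simpa using lsNorm_smul hs 0 (0 : Fin d → ℝ)

theorem lsNorm_sum_le (hs : 1 ≤ s) {ι : Type*} (t : Finset ι) (f : ι → Fin d → ℝ) :
    lsNorm s (∑ i ∈ t, f i) ≤ ∑ i ∈ t, lsNorm s (f i) := by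
  classical
  induction t using Finset.induction_on with
  | empty => simp [lsNorm_zero hs]
  | insert a t ha ih =>
    rw [Finset.sum_insert ha, Finset.sum_insert ha]
    exact (lsNorm_add_le hs _ _).trans (add_le_add_right ih _)

theorem continuous_lsNorm (hs : 1 ≤ s) : Continuous (lsNorm s : (Fin d → ℝ) → ℝ) := by
  have : Fact (1 ≤ (s : ℝ≥0∞)) := ⟨by exact_mod_cast hs⟩
  have h : (lsNorm s : (Fin d → ℝ) → ℝ) =
      fun x => ‖(WithLp.toLp (s : ℝ≥0∞) x : PiLp (s : ℝ≥0∞) fun _ : Fin d => ℝ)‖ :=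
    funext (lsNorm_eq_norm hs)
  rw [h]
  exact (PiLp.continuous_toLp _ _).norm

theorem norm_le_lsNorm (hs : 1 ≤ s) (x : Fin d → ℝ) : ‖x‖ ≤ lsNorm s x := by
  have : Fact (1 ≤ (s : ℝ≥0∞)) := ⟨by exact_mod_cast hs⟩
  refine (pi_norm_le_iff_of_nonneg (lsNorm_nonneg s x)).2 fun i => ?_
  rw [lsNorm_eq_norm hs]
  exact PiLp.norm_apply_le (WithLp.toLp (s : ℝ≥0∞) x : PiLp (s : ℝ≥0∞) fun _ : Fin d => ℝ) i

theorem lsNorm_le_card_rpow_mul (hs : 1 ≤ s) (x : Fin d → ℝ) :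
    lsNorm s x ≤ (d : ℝ) ^ (1 / (s : ℝ)) * ‖x‖ := by
  have h : lsNorm s x ^ s ≤ ((d : ℝ) ^ (1 / (s : ℝ)) * ‖x‖) ^ s := by
    rw [lsNorm_pow hs, mul_pow, ← Real.rpow_natCast ((d : ℝ) ^ (1 / (s : ℝ))),
      ← Real.rpow_mul (Nat.cast_nonneg d), one_div, inv_mul_cancel₀ (by positivity), Real.rpow_one]
    calc ∑ i, |x i| ^ s ≤ ∑ _i : Fin d, ‖x‖ ^ s := Finset.sum_le_sum fun i _ =>
          pow_le_pow_left₀ (abs_nonneg _) (norm_le_pi_norm x i) s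
      _ = _ := by simp
  exact le_of_pow_le_pow_left₀ (by omega) (by positivity) h

theorem eq_zero_of_lsNorm_eq_zero (hs : 1 ≤ s) {x : Fin d → ℝ} (h : lsNorm s x = 0) : x = 0 :=
  norm_le_zero_iff.1 ((norm_le_lsNorm hs x).trans h.le)

/-- The pairing `⟨x^{⊙(s-1)}, y⟩ / |x|_s^{s-2}`, half the derivative of `|·|_s^2` at `x` in
direction `y`; it is `0` for `x = 0`. -/
noncomputable def lsDual (s : ℕ) (x y : Fin d → ℝ) : ℝ :=
  (∑ i, x i ^ (s - 1) * y i) / lsNorm s x ^ (s - 2)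

theorem lsDual_smul (s : ℕ) (c : ℝ) (x y : Fin d → ℝ) :
    lsDual s x (c • y) = c * lsDual s x y := by
  simp only [lsDual, Pi.smul_apply, smul_eq_mul, ← mul_div_assoc, Finset.mul_sum]
  congr 1
  exact Finset.sum_congr rfl fun i _ => by ring

section Count

/-- The `ℓ^s`-norm as an `L^s`-norm for the counting measure, through which the inequalities for
`L^r`-norms apply to it. -/
theorem lsNorm_eq_lpNorm (hs : 1 ≤ s) (x : Fin d → ℝ) :
    lsNorm s x = lpNorm x (ENNReal.ofReal (s : ℝ)) Measure.count := by
  rw [lpNorm_eq_integral_norm_rpow_toReal (by simp; omega) ENNReal.ofReal_ne_top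
    (by fun_prop)]
  simp [lsNorm]

theorem abs_rpow_mul_self (hs : 2 ≤ s) (he : Even s) (a : ℝ) :
    |a| ^ ((s : ℝ) - 2) * a = a ^ (s - 1) := by
  have h : (s : ℝ) - 2 = ((s - 2 : ℕ) : ℝ) := by push_cast [Nat.cast_sub hs]; ring
  have h2 : Even (s - 2) := (Nat.even_sub hs).2 (by simp [he])
  rw [h, Real.rpow_natCast, h2.pow_abs, ← pow_succ]
  congr 1; omega

/-- Smoothness of the square of the `ℓ^s`-norm. -/
theorem lsNorm_add_sq_le (hs : 2 ≤ s) (he : Even s) (x y : Fin d → ℝ) :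
    lsNorm s (x + y) ^ 2 ≤ lsNorm s x ^ 2 + 2 * lsDual s x y
      + 10 / 3 * ((s : ℝ) - 1) * lsNorm s y ^ 2 := by
  have h := lpNorm_add_sq_le (μ := (Measure.count : Measure (Fin d))) (r := (s : ℝ))
    (X := x) (Y := y) (by exact_mod_cast hs) (MemLp.of_discrete) (MemLp.of_discrete)
  simp only [← lsNorm_eq_lpNorm (by omega : 1 ≤ s), integral_count, abs_rpow_mul_self hs he] at h
  have e : (s : ℝ) - 2 = ((s - 2 : ℕ) : ℝ) := by push_cast [Nat.cast_sub hs]; ring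
  rwa [e, Real.rpow_natCast] at h

theorem abs_sum_pow_mul_le (hs : 2 ≤ s) (he : Even s) (x y : Fin d → ℝ) :
    |∑ i, x i ^ (s - 1) * y i| ≤ lsNorm s x ^ (s - 1) * lsNorm s y := by
  have h := abs_dualPairing_le (μ := (Measure.count : Measure (Fin d))) (r := (s : ℝ))
    (X := x) (Y := y) (by exact_mod_cast hs) (MemLp.of_discrete) (MemLp.of_discrete)
  simp only [← lsNorm_eq_lpNorm (by omega : 1 ≤ s), integral_count, abs_rpow_mul_self hs he] at h
  have e : (s : ℝ) - 1 = ((s - 1 : ℕ) : ℝ) := by push_cast [Nat.cast_sub (by omega : 1 ≤ s)]; ring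
  rwa [e, Real.rpow_natCast] at h

theorem abs_lsDual_le (hs : 2 ≤ s) (he : Even s) (x y : Fin d → ℝ) :
    |lsDual s x y| ≤ lsNorm s x * lsNorm s y := by
  rw [lsDual, abs_div, abs_of_nonneg (by have := lsNorm_nonneg s x; positivity :
    0 ≤ lsNorm s x ^ (s - 2))]
  refine div_le_of_le_mul₀ (by have := lsNorm_nonneg s x; positivity)
    (mul_nonneg (lsNorm_nonneg s x) (lsNorm_nonneg s y)) ?_
  refine (abs_sum_pow_mul_le hs he x y).trans (le_of_eq ?_)
  have : s - 1 = (s - 2) + 1 := by omega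
  rw [this, pow_succ]; ring

end Count

/-- The Euclidean norm is at most `d^{1/2 - 1/s}` times the `ℓ^s`-norm. -/
theorem sum_sq_le_card_rpow_mul (hs : 2 ≤ s) (x : Fin d → ℝ) :
    ∑ i, x i ^ 2 ≤ (d : ℝ) ^ (1 - 2 / (s : ℝ)) * lsNorm s x ^ 2 := by
  have hs2 : (2 : ℝ) ≤ s := by exact_mod_cast hs
  have hA : 0 ≤ ∑ i, x i ^ 2 := Finset.sum_nonneg fun i _ => sq_nonneg _
  have h := Real.rpow_sum_le_const_mul_sum_rpow_of_nonneg (s := Finset.univ)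
    (f := fun i => x i ^ 2) (p := (s : ℝ) / 2) (by linarith) (fun i _ => sq_nonneg _)
  have e1 : ∀ i, (x i ^ 2) ^ ((s : ℝ) / 2) = |x i| ^ s := fun i => by
    rw [← sq_abs, ← Real.rpow_natCast, ← Real.rpow_mul (abs_nonneg _), ← Real.rpow_natCast]
    congr 1; push_cast; ring
  simp only [e1, ← lsNorm_pow (by omega : 1 ≤ s), Finset.card_univ, Fintype.card_fin] at h
  have hN := lsNorm_nonneg s x
  calc ∑ i, x i ^ 2 = ((∑ i, x i ^ 2) ^ ((s : ℝ) / 2)) ^ (2 / (s : ℝ)) := by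
        rw [← Real.rpow_mul hA, div_mul_div_cancel₀ (by norm_num), div_self (by linarith),
          Real.rpow_one]
    _ ≤ ((d : ℝ) ^ ((s : ℝ) / 2 - 1) * lsNorm s x ^ s) ^ (2 / (s : ℝ)) :=
        Real.rpow_le_rpow (by positivity) h (by positivity)
    _ = _ := by
        rw [Real.mul_rpow (by positivity) (by positivity), ← Real.rpow_mul (Nat.cast_nonneg d),
          ← Real.rpow_natCast (lsNorm s x) s, ← Real.rpow_mul hN,
          ← Real.rpow_natCast (lsNorm s x) 2]
        congr 2
        · field_simp
        · push_cast; field_simp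

theorem integrable_of_memLp_one_le {Ω E : Type*} [MeasurableSpace Ω] [NormedAddCommGroup E]
    {P : Measure Ω} [IsFiniteMeasure P]
    {q : ℝ} (hq : 1 ≤ q) {X : Ω → E} (hX : MemLp X (ENNReal.ofReal q) P) : Integrable X P :=
  hX.integrable (by rw [← ENNReal.ofReal_one]; exact ENNReal.ofReal_le_ofReal hq)

section Random
variable {Ω : Type*} [MeasurableSpace Ω] {P : Measure Ω} {q : ℝ} {X Y : Ω → Fin d → ℝ}

theorem memLp_lsNorm (hs : 1 ≤ s) {p : ℝ≥0∞} (hX : MemLp X p P) :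
    MemLp (fun ω => lsNorm s (X ω)) p P := by
  refine (hX.norm.const_mul ((d : ℝ) ^ (1 / (s : ℝ)))).mono
    ((continuous_lsNorm hs).comp_aestronglyMeasurable hX.1) (ae_of_all _ fun ω => ?_)
  rw [Real.norm_eq_abs, abs_of_nonneg (lsNorm_nonneg _ _)]
  exact (lsNorm_le_card_rpow_mul hs _).trans (le_abs_self _)

theorem memLp_of_lsNorm (hs : 1 ≤ s) {p : ℝ≥0∞} (hX : AEStronglyMeasurable X P)
    (h : MemLp (fun ω => lsNorm s (X ω)) p P) : MemLp X p P :=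
  h.mono hX (ae_of_all _ fun _ => (norm_le_lsNorm hs _).trans (le_abs_self _))

theorem lsNorm_integral_le (hs : 1 ≤ s) (X : Ω → Fin d → ℝ) (hX : Integrable X P) :
    lsNorm s (∫ ω, X ω ∂P) ≤ ∫ ω, lsNorm s (X ω) ∂P := by
  have : Fact (1 ≤ (s : ℝ≥0∞)) := ⟨by exact_mod_cast hs⟩
  have h := ContinuousLinearMap.integral_comp_comm
    ((PiLp.continuousLinearEquiv (s : ℝ≥0∞) ℝ (fun _ : Fin d => ℝ)).symm :
      (Fin d → ℝ) →L[ℝ] PiLp (s : ℝ≥0∞) (fun _ : Fin d => ℝ)) hX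
  simp only [lsNorm_eq_norm hs]
  calc _ = ‖∫ ω, (WithLp.toLp (s : ℝ≥0∞) (X ω) : PiLp (s : ℝ≥0∞) fun _ : Fin d => ℝ) ∂P‖ :=
        congrArg norm h.symm
    _ ≤ _ := norm_integral_le_integral_norm _

theorem lsDual_integral (x : Fin d → ℝ) (hX : Integrable X P) :
    lsDual s x (∫ ω, X ω ∂P) = ∫ ω, lsDual s x (X ω) ∂P := by
  have hi : ∀ i, Integrable (fun ω => X ω i) P := fun i => hX.eval i
  simp only [lsDual]
  rw [integral_div, integral_finsetSum _ fun i _ => (hi i).const_mul _]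
  congr 1
  refine Finset.sum_congr rfl fun i _ => ?_
  rw [eval_integral hi, integral_const_mul]

/-- The `L^q`-norm of the square, in `L^{q/2}`. -/
theorem lpNorm_sq_half (hq : 0 < q) {f : Ω → ℝ} (hf : AEStronglyMeasurable f P) :
    lpNorm (fun ω => f ω ^ 2) (ENNReal.ofReal (q / 2)) P = lpNorm f (ENNReal.ofReal q) P ^ 2 := by
  have h := eLpNorm_norm_rpow (μ := P) (p := ENNReal.ofReal (q / 2)) f (q := 2) two_pos
  rw [← ENNReal.ofReal_mul (by positivity), div_mul_cancel₀ _ two_ne_zero] at h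
  have hf2 : AEStronglyMeasurable (fun ω => f ω ^ 2) P := hf.pow 2
  rw [← toReal_eLpNorm hf, ← toReal_eLpNorm hf2, ← ENNReal.toReal_pow,
    ← ENNReal.rpow_natCast, Nat.cast_two, ← h]
  simp

theorem memLp_sq_half (hq : 0 < q) {f : Ω → ℝ} (hf : MemLp f (ENNReal.ofReal q) P) :
    MemLp (fun ω => f ω ^ 2) (ENNReal.ofReal (q / 2)) P := by
  refine ⟨hf.1.pow 2, ?_⟩
  have h := eLpNorm_norm_rpow (μ := P) (p := ENNReal.ofReal (q / 2)) f (q := 2) two_pos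
  rw [← ENNReal.ofReal_mul (by positivity), div_mul_cancel₀ _ two_ne_zero] at h
  have h2 : eLpNorm (fun ω => f ω ^ 2) (ENNReal.ofReal (q / 2)) P
      = eLpNorm f (ENNReal.ofReal q) P ^ (2 : ℝ) := by
    rw [← h]; simp
  rw [h2]
  exact ENNReal.rpow_lt_top_of_nonneg (by norm_num) hf.2.ne

/-- Minkowski's inequality in `L^{q/2}`, applied to squares. -/
theorem lpNorm_sq_le_add_sq (hq : 2 ≤ q) {f g h : Ω → ℝ} (hf : AEStronglyMeasurable f P)
    (hg : MemLp g (ENNReal.ofReal q) P) (hh : MemLp h (ENNReal.ofReal q) P)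
    (hle : ∀ ω, f ω ^ 2 ≤ g ω ^ 2 + h ω ^ 2) :
    lpNorm f (ENNReal.ofReal q) P ^ 2 ≤
      lpNorm g (ENNReal.ofReal q) P ^ 2 + lpNorm h (ENNReal.ofReal q) P ^ 2 := by
  have hq0 : 0 < q := by linarith
  have hp1 : 1 ≤ ENNReal.ofReal (q / 2) := by
    rw [← ENNReal.ofReal_one]; exact ENNReal.ofReal_le_ofReal (by linarith)
  have hg2 := memLp_sq_half hq0 hg
  have hh2 := memLp_sq_half hq0 hh
  rw [← lpNorm_sq_half hq0 hf, ← lpNorm_sq_half hq0 hg.1, ← lpNorm_sq_half hq0 hh.1]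
  refine le_trans ?_ (lpNorm_add_le hg2 hp1)
  refine lpNorm_mono_real (hg2.add hh2) fun ω => ?_
  rw [Real.norm_eq_abs, abs_of_nonneg (sq_nonneg _)]
  exact hle ω

/-- The one-step inequality: smoothness of the norm of `L^q(P; ℓ^s)` at a deterministic point
`x`.  It combines the smoothness of `|·|_s` with that of the scalar `L^q`-norm, the latter
applied to the component of `Y` along the derivative of `|·|_s` at `x`. -/
theorem lpNorm_lsNorm_add_sq_le [IsProbabilityMeasure P] (hs : 2 ≤ s) (he : Even s) (hq : 2 ≤ q)
    (x : Fin d → ℝ) (hY : MemLp Y (ENNReal.ofReal q) P) :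
    lpNorm (fun ω => lsNorm s (x + Y ω)) (ENNReal.ofReal q) P ^ 2 ≤
      lsNorm s x ^ 2 + 2 * lsDual s x (∫ ω, Y ω ∂P)
        + 20 / 3 * max q s * lpNorm (fun ω => lsNorm s (Y ω)) (ENNReal.ofReal q) P ^ 2 := by
  have hs1 : 1 ≤ s := by omega
  have hq0 : 0 < q := by linarith
  have hint : Integrable Y P := integrable_of_memLp_one_le (by linarith) hY
  have hNY := memLp_lsNorm hs1 hY
  have hxY : MemLp (fun ω => x + Y ω) (ENNReal.ofReal q) P := (memLp_const x).add hY
  have hNxY := memLp_lsNorm hs1 hxY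
  set c := lsNorm s x with hc
  set b := lpNorm (fun ω => lsNorm s (Y ω)) (ENNReal.ofReal q) P with hb
  have hc0 : 0 ≤ c := lsNorm_nonneg s x
  have hp : (q - 1) + ((s : ℝ) - 1) ≤ 2 * max q s := by
    linarith [le_max_left q (s : ℝ), le_max_right q (s : ℝ)]
  rcases eq_or_lt_of_le hc0 with h0 | hcpos
  · have hx : x = 0 := eq_zero_of_lsNorm_eq_zero hs1 (hc.symm.trans h0.symm)
    have hd : lsDual s x (∫ ω, Y ω ∂P) = 0 := by
      simp [lsDual, hx, zero_pow (by omega : s - 1 ≠ 0)]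
    have : (fun ω => lsNorm s (x + Y ω)) = fun ω => lsNorm s (Y ω) := by simp [hx]
    rw [this, ← hb, hd, ← h0]
    have : 2 ≤ max q (s : ℝ) := hq.trans (le_max_left _ _)
    nlinarith [mul_le_mul_of_nonneg_right this (sq_nonneg b), sq_nonneg b]
  -- the normalized derivative of `|·|_s` at `x` in direction `Y`
  set v : Ω → ℝ := fun ω => lsDual s x (Y ω) / c with hv
  have hvb : ∀ ω, |v ω| ≤ lsNorm s (Y ω) := fun ω => by
    rw [hv, abs_div, abs_of_pos hcpos, div_le_iff₀ hcpos, mul_comm]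
    exact abs_lsDual_le hs he x (Y ω)
  have hvm : AEStronglyMeasurable v P := by
    have : AEMeasurable Y P := hY.1.aemeasurable
    simp only [hv, lsDual]
    exact ((Finset.aemeasurable_fun_sum _ fun i _ =>
      ((measurable_pi_apply i).comp_aemeasurable this).const_mul _).div_const _
        |>.div_const _).aestronglyMeasurable
  have hvL : MemLp v (ENNReal.ofReal q) P :=
    hNY.mono hvm (ae_of_all _ fun ω => by
      rw [Real.norm_eq_abs, Real.norm_eq_abs, abs_of_nonneg (lsNorm_nonneg _ _)]; exact hvb ω)
  have hvn : lpNorm v (ENNReal.ofReal q) P ≤ b := lpNorm_mono_real hNY hvb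
  have hcv : MemLp (fun ω => c + v ω) (ENNReal.ofReal q) P := (memLp_const c).add hvL
  have hconst : lpNorm (fun _ : Ω => c) (ENNReal.ofReal q) P = c := by
    rw [lpNorm_const (by simpa using hq0) (IsProbabilityMeasure.ne_zero P)]
    simp [abs_of_pos hcpos]
  -- the component of `Y` along the derivative, treated as a scalar random variable
  have hscal : lpNorm (fun ω => c + v ω) (ENNReal.ofReal q) P ^ 2 ≤
      c ^ 2 + 2 * lsDual s x (∫ ω, Y ω ∂P) + 10 / 3 * (q - 1) * b ^ 2 := by
    have h := lpNorm_add_sq_le (μ := P) hq (memLp_const c) hvL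
    have e : (∫ a, |c| ^ (q - 2) * c * v a ∂P) / c ^ (q - 2) = lsDual s x (∫ ω, Y ω ∂P) := by
      rw [integral_const_mul, abs_of_pos hcpos, hv, integral_div, ← lsDual_integral x hint]
      have : c ^ (q - 2) ≠ 0 := (Real.rpow_pos_of_pos hcpos _).ne'
      field_simp
    rw [hconst, e] at h
    refine h.trans (add_le_add_right ?_ _)
    exact mul_le_mul_of_nonneg_left (pow_le_pow_left₀ lpNorm_nonneg hvn 2) (by linarith)
  have hκ : 0 ≤ 10 / 3 * ((s : ℝ) - 1) := by
    have : (2 : ℝ) ≤ s := by exact_mod_cast hs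
    linarith
  -- pathwise, `|x + Y|_s² ≤ (c + v)² + 10/3 (s - 1) |Y|_s²`, as `2 ⟨derivative, Y⟩ = 2cv`
  have hsum := lpNorm_sq_le_add_sq hq hNxY.1 hcv
    (hNY.const_mul (√(10 / 3 * ((s : ℝ) - 1)))) (fun ω => by
      rw [mul_pow, Real.sq_sqrt hκ]
      refine (lsNorm_add_sq_le hs he x (Y ω)).trans (add_le_add_left ?_ _)
      have e : lsDual s x (Y ω) = c * v ω := by simp only [hv]; field_simp
      rw [e]; nlinarith [sq_nonneg (v ω)])
  have e2 : lpNorm (fun ω => √(10 / 3 * ((s : ℝ) - 1)) * lsNorm s (Y ω)) (ENNReal.ofReal q) P ^ 2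
      = 10 / 3 * ((s : ℝ) - 1) * b ^ 2 := by
    have := lpNorm_const_smul (p := ENNReal.ofReal q) (√(10 / 3 * ((s : ℝ) - 1)))
      (fun ω => lsNorm s (Y ω)) P
    have e3 : (√(10 / 3 * ((s : ℝ) - 1)) • fun ω => lsNorm s (Y ω))
      = fun ω => √(10 / 3 * ((s : ℝ) - 1)) * lsNorm s (Y ω) := rfl
    rw [e3] at this
    rw [this, mul_pow, coe_nnnorm, Real.norm_eq_abs, sq_abs, Real.sq_sqrt hκ]
  rw [e2] at hsum
  nlinarith [mul_le_mul_of_nonneg_right hp (sq_nonneg b)]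

end Random
end LsNorm

/-! ### The stochastic gradient -/

theorem one_le_ofReal {q : ℝ} (hq : 1 ≤ q) : 1 ≤ ENNReal.ofReal q := by
  rw [← ENNReal.ofReal_one]; exact ENNReal.ofReal_le_ofReal hq

theorem integral_le_lpNorm {Ω : Type*} [MeasurableSpace Ω] {P : Measure Ω}
    [IsProbabilityMeasure P] {q : ℝ} (hq : 1 ≤ q) {f : Ω → ℝ} (hf : MemLp f (ENNReal.ofReal q) P) :
    ∫ ω, |f ω| ∂P ≤ lpNorm f (ENNReal.ofReal q) P := by
  have h := lpNorm_one_eq_integral_norm (μ := P) hf.1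
  simp only [Real.norm_eq_abs] at h
  rw [← h, ← toReal_eLpNorm hf.1, ← toReal_eLpNorm hf.1]
  exact ENNReal.toReal_mono hf.2.ne
    (eLpNorm_le_eLpNorm_of_exponent_le (one_le_ofReal hq) hf.1)

theorem continuous_of_lsNorm_lipschitz {d s : ℕ} (hs : 1 ≤ s) {C : ℝ} (hC : 0 ≤ C)
    {f : (Fin d → ℝ) → Fin d → ℝ}
    (hf : ∀ b b', lsNorm s (f b - f b') ≤ C * lsNorm s (b - b')) : Continuous f := by
  have hK : 0 ≤ C * (d : ℝ) ^ (1 / (s : ℝ)) := by positivity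
  refine (LipschitzWith.of_dist_le_mul (K := ⟨_, hK⟩) fun b b' => ?_).continuous
  rw [dist_eq_norm, dist_eq_norm]
  calc ‖f b - f b'‖ ≤ lsNorm s (f b - f b') := norm_le_lsNorm hs _
    _ ≤ C * lsNorm s (b - b') := hf b b'
    _ ≤ C * ((d : ℝ) ^ (1 / (s : ℝ)) * ‖b - b'‖) :=
        mul_le_mul_of_nonneg_left (lsNorm_le_card_rpow_mul hs _) hC
    _ = _ := by rw [← mul_assoc]; rfl

namespace Assumptions

variable {d : ℕ} {Ξ : Type*} [MeasurableSpace Ξ] {Q : Measure Ξ}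
  {g : (Fin d → ℝ) → Ξ → ℝ} {s : ℕ} {q μ L K : ℝ} {bstar : Fin d → ℝ}

theorem continuous_stochGrad (A : Assumptions Q g s q μ L K bstar) (x : Ξ) :
    Continuous fun b => stochGrad g b x :=
  continuous_pi fun i => ((A.loss_twiceDiff x).2 i).continuous

/-- The gradient is a limit of difference quotients, so that it is measurable in the sample. -/
theorem measurable_stochGrad_right (A : Assumptions Q g s q μ L K bstar) (b : Fin d → ℝ) :
    Measurable (stochGrad g b) := by
  refine measurable_pi_lambda _ fun i => ?_
  refine measurable_of_tendsto_metrizable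
    (f := fun (n : ℕ) x => (n : ℝ) • (g (b + (n : ℝ)⁻¹ • Pi.single i 1) x - g b x))
    (fun n => ((A.measurable _).sub (A.measurable b)).const_smul (n : ℝ)) ?_
  refine tendsto_pi_nhds.2 fun x => ?_
  exact ((A.loss_twiceDiff x).1 b).hasFDerivAt.lim _
    (by simpa using tendsto_natCast_atTop_atTop)

theorem measurable_stochGrad (A : Assumptions Q g s q μ L K bstar) :
    Measurable fun p : (Fin d → ℝ) × Ξ => stochGrad g p.1 p.2 :=
  measurable_uncurry_of_continuous_of_measurable A.continuous_stochGrad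
    A.measurable_stochGrad_right

theorem measurable_sgdStep (A : Assumptions Q g s q μ L K bstar) (α : ℝ) :
    Measurable fun p : (Fin d → ℝ) × Ξ => sgdStep g α p.1 p.2 :=
  measurable_fst.sub (A.measurable_stochGrad.const_smul α)

theorem memLp_stochGrad_min (A : Assumptions Q g s q μ L K bstar) (hs : 1 ≤ s) :
    MemLp (stochGrad g bstar) (ENNReal.ofReal q) Q :=
  memLp_of_lsNorm hs (A.measurable_stochGrad_right bstar).aestronglyMeasurable
    ⟨((continuous_lsNorm hs).measurable.comp
      (A.measurable_stochGrad_right bstar)).aestronglyMeasurable, A.noiseMoment_lt_top⟩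

theorem memLp_stochGrad_sub (A : Assumptions Q g s q μ L K bstar) (hs : 1 ≤ s)
    (b b' : Fin d → ℝ) :
    MemLp (fun x => stochGrad g b x - stochGrad g b' x) (ENNReal.ofReal q) Q := by
  have hm : Measurable fun x => stochGrad g b x - stochGrad g b' x :=
    (A.measurable_stochGrad_right b).sub (A.measurable_stochGrad_right b')
  exact memLp_of_lsNorm hs hm.aestronglyMeasurable
    ⟨((continuous_lsNorm hs).measurable.comp hm).aestronglyMeasurable,
      (A.stochLipschitz b b').trans_lt ENNReal.ofReal_lt_top⟩

theorem memLp_stochGrad (A : Assumptions Q g s q μ L K bstar) (hs : 1 ≤ s) (b : Fin d → ℝ) :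
    MemLp (stochGrad g b) (ENNReal.ofReal q) Q := by
  have := (A.memLp_stochGrad_sub hs b bstar).add (A.memLp_stochGrad_min hs)
  refine this.ae_eq (ae_of_all _ fun x => ?_)
  simp

theorem lpNorm_stochGrad_sub_le (A : Assumptions Q g s q μ L K bstar) (hs : 1 ≤ s) (hL : 0 ≤ L)
    (b b' : Fin d → ℝ) :
    lpNorm (fun x => lsNorm s (stochGrad g b x - stochGrad g b' x)) (ENNReal.ofReal q) Q
      ≤ L * lsNorm s (b - b') := by
  rw [← toReal_eLpNorm (memLp_lsNorm hs (A.memLp_stochGrad_sub hs b b')).1]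
  exact ENNReal.toReal_le_of_le_ofReal (mul_nonneg hL (lsNorm_nonneg _ _)) (A.stochLipschitz b b')

theorem lpNorm_stochGrad_le (A : Assumptions Q g s q μ L K bstar) (hs : 1 ≤ s) (hq : 1 ≤ q)
    (hL : 0 ≤ L) (b : Fin d → ℝ) :
    lpNorm (fun x => lsNorm s (stochGrad g b x)) (ENNReal.ofReal q) Q
      ≤ (noiseMoment Q g s q bstar).toReal + L * lsNorm s (b - bstar) := by
  have h1 := memLp_lsNorm hs (A.memLp_stochGrad_min hs)
  have h2 := memLp_lsNorm hs (A.memLp_stochGrad_sub hs b bstar)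
  have e : (noiseMoment Q g s q bstar).toReal
      = lpNorm (fun x => lsNorm s (stochGrad g bstar x)) (ENNReal.ofReal q) Q :=
    toReal_eLpNorm h1.1
  rw [e]
  refine le_trans (lpNorm_mono_real (h1.add h2) fun x => ?_)
    ((lpNorm_add_le h1 (one_le_ofReal hq)).trans
      (add_le_add_right (A.lpNorm_stochGrad_sub_le hs hL b bstar) _))
  rw [Real.norm_eq_abs, abs_of_nonneg (lsNorm_nonneg _ _)]
  refine le_trans (le_of_eq ?_) (lsNorm_add_le hs _ _)
  simp

theorem grad_min (A : Assumptions Q g s q μ L K bstar) : grad (risk Q g) bstar = 0 := by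
  funext i
  have : IsLocalMin (risk Q g) bstar := Eventually.of_forall A.isMin
  simp [grad, pd, this.fderiv_eq_zero]

section Mean
variable [IsProbabilityMeasure Q]

theorem integrable_stochGrad (A : Assumptions Q g s q μ L K bstar) (hs : 1 ≤ s) (hq : 1 ≤ q)
    (b : Fin d → ℝ) : Integrable (stochGrad g b) Q :=
  integrable_of_memLp_one_le hq (A.memLp_stochGrad hs b)

theorem lsNorm_integral_stochGrad_sub_le (A : Assumptions Q g s q μ L K bstar) (hs : 1 ≤ s)
    (hq : 1 ≤ q) (hL : 0 ≤ L) (b b' : Fin d → ℝ) :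
    lsNorm s (∫ x, stochGrad g b x ∂Q - ∫ x, stochGrad g b' x ∂Q) ≤ L * lsNorm s (b - b') := by
  rw [← integral_sub (A.integrable_stochGrad hs hq b) (A.integrable_stochGrad hs hq b')]
  have h := A.memLp_stochGrad_sub hs b b'
  refine (lsNorm_integral_le hs _ (integrable_of_memLp_one_le hq h)).trans ?_
  refine le_trans ?_ (A.lpNorm_stochGrad_sub_le hs hL b b')
  refine le_trans (le_of_eq (integral_congr_ae (ae_of_all _ fun x => ?_)))
    (integral_le_lpNorm hq (memLp_lsNorm hs h))
  exact (abs_of_nonneg (lsNorm_nonneg _ _)).symm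

theorem continuous_integral_stochGrad (A : Assumptions Q g s q μ L K bstar) (hs : 1 ≤ s)
    (hq : 1 ≤ q) (hL : 0 ≤ L) : Continuous fun b => ∫ x, stochGrad g b x ∂Q :=
  continuous_of_lsNorm_lipschitz hs hL (A.lsNorm_integral_stochGrad_sub_le hs hq hL)

/-- Differentiation under the expectation: the stochastic gradient is unbiased.  No domination
is assumed; the increments of the risk along a coordinate are integrals of the mean stochastic
gradient by Fubini's theorem, and that mean is continuous. -/
theorem integral_stochGrad (A : Assumptions Q g s q μ L K bstar) (hs : 1 ≤ s)
    (hq : 1 ≤ q) (hL : 0 ≤ L) (b : Fin d → ℝ) :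
    ∫ x, stochGrad g b x ∂Q = grad (risk Q g) b := by
  have hev : ∀ b', Integrable (stochGrad g b') Q := A.integrable_stochGrad hs hq
  funext i
  set e : Fin d → ℝ := Pi.single i 1 with he
  have hpath : Continuous fun u : ℝ => b + u • e := by fun_prop
  set γ : ℝ → ℝ := fun u => ∫ x, stochGrad g (b + u • e) x i ∂Q with hγ
  have hγeq : ∀ u, γ u = (∫ x, stochGrad g (b + u • e) x ∂Q) i := fun u =>
    (eval_integral (fun j => (hev _).eval j) i).symm
  have hγc : Continuous γ := by
    have := (continuous_apply i).comp ((A.continuous_integral_stochGrad hs hq hL).comp hpath)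
    exact this.congr fun u => (hγeq u).symm
  have hline : ∀ (f : (Fin d → ℝ) → ℝ), Differentiable ℝ f → ∀ u : ℝ,
      HasDerivAt (fun t => f (b + t • e)) (pd i f (b + u • e)) u := by
    intro f hf u
    have h1 : HasDerivAt (fun t : ℝ => b + t • e) e u := by
      simpa using ((hasDerivAt_id u).smul_const e).const_add b
    exact (hf (b + u • e)).hasFDerivAt.comp_hasDerivAt u h1
  have hinc : ∀ t, risk Q g (b + t • e) - risk Q g b = ∫ u in (0 : ℝ)..t, γ u := by
    intro t
    have h1 : ∀ x, g (b + t • e) x - g b x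
        = ∫ u in (0 : ℝ)..t, stochGrad g (b + u • e) x i := by
      intro x
      have := intervalIntegral.integral_eq_sub_of_hasDerivAt (a := 0) (b := t)
        (f := fun u => g (b + u • e) x) (f' := fun u => stochGrad g (b + u • e) x i)
        (fun u _ => hline _ (A.loss_twiceDiff x).1 u)
        (((continuous_apply i).comp
          ((A.continuous_stochGrad x).comp hpath)).intervalIntegrable 0 t)
      simpa using this.symm
    rw [risk, risk, ← integral_sub (A.integrable _) (A.integrable _)]
    simp only [h1]
    symm
    refine intervalIntegral_integral_swap ?_
    have hm : Measurable fun p : ℝ × Ξ => stochGrad g (b + p.1 • e) p.2 i :=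
      (measurable_pi_apply i).comp (A.measurable_stochGrad.comp
        ((hpath.measurable.comp measurable_fst).prodMk measurable_snd))
    refine (integrable_prod_iff hm.aestronglyMeasurable).2
      ⟨ae_of_all _ fun u => (hev (b + u • e)).eval i, ?_⟩
    have hbd : ∀ u : ℝ, ∫ x, ‖stochGrad g (b + u • e) x i‖ ∂Q ≤
        (noiseMoment Q g s q bstar).toReal + L * lsNorm s (b + u • e - bstar) := by
      intro u
      refine le_trans ?_ (A.lpNorm_stochGrad_le hs hq hL (b + u • e))
      have h2 := memLp_lsNorm hs (A.memLp_stochGrad hs (b + u • e))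
      refine le_trans ?_ (integral_le_lpNorm hq h2)
      refine integral_mono ((hev _).eval i).norm (integrable_of_memLp_one_le hq h2).abs
        fun x => ?_
      exact (norm_le_pi_norm _ i).trans ((norm_le_lsNorm hs _).trans (le_abs_self _))
    have hcont : Continuous fun u : ℝ =>
        (noiseMoment Q g s q bstar).toReal + L * lsNorm s (b + u • e - bstar) :=
      continuous_const.add (continuous_const.mul
        ((continuous_lsNorm hs).comp (hpath.sub continuous_const)))
    refine (hcont.integrableOn_uIoc).mono'
      (hm.norm.stronglyMeasurable.integral_prod_right'.aestronglyMeasurable)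
      (ae_of_all _ fun u => ?_)
    rw [Real.norm_eq_abs, abs_of_nonneg (integral_nonneg fun x => norm_nonneg _)]
    exact hbd u
  have hd1 : HasDerivAt (fun t : ℝ => risk Q g (b + t • e)) (pd i (risk Q g) b) 0 := by
    simpa using hline _ A.risk_thriceDiff.1.1 0
  have hd2 : HasDerivAt (fun t : ℝ => risk Q g (b + t • e)) (γ 0) 0 := by
    have h1 := (intervalIntegral.integral_hasDerivAt_right (a := 0) (b := 0)
      (hγc.intervalIntegrable 0 0) (hγc.stronglyMeasurableAtFilter _ _)
      hγc.continuousAt).const_add (risk Q g b)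
    refine h1.congr_of_eventuallyEq (Eventually.of_forall fun t => ?_)
    simp only
    rw [← hinc t]; ring
  have := hd2.unique hd1
  rw [hγeq] at this
  simpa [grad] using this

theorem lsNorm_grad_sub_le (A : Assumptions Q g s q μ L K bstar) (hs : 1 ≤ s)
    (hq : 1 ≤ q) (hL : 0 ≤ L) (b b' : Fin d → ℝ) :
    lsNorm s (grad (risk Q g) b - grad (risk Q g) b') ≤ L * lsNorm s (b - b') := by
  rw [← A.integral_stochGrad hs hq hL, ← A.integral_stochGrad hs hq hL]
  exact A.lsNorm_integral_stochGrad_sub_le hs hq hL b b'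

end Mean
end Assumptions

/-! ### One step of SGD -/

/-- The contraction factor `1 - αμ/21` of one SGD step. -/
noncomputable def rate (α μ : ℝ) : ℝ := 1 - α * μ / 21

/-- The bound `5740 max{q,s} α M² / μ` for the squared `L^q(ℓ^s)`-distance between
the stationary SGD chain and the minimizer. -/
noncomputable def statVar (s : ℕ) (q μ M α : ℝ) : ℝ := 5740 * (max q (s : ℝ) * α * M ^ 2) / μ

theorem lpNorm_smul_lsNorm {Ω : Type*} [MeasurableSpace Ω] {P : Measure Ω} {p : ℝ≥0∞} {d s : ℕ}
    (hs : 1 ≤ s) (c : ℝ) (X : Ω → Fin d → ℝ) :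
    lpNorm (fun ω => lsNorm s (c • X ω)) p P = |c| * lpNorm (fun ω => lsNorm s (X ω)) p P := by
  have := lpNorm_const_smul (p := p) |c| (fun ω => lsNorm s (X ω)) P
  simp only [coe_nnnorm, Real.norm_eq_abs, abs_abs] at this
  rw [← this]
  congr 1
  funext ω
  simp [lsNorm_smul hs]

theorem max_mul_le_of_le_alphaMax {s : ℕ} {q μ L α : ℝ} (hq : 2 ≤ q) (hL : 0 < L)
    (hα : α ≤ alphaMax s q μ L / 7) : max q (s : ℝ) * α * L ^ 2 ≤ 2 * μ / 7 := by
  have hp : 0 < max q (s : ℝ) := lt_of_lt_of_le (by linarith) (le_max_left _ _)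
  rw [alphaMax, div_div, le_div_iff₀ (by positivity)] at hα
  linarith

/-- Strong convexity in terms of half the derivative of `|·|_s²`; both sides vanish for
`b = b'`. -/
theorem StronglyConvex.mul_sq_le_lsDual {d s : ℕ} {μ : ℝ} {G : (Fin d → ℝ) → ℝ} (hs : 2 ≤ s)
    (hG : StronglyConvex s μ G) (b b' : Fin d → ℝ) :
    μ * lsNorm s (b - b') ^ 2 ≤ lsDual s (b - b') (grad G b - grad G b') := by
  rcases eq_or_lt_of_le (lsNorm_nonneg s (b - b')) with h0 | hpos
  · have : b - b' = 0 := eq_zero_of_lsNorm_eq_zero (by omega) h0.symm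
    rw [this, lsNorm_zero (by omega)]
    simp [lsDual, zero_pow (by omega : s - 1 ≠ 0)]
  · rw [lsDual, le_div_iff₀ (by positivity), mul_assoc, ← pow_add]
    have : 2 + (s - 2) = s := by omega
    rw [this]
    exact hG b b'

namespace Assumptions

variable {d : ℕ} {Ξ : Type*} [MeasurableSpace Ξ] {Q : Measure Ξ} [IsProbabilityMeasure Q]
  {g : (Fin d → ℝ) → Ξ → ℝ} {s : ℕ} {q μ L K : ℝ} {bstar : Fin d → ℝ} {α : ℝ}

theorem memLp_sgdStep_sub (A : Assumptions Q g s q μ L K bstar) (hs : 1 ≤ s)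
    (b c : Fin d → ℝ) : MemLp (fun x => sgdStep g α b x - c) (ENNReal.ofReal q) Q := by
  have h := ((memLp_const (b - c)).sub ((A.memLp_stochGrad hs b).const_smul α) :
    MemLp _ (ENNReal.ofReal q) Q)
  refine h.ae_eq (ae_of_all _ fun x => ?_)
  simp only [sgdStep, Pi.sub_apply, Pi.smul_apply]
  abel

theorem memLp_sgdStep_sub_sgdStep (A : Assumptions Q g s q μ L K bstar) (hs : 1 ≤ s)
    (b b' : Fin d → ℝ) :
    MemLp (fun x => sgdStep g α b x - sgdStep g α b' x) (ENNReal.ofReal q) Q := by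
  have h := (A.memLp_sgdStep_sub (α := α) hs b 0).sub (A.memLp_sgdStep_sub (α := α) hs b' 0)
  refine h.ae_eq (ae_of_all _ fun x => ?_)
  simp

/-- The drift contributes `-2αμ`, and the quadratic term at most `2 · (20/3) / 7 · αμ = 40/21 · αμ`,
so that `α ≤ alphaMax / 7` leaves a contraction by `2αμ/21`. -/
theorem lpNorm_sgdStep_sub_sq_le (A : Assumptions Q g s q μ L K bstar) (hs : 2 ≤ s) (he : Even s)
    (hq : 2 ≤ q) (hL : 0 < L) (hα : 0 < α) (hα7 : α ≤ alphaMax s q μ L / 7)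
    (b b' : Fin d → ℝ) :
    lpNorm (fun x => lsNorm s (sgdStep g α b x - sgdStep g α b' x)) (ENNReal.ofReal q) Q ^ 2
      ≤ (1 - 2 * (α * μ / 21)) * lsNorm s (b - b') ^ 2 := by
  have hs1 : 1 ≤ s := by omega
  have hq1 : 1 ≤ q := by linarith
  have hY := (A.memLp_stochGrad_sub hs1 b b').const_smul (-α)
  have h := lpNorm_lsNorm_add_sq_le hs he hq (b - b') hY
  simp only [Pi.smul_apply] at h
  have e1 : (fun x => lsNorm s (sgdStep g α b x - sgdStep g α b' x)) =
      fun x => lsNorm s (b - b' + -α • (stochGrad g b x - stochGrad g b' x)) := by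
    funext x; congr 1; simp only [sgdStep, smul_sub, neg_smul]; abel
  rw [e1]
  refine h.trans ?_
  rw [integral_smul, lsDual_smul, integral_sub (A.integrable_stochGrad hs1 hq1 b)
    (A.integrable_stochGrad hs1 hq1 b'), A.integral_stochGrad hs1 hq1 hL.le,
    A.integral_stochGrad hs1 hq1 hL.le, lpNorm_smul_lsNorm hs1, abs_neg, abs_of_pos hα]
  have h1 := A.stronglyConvex.mul_sq_le_lsDual hs b b'
  have h2 := A.lpNorm_stochGrad_sub_le hs1 hL.le b b'
  have h3 := max_mul_le_of_le_alphaMax hq hL hα7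
  set N := lsNorm s (b - b')
  set ℓ := lpNorm (fun x => lsNorm s (stochGrad g b x - stochGrad g b' x)) (ENNReal.ofReal q) Q
  have h4 : ℓ ^ 2 ≤ L ^ 2 * N ^ 2 := by
    rw [← mul_pow]; exact pow_le_pow_left₀ lpNorm_nonneg h2 2
  have hp : 0 ≤ max q (s : ℝ) := le_trans (by linarith) (le_max_left _ _)
  have h5 : 20 / 3 * max q (s : ℝ) * (α * ℓ) ^ 2 ≤ 20 / 3 * (2 * μ / 7) * α * N ^ 2 := by
    calc 20 / 3 * max q (s : ℝ) * (α * ℓ) ^ 2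
        = 20 / 3 * (max q (s : ℝ) * α ^ 2) * ℓ ^ 2 := by ring
      _ ≤ 20 / 3 * (max q (s : ℝ) * α ^ 2) * (L ^ 2 * N ^ 2) :=
          mul_le_mul_of_nonneg_left h4 (by positivity)
      _ = 20 / 3 * (max q (s : ℝ) * α * L ^ 2) * (α * N ^ 2) := by ring
      _ ≤ 20 / 3 * (2 * μ / 7) * (α * N ^ 2) :=
          mul_le_mul_of_nonneg_right (by linarith) (by positivity)
      _ = _ := by ring
  have h6 := mul_le_mul_of_nonneg_left h1 hα.le
  nlinarith

/-- If `rate α μ` were negative, the contraction inequality would fail for two distinct points. -/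
theorem rate_nonneg (A : Assumptions Q g s q μ L K bstar) (hd : 1 ≤ d) (hs : 2 ≤ s)
    (he : Even s) (hq : 2 ≤ q) (hL : 0 < L) (hα : 0 < α) (hα7 : α ≤ alphaMax s q μ L / 7) :
    0 ≤ rate α μ := by
  have h := A.lpNorm_sgdStep_sub_sq_le hs he hq hL hα hα7 (fun _ => 1) 0
  have h0 : 0 ≤ (1 - 2 * (α * μ / 21)) * lsNorm s ((fun _ => 1) - (0 : Fin d → ℝ)) ^ 2 :=
    (sq_nonneg _).trans h
  have hN : 0 < lsNorm s ((fun _ => 1) - (0 : Fin d → ℝ)) := by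
    refine (lsNorm_nonneg s _).lt_of_ne fun h => ?_
    have := congrFun (eq_zero_of_lsNorm_eq_zero (by omega) h.symm) ⟨0, hd⟩
    simp at this
  have := nonneg_of_mul_nonneg_left h0 (by positivity)
  rw [rate]; linarith

/-- One SGD step contracts in `L^q(ℓ^s)`. -/
theorem lpNorm_sgdStep_sub_le (A : Assumptions Q g s q μ L K bstar) (hd : 1 ≤ d) (hs : 2 ≤ s)
    (he : Even s) (hq : 2 ≤ q) (hL : 0 < L) (hα : 0 < α) (hα7 : α ≤ alphaMax s q μ L / 7)
    (b b' : Fin d → ℝ) :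
    lpNorm (fun x => lsNorm s (sgdStep g α b x - sgdStep g α b' x)) (ENNReal.ofReal q) Q
      ≤ rate α μ * lsNorm s (b - b') := by
  refine le_of_pow_le_pow_left₀ two_ne_zero
    (mul_nonneg (A.rate_nonneg hd hs he hq hL hα hα7) (lsNorm_nonneg _ _)) ?_
  refine (A.lpNorm_sgdStep_sub_sq_le hs he hq hL hα hα7 b b').trans ?_
  rw [mul_pow, rate]
  exact mul_le_mul_of_nonneg_right (by nlinarith [sq_nonneg (α * μ / 21)]) (sq_nonneg _)

/-- One SGD step pulls the squared distance to the minimizer towards `statVar`. -/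
theorem lpNorm_sgdStep_sub_min_sq_le (A : Assumptions Q g s q μ L K bstar) (hs : 2 ≤ s)
    (he : Even s) (hq : 2 ≤ q) (hμ : 0 < μ) (hL : 0 < L) (hα : 0 < α)
    (hα7 : α ≤ alphaMax s q μ L / 7) {M : ℝ} (hM : M = (noiseMoment Q g s q bstar).toReal)
    (b : Fin d → ℝ) :
    lpNorm (fun x => lsNorm s (sgdStep g α b x - bstar)) (ENNReal.ofReal q) Q ^ 2
      ≤ rate α μ * lsNorm s (b - bstar) ^ 2 + (1 - rate α μ) * statVar s q μ M α := by
  have hs1 : 1 ≤ s := by omega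
  have hq1 : 1 ≤ q := by linarith
  have hY := (A.memLp_stochGrad hs1 b).const_smul (-α)
  have h := lpNorm_lsNorm_add_sq_le hs he hq (b - bstar) hY
  simp only [Pi.smul_apply] at h
  have e1 : (fun x => lsNorm s (sgdStep g α b x - bstar)) =
      fun x => lsNorm s (b - bstar + -α • stochGrad g b x) := by
    funext x; congr 1; simp only [sgdStep, neg_smul]; abel
  rw [e1]
  refine h.trans ?_
  rw [integral_smul, lsDual_smul, A.integral_stochGrad hs1 hq1 hL.le, lpNorm_smul_lsNorm hs1,
    abs_neg, abs_of_pos hα]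
  have h1 := A.stronglyConvex.mul_sq_le_lsDual hs b bstar
  rw [A.grad_min, sub_zero] at h1
  have h2 := A.lpNorm_stochGrad_le hs1 hq1 hL.le b
  rw [← hM] at h2
  have h3 := max_mul_le_of_le_alphaMax hq hL hα7
  have hM0 : 0 ≤ M := hM ▸ ENNReal.toReal_nonneg
  set N := lsNorm s (b - bstar)
  set ℓ := lpNorm (fun x => lsNorm s (stochGrad g b x)) (ENNReal.ofReal q) Q
  -- Young's inequality; the weight `41/40` keeps `20/3 · 41/40 = 41/6` below the `7` of `hα7`
  have h4 : ℓ ^ 2 ≤ 41 * M ^ 2 + 41 / 40 * (L ^ 2 * N ^ 2) := by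
    have := pow_le_pow_left₀ lpNorm_nonneg h2 2
    nlinarith [sq_nonneg (40 * M - L * N)]
  have hp : 0 ≤ max q (s : ℝ) := le_trans (by linarith) (le_max_left _ _)
  have h5 : 20 / 3 * max q (s : ℝ) * (α * ℓ) ^ 2 ≤
      41 / 6 * (2 * μ / 7) * α * N ^ 2 + 820 / 3 * (max q (s : ℝ) * α ^ 2) * M ^ 2 := by
    calc 20 / 3 * max q (s : ℝ) * (α * ℓ) ^ 2
        = 20 / 3 * (max q (s : ℝ) * α ^ 2) * ℓ ^ 2 := by ring
      _ ≤ 20 / 3 * (max q (s : ℝ) * α ^ 2) * (41 * M ^ 2 + 41 / 40 * (L ^ 2 * N ^ 2)) :=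
          mul_le_mul_of_nonneg_left h4 (by positivity)
      _ = 41 / 6 * (max q (s : ℝ) * α * L ^ 2) * (α * N ^ 2)
          + 820 / 3 * (max q (s : ℝ) * α ^ 2) * M ^ 2 := by ring
      _ ≤ 41 / 6 * (2 * μ / 7) * (α * N ^ 2) + 820 / 3 * (max q (s : ℝ) * α ^ 2) * M ^ 2 :=
          add_le_add_left (mul_le_mul_of_nonneg_right (by linarith) (by positivity)) _
      _ = _ := by ring
  have h6 := mul_le_mul_of_nonneg_left h1 hα.le
  have h7 : (1 - rate α μ) * statVar s q μ M α = 820 / 3 * (max q (s : ℝ) * α ^ 2) * M ^ 2 := by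
    rw [rate, statVar]; field_simp; ring
  rw [h7, rate]
  nlinarith

end Assumptions

/-! ### History and fresh samples -/

section Fresh
variable {Ω Ξ E 𝓦 : Type*} [MeasurableSpace Ξ] [MeasurableSpace E] [MeasurableSpace 𝓦]

theorem measurable_comp_prodMk {m : MeasurableSpace Ω} {V : Type*} [MeasurableSpace V]
    {X : Ω → E} {ζ : Ω → Ξ} {F : E × Ξ → V} (hF : Measurable F) (hX : Measurable[m] X)
    (hζ : Measurable[m] ζ) : Measurable[m] fun ω => F (X ω, ζ ω) :=
  hF.comp (hX.prodMk hζ)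

/-- The σ-algebra generated by the initial state `W` and the samples used in the first `k`
steps. -/
@[reducible] def history (W : Ω → 𝓦) (ξ : ℕ → Ω → Ξ) (k : ℕ) : MeasurableSpace Ω :=
  MeasurableSpace.comap (fun ω => (W ω, fun i : Finset.range k => ξ i ω)) inferInstance

section History
variable {W : Ω → 𝓦} {ξ : ℕ → Ω → Ξ}

theorem measurable_history_init (k : ℕ) : Measurable[history W ξ k] W :=
  measurable_fst.comp (comap_measurable _)

theorem measurable_history_sample {i k : ℕ} (h : i < k) : Measurable[history W ξ k] (ξ i) :=
  ((measurable_pi_apply (⟨i, Finset.mem_range.2 h⟩ : Finset.range k)).comp measurable_snd).comp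
    (comap_measurable (fun ω => (W ω, fun i : Finset.range k => ξ i ω)))

theorem history_mono {j k : ℕ} (h : j ≤ k) : history W ξ j ≤ history W ξ k := by
  have hφ : Measurable fun p : 𝓦 × (Finset.range k → Ξ) => (p.1, fun i : Finset.range j =>
      p.2 ⟨i, Finset.mem_range.2 ((Finset.mem_range.1 i.2).trans_le h)⟩) :=
    measurable_fst.prodMk (measurable_pi_lambda _ fun i =>
      (measurable_pi_apply _).comp measurable_snd)
  exact (hφ.comp (comap_measurable (fun ω => (W ω, fun i : Finset.range k => ξ i ω)))).comap_le

end History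

variable [MeasurableSpace Ω] {P : Measure Ω} {Q : Measure Ξ}
  {W : Ω → 𝓦} {ξ : ℕ → Ω → Ξ}

theorem history_le (hW : Measurable W) (hξ : ∀ k, Measurable (ξ k)) (k : ℕ) :
    history W ξ k ≤ ‹MeasurableSpace Ω› :=
  (hW.prodMk (measurable_pi_lambda _ fun i : Finset.range k => hξ i)).comap_le

theorem indepFun_prodMk_of_indepFun {A B C : Type*} [MeasurableSpace A] [MeasurableSpace B]
    [MeasurableSpace C] {X : Ω → A} {Y : Ω → B} {Z : Ω → C} (hX : Measurable X)
    (hY : Measurable Y) (hZ : Measurable Z) (h1 : IndepFun X (fun ω => (Y ω, Z ω)) P)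
    (h2 : IndepFun Y Z P) [IsProbabilityMeasure P] : IndepFun (fun ω => (X ω, Y ω)) Z P := by
  have : IsProbabilityMeasure (P.map X) := Measure.isProbabilityMeasure_map hX.aemeasurable
  have : IsProbabilityMeasure (P.map Y) := Measure.isProbabilityMeasure_map hY.aemeasurable
  have : IsProbabilityMeasure (P.map Z) := Measure.isProbabilityMeasure_map hZ.aemeasurable
  have e1 := h1.map_prod_eq_prod_map_map hX.aemeasurable (hY.prodMk hZ).aemeasurable
  have e2 := h2.map_prod_eq_prod_map_map hY.aemeasurable hZ.aemeasurable
  have h12 : IndepFun X Y P := h1.comp measurable_id measurable_fst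
  have e3 := h12.map_prod_eq_prod_map_map hX.aemeasurable hY.aemeasurable
  refine (indepFun_iff_map_prod_eq_prod_map_map (hX.prodMk hY).aemeasurable
    hZ.aemeasurable).2 ?_
  rw [e3]
  refine (MeasurableEquiv.prodAssoc (α := A) (β := B) (γ := C)).map_measurableEquiv_injective ?_
  rw [Measure.prodAssoc_prod, ← e2, ← e1, Measure.map_map
    (MeasurableEquiv.measurable _) ((hX.prodMk hY).prodMk hZ)]
  rfl

/-- A function of the history up to time `k` is independent of the next sample. -/
theorem map_prodMk_sample [IsProbabilityMeasure P] (hξ : IsIIDSample P Q ξ) (hW : Measurable W)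
    (hind : IndepFun W (fun ω k => ξ k ω) P) {k : ℕ} {X : Ω → E}
    (hX : Measurable[history W ξ k] X) :
    P.map (fun ω => (X ω, ξ k ω)) = (P.map X).prod Q := by
  have hm : Measurable fun ω => fun i : Finset.range k => ξ i ω :=
    measurable_pi_lambda _ fun i => hξ.measurable i
  have h1 : IndepFun W (fun ω => ((fun i : Finset.range k => ξ i ω), ξ k ω)) P :=
    hind.comp measurable_id ((measurable_pi_lambda _ fun i : Finset.range k =>
      measurable_pi_apply (i : ℕ)).prodMk (measurable_pi_apply k))
  have h2 : IndepFun (fun ω => fun i : Finset.range k => ξ i ω) (ξ k) P :=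
    (hξ.indep.indepFun_finset (Finset.range k) {k} (by simp) hξ.measurable).comp
      measurable_id (measurable_pi_apply (⟨k, by simp⟩ : ({k} : Finset ℕ)))
  have h3 := indepFun_prodMk_of_indepFun hW hm (hξ.measurable k) h1 h2
  have hX' : Measurable X := hX.mono (history_le hW hξ.measurable k) le_rfl
  have h4 : IndepFun X (ξ k) P := by
    rw [IndepFun_iff_Indep] at h3 ⊢
    exact indep_of_indep_of_le_left h3 hX.comap_le
  rw [h4.map_prod_eq_prod_map_map hX'.aemeasurable (hξ.measurable k).aemeasurable, hξ.law k]

section ProductLaw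
variable [IsProbabilityMeasure Q] {X : Ω → E} {ζ : Ω → Ξ} {q : ℝ}

/-- A moment bound that holds for every fixed value of `X` holds for random `X` independent of
`ζ`. -/
theorem memLp_and_lpNorm_le_of_prod (hX : Measurable X) (hζ : Measurable ζ)
    (hlaw : P.map (fun ω => (X ω, ζ ω)) = (P.map X).prod Q) (hq : 0 < q)
    {F : E × Ξ → ℝ} (hF : Measurable F) {A : E → ℝ} (hA : Measurable A)
    (hAX : MemLp (fun ω => A (X ω)) (ENNReal.ofReal q) P)
    (hmem : ∀ x, MemLp (fun z => F (x, z)) (ENNReal.ofReal q) Q)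
    (hle : ∀ x, lpNorm (fun z => F (x, z)) (ENNReal.ofReal q) Q ≤ A x) :
    MemLp (fun ω => F (X ω, ζ ω)) (ENNReal.ofReal q) P ∧
      lpNorm (fun ω => F (X ω, ζ ω)) (ENNReal.ofReal q) P ≤
        lpNorm (fun ω => A (X ω)) (ENNReal.ofReal q) P := by
  have hFm : Measurable fun ω => F (X ω, ζ ω) := hF.comp (hX.prodMk hζ)
  have key : eLpNorm (fun ω => F (X ω, ζ ω)) (ENNReal.ofReal q) P ≤
      eLpNorm (fun ω => A (X ω)) (ENNReal.ofReal q) P := by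
    rw [← ENNReal.rpow_le_rpow_iff hq, ← lintegral_enorm_rpow_eq hq, ← lintegral_enorm_rpow_eq hq]
    have e1 : ∫⁻ ω, ‖F (X ω, ζ ω)‖ₑ ^ q ∂P = ∫⁻ x, ∫⁻ z, ‖F (x, z)‖ₑ ^ q ∂Q ∂(P.map X) := by
      rw [← lintegral_prod _ (hF.enorm.pow_const q).aemeasurable, ← hlaw,
        lintegral_map (hF.enorm.pow_const q) (hX.prodMk hζ)]
    have e2 : ∫⁻ ω, ‖A (X ω)‖ₑ ^ q ∂P = ∫⁻ x, ‖A x‖ₑ ^ q ∂(P.map X) := by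
      rw [lintegral_map (hA.enorm.pow_const q) hX]
    rw [e1, e2]
    refine lintegral_mono fun x => ?_
    rw [lintegral_enorm_rpow_eq hq]
    refine ENNReal.rpow_le_rpow ?_ hq.le
    rw [← ofReal_lpNorm (hmem x), Real.enorm_eq_ofReal (lpNorm_nonneg.trans (hle x))]
    exact ENNReal.ofReal_le_ofReal (hle x)
  refine ⟨⟨hFm.aestronglyMeasurable, key.trans_lt hAX.2⟩, ?_⟩
  rw [← toReal_eLpNorm hFm.aestronglyMeasurable, ← toReal_eLpNorm hAX.1]
  exact ENNReal.toReal_mono hAX.2.ne key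

/-- The version of `memLp_and_lpNorm_le_of_prod` for a bound on the square by a sum of squares,
which integrates by Minkowski's inequality in `L^{q/2}`. -/
theorem memLp_and_lpNorm_sq_le_of_prod (hX : Measurable X) (hζ : Measurable ζ)
    (hlaw : P.map (fun ω => (X ω, ζ ω)) = (P.map X).prod Q) (hq : 2 ≤ q)
    {F : E × Ξ → ℝ} (hF : Measurable F) {G H : E → ℝ} (hG : Measurable G) (hH : Measurable H)
    (hGX : MemLp (fun ω => G (X ω)) (ENNReal.ofReal q) P)
    (hHX : MemLp (fun ω => H (X ω)) (ENNReal.ofReal q) P)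
    (hmem : ∀ x, MemLp (fun z => F (x, z)) (ENNReal.ofReal q) Q)
    (hle : ∀ x, lpNorm (fun z => F (x, z)) (ENNReal.ofReal q) Q ^ 2 ≤ G x ^ 2 + H x ^ 2) :
    MemLp (fun ω => F (X ω, ζ ω)) (ENNReal.ofReal q) P ∧
      lpNorm (fun ω => F (X ω, ζ ω)) (ENNReal.ofReal q) P ^ 2 ≤
        lpNorm (fun ω => G (X ω)) (ENNReal.ofReal q) P ^ 2
          + lpNorm (fun ω => H (X ω)) (ENNReal.ofReal q) P ^ 2 := by
  have hA : Measurable fun x => √(G x ^ 2 + H x ^ 2) := by fun_prop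
  have hAX : MemLp (fun ω => √(G (X ω) ^ 2 + H (X ω) ^ 2)) (ENNReal.ofReal q) P := by
    refine (hGX.abs.add hHX.abs).mono (hA.comp hX).aestronglyMeasurable (ae_of_all _ fun ω => ?_)
    rw [Real.norm_eq_abs, abs_of_nonneg (Real.sqrt_nonneg _)]
    refine le_trans (Real.sqrt_le_left ?_ |>.2 ?_) (le_abs_self _)
    · simp only [Pi.add_apply, Pi.abs_apply]; positivity
    · simp only [Pi.add_apply, Pi.abs_apply]
      nlinarith [sq_abs (G (X ω)), sq_abs (H (X ω)),
        mul_nonneg (abs_nonneg (G (X ω))) (abs_nonneg (H (X ω)))]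
  obtain ⟨h1, h2⟩ := memLp_and_lpNorm_le_of_prod hX hζ hlaw (by linarith) hF hA hAX hmem
    fun x => Real.le_sqrt_of_sq_le (hle x)
  refine ⟨h1, (pow_le_pow_left₀ lpNorm_nonneg h2 2).trans ?_⟩
  refine lpNorm_sq_le_add_sq hq hAX.1 hGX hHX fun ω => ?_
  rw [Real.sq_sqrt (by positivity)]

/-- The tower property for a function of `X` and an independent `ζ`. -/
theorem integral_comp_of_prod (hX : Measurable X) (hζ : Measurable ζ)
    (hlaw : P.map (fun ω => (X ω, ζ ω)) = (P.map X).prod Q)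
    [IsProbabilityMeasure P] {V : Type*} [NormedAddCommGroup V] [NormedSpace ℝ V] [CompleteSpace V]
    [SecondCountableTopology V] [MeasurableSpace V] [BorelSpace V]
    {F : E × Ξ → V} (hF : Measurable F) (hint : Integrable (fun ω => F (X ω, ζ ω)) P) :
    ∫ ω, F (X ω, ζ ω) ∂P = ∫ ω, ∫ z, F (X ω, z) ∂Q ∂P := by
  have hFs : AEStronglyMeasurable F (P.map fun ω => (X ω, ζ ω)) := hF.aestronglyMeasurable
  have h1 : Integrable F ((P.map X).prod Q) := by
    rw [← hlaw]; exact (integrable_map_measure hFs (hX.prodMk hζ).aemeasurable).2 hint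
  have h2 : AEStronglyMeasurable (fun x => ∫ z, F (x, z) ∂Q) (P.map X) :=
    hF.stronglyMeasurable.integral_prod_right'.aestronglyMeasurable
  rw [← integral_map (hX.prodMk hζ).aemeasurable hFs, hlaw, integral_prod _ h1,
    integral_map hX.aemeasurable h2]

end ProductLaw
end Fresh

/-! ### Contraction and moments of the chain -/

/-- The standing conditions on the dimension, the exponents and the learning rate. -/
structure Regime (d s : ℕ) (q μ L α : ℝ) : Prop where
  one_le_dim : 1 ≤ d
  two_le_s : 2 ≤ s
  even_s : Even s
  two_le_q : 2 ≤ q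
  mu_pos : 0 < μ
  L_pos : 0 < L
  alpha_pos : 0 < α
  alpha_le : α ≤ alphaMax s q μ L / 7

namespace Regime
variable {d s : ℕ} {q μ L α : ℝ}

theorem one_le_s (R : Regime d s q μ L α) : 1 ≤ s := one_le_two.trans R.two_le_s
theorem q_pos (R : Regime d s q μ L α) : 0 < q := two_pos.trans_le R.two_le_q
theorem one_le_q (R : Regime d s q μ L α) : 1 ≤ q := one_le_two.trans R.two_le_q
theorem max_pos (R : Regime d s q μ L α) : 0 < max q (s : ℝ) :=
  R.q_pos.trans_le (le_max_left _ _)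
theorem rate_lt_one (R : Regime d s q μ L α) : rate α μ < 1 := by
  have := R.alpha_pos
  have := R.mu_pos
  have : 0 < α * μ / 21 := by positivity
  rw [rate]; linarith
theorem statVar_nonneg (R : Regime d s q μ L α) (M : ℝ) : 0 ≤ statVar s q μ M α := by
  have := R.alpha_pos
  have := R.mu_pos
  have := R.max_pos
  rw [statVar]; positivity
end Regime

theorem Assumptions.measurable_history_sgd {d : ℕ} {Ξ Ω 𝓦 : Type*} [MeasurableSpace Ξ]
    [MeasurableSpace 𝓦] {Q : Measure Ξ} {g : (Fin d → ℝ) → Ξ → ℝ} {s : ℕ} {q μ L K : ℝ}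
    {bstar : Fin d → ℝ} {α : ℝ} {ξ : ℕ → Ω → Ξ} {W : Ω → 𝓦} {b₀ : Ω → Fin d → ℝ}
    (A : Assumptions Q g s q μ L K bstar)
    (hb : Measurable[history W ξ 0] b₀) (k : ℕ) :
    Measurable[history W ξ k] fun ω => sgd g α (b₀ ω) (fun i => ξ i ω) k := by
  induction k with
  | zero => exact hb
  | succ k ih =>
    exact measurable_comp_prodMk (A.measurable_sgdStep α)
      (ih.mono (history_mono k.le_succ) le_rfl) (measurable_history_sample k.lt_succ_self)

theorem Assumptions.measurable_sgd {d : ℕ} {Ξ Ω 𝓦 : Type*} [MeasurableSpace Ξ]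
    [MeasurableSpace Ω] [MeasurableSpace 𝓦] {Q : Measure Ξ} {g : (Fin d → ℝ) → Ξ → ℝ} {s : ℕ}
    {q μ L K : ℝ} {bstar : Fin d → ℝ} {α : ℝ} {ξ : ℕ → Ω → Ξ} {W : Ω → 𝓦} {b₀ : Ω → Fin d → ℝ}
    (A : Assumptions Q g s q μ L K bstar)
    (hW : Measurable W) (hξ : ∀ k, Measurable (ξ k))
    (hb : Measurable[history W ξ 0] b₀) (k : ℕ) :
    Measurable fun ω => sgd g α (b₀ ω) (fun i => ξ i ω) k :=
  (A.measurable_history_sgd hb k).mono (history_le hW hξ k) le_rfl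

section Chain
variable {d : ℕ} {Ξ Ω 𝓦 : Type*} [MeasurableSpace Ξ] [MeasurableSpace Ω] [MeasurableSpace 𝓦]
  {Q : Measure Ξ} [IsProbabilityMeasure Q] {P : Measure Ω} [IsProbabilityMeasure P]
  {g : (Fin d → ℝ) → Ξ → ℝ} {s : ℕ} {q μ L K : ℝ} {bstar : Fin d → ℝ} {α : ℝ}
  {ξ : ℕ → Ω → Ξ} {W : Ω → 𝓦} {b₀ b₀' : Ω → Fin d → ℝ}

theorem Regime.rate_nonneg (R : Regime d s q μ L α) (A : Assumptions Q g s q μ L K bstar) :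
    0 ≤ rate α μ :=
  A.rate_nonneg R.one_le_dim R.two_le_s R.even_s R.two_le_q R.L_pos R.alpha_pos R.alpha_le

/-- Two SGD chains driven by the same samples approach each other geometrically. -/
theorem Assumptions.lpNorm_sgd_sub_sgd_le (A : Assumptions Q g s q μ L K bstar)
    (R : Regime d s q μ L α) (hξ : IsIIDSample P Q ξ) (hW : Measurable W)
    (hind : IndepFun W (fun ω k => ξ k ω) P) (hb : Measurable[history W ξ 0] b₀)
    (hb' : Measurable[history W ξ 0] b₀')
    (h0 : MemLp (fun ω => b₀ ω - b₀' ω) (ENNReal.ofReal q) P) (k : ℕ) :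
    MemLp (fun ω => sgd g α (b₀ ω) (fun i => ξ i ω) k - sgd g α (b₀' ω) (fun i => ξ i ω) k)
        (ENNReal.ofReal q) P ∧
      lpNorm (fun ω => lsNorm s
        (sgd g α (b₀ ω) (fun i => ξ i ω) k - sgd g α (b₀' ω) (fun i => ξ i ω) k))
        (ENNReal.ofReal q) P
      ≤ rate α μ ^ k * lpNorm (fun ω => lsNorm s (b₀ ω - b₀' ω)) (ENNReal.ofReal q) P := by
  have hr := R.rate_nonneg A
  have hs := R.one_le_s
  induction k with
  | zero => exact ⟨h0, by simp [sgd]⟩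
  | succ k ih =>
    obtain ⟨ih1, ih2⟩ := ih
    have m1 := A.measurable_history_sgd (α := α) hb k
    have m2 := A.measurable_history_sgd (α := α) hb' k
    have hXm := measurable_comp_prodMk (F := id) measurable_id m1 m2
    have hXm' := hXm.mono (history_le hW hξ.measurable k) le_rfl
    have hFv : Measurable fun p : ((Fin d → ℝ) × (Fin d → ℝ)) × Ξ =>
        sgdStep g α p.1.1 p.2 - sgdStep g α p.1.2 p.2 :=
      ((A.measurable_sgdStep α).comp ((measurable_fst.comp measurable_fst).prodMk
        measurable_snd)).sub ((A.measurable_sgdStep α).comp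
          ((measurable_snd.comp measurable_fst).prodMk measurable_snd))
    have hN := (continuous_lsNorm (d := d) hs).measurable
    obtain ⟨h1, h2⟩ := memLp_and_lpNorm_le_of_prod hXm' (hξ.measurable k)
      (map_prodMk_sample hξ hW hind hXm) R.q_pos (hN.comp hFv)
      (A := fun x => rate α μ * lsNorm s (x.1 - x.2))
      ((hN.comp (measurable_fst.sub measurable_snd)).const_mul _)
      ((memLp_lsNorm hs ih1).const_mul _)
      (fun x => memLp_lsNorm hs (A.memLp_sgdStep_sub_sgdStep hs x.1 x.2))
      (fun x => A.lpNorm_sgdStep_sub_le R.one_le_dim R.two_le_s R.even_s R.two_le_q R.L_pos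
        R.alpha_pos R.alpha_le x.1 x.2)
    refine ⟨memLp_of_lsNorm hs (hFv.comp (hXm'.prodMk (hξ.measurable k))).aestronglyMeasurable h1,
      h2.trans ?_⟩
    have e := lpNorm_const_smul (p := ENNReal.ofReal q) (rate α μ) (fun ω => lsNorm s
        (sgd g α (b₀ ω) (fun i => ξ i ω) k - sgd g α (b₀' ω) (fun i => ξ i ω) k)) P
    rw [coe_nnnorm, Real.norm_eq_abs, abs_of_nonneg hr] at e
    refine e.le.trans ?_
    rw [pow_succ', mul_assoc]
    exact mul_le_mul_of_nonneg_left ih2 hr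

/-- Moment bound for the distance of the SGD iterates to the minimizer. -/
theorem Assumptions.lpNorm_sgd_sub_min_sq_le (A : Assumptions Q g s q μ L K bstar)
    (R : Regime d s q μ L α) (hξ : IsIIDSample P Q ξ) (hW : Measurable W)
    (hind : IndepFun W (fun ω k => ξ k ω) P) (hb : Measurable[history W ξ 0] b₀)
    (h0 : MemLp (fun ω => b₀ ω - bstar) (ENNReal.ofReal q) P)
    {M : ℝ} (hM : M = (noiseMoment Q g s q bstar).toReal) (k : ℕ) :
    MemLp (fun ω => sgd g α (b₀ ω) (fun i => ξ i ω) k - bstar) (ENNReal.ofReal q) P ∧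
      lpNorm (fun ω => lsNorm s (sgd g α (b₀ ω) (fun i => ξ i ω) k - bstar))
        (ENNReal.ofReal q) P ^ 2
      ≤ rate α μ ^ k * lpNorm (fun ω => lsNorm s (b₀ ω - bstar)) (ENNReal.ofReal q) P ^ 2
        + (1 - rate α μ ^ k) * statVar s q μ M α := by
  have hr := R.rate_nonneg A
  have hr1 := R.rate_lt_one
  have hs := R.one_le_s
  have hT := R.statVar_nonneg M
  induction k with
  | zero => exact ⟨h0, by simp [sgd]⟩
  | succ k ih =>
    obtain ⟨ih1, ih2⟩ := ih
    have hXm := A.measurable_history_sgd (α := α) hb k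
    have hXm' := A.measurable_sgd (α := α) hW hξ.measurable hb k
    have hFv : Measurable fun p : (Fin d → ℝ) × Ξ => sgdStep g α p.1 p.2 - bstar :=
      (A.measurable_sgdStep α).sub measurable_const
    have hN := (continuous_lsNorm (d := d) hs).measurable
    obtain ⟨h1, h2⟩ := memLp_and_lpNorm_sq_le_of_prod hXm' (hξ.measurable k)
      (map_prodMk_sample hξ hW hind hXm) R.two_le_q (hN.comp hFv)
      (G := fun x => √(rate α μ) * lsNorm s (x - bstar))
      (H := fun _ => √((1 - rate α μ) * statVar s q μ M α))
      ((hN.comp (measurable_id.sub measurable_const)).const_mul _) measurable_const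
      ((memLp_lsNorm hs ih1).const_mul _) (memLp_const _)
      (fun x => memLp_lsNorm hs (A.memLp_sgdStep_sub hs x bstar))
      (fun x => by
        rw [mul_pow, Real.sq_sqrt hr, Real.sq_sqrt (mul_nonneg (by linarith) hT)]
        exact A.lpNorm_sgdStep_sub_min_sq_le R.two_le_s R.even_s R.two_le_q R.mu_pos R.L_pos
          R.alpha_pos R.alpha_le hM x)
    refine ⟨memLp_of_lsNorm hs (hFv.comp (hXm'.prodMk (hξ.measurable k))).aestronglyMeasurable h1,
      h2.trans ?_⟩
    have e := lpNorm_const_smul (p := ENNReal.ofReal q) (√(rate α μ)) (fun ω => lsNorm s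
        (sgd g α (b₀ ω) (fun i => ξ i ω) k - bstar)) P
    rw [coe_nnnorm, Real.norm_eq_abs, abs_of_nonneg (Real.sqrt_nonneg _)] at e
    have e' : lpNorm (fun ω => √(rate α μ) * lsNorm s
        (sgd g α (b₀ ω) (fun i => ξ i ω) k - bstar)) (ENNReal.ofReal q) P ^ 2 =
        rate α μ * lpNorm (fun ω => lsNorm s
        (sgd g α (b₀ ω) (fun i => ξ i ω) k - bstar)) (ENNReal.ofReal q) P ^ 2 := by
      rw [← Real.sq_sqrt hr, Real.sqrt_sq (Real.sqrt_nonneg _), ← mul_pow]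
      exact congrArg (· ^ 2) e
    have e2 : lpNorm (fun _ : Ω => √((1 - rate α μ) * statVar s q μ M α))
        (ENNReal.ofReal q) P ^ 2 = (1 - rate α μ) * statVar s q μ M α := by
      rw [lpNorm_const (by simpa using R.q_pos) (IsProbabilityMeasure.ne_zero P)]
      simp [Real.sq_sqrt (mul_nonneg (by linarith : 0 ≤ 1 - rate α μ) hT)]
    rw [e', e2, pow_succ' (rate α μ) k]
    nlinarith [mul_le_mul_of_nonneg_left ih2 hr]

end Chain

/-! ### Mean iterates and one-step fluctuations -/

/-- `f` is Lipschitz with constant `C` for the `ℓ^s`-norm. -/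
def LsLipschitz {d : ℕ} (s : ℕ) (C : ℝ) (f : (Fin d → ℝ) → Fin d → ℝ) : Prop :=
  ∀ b b', lsNorm s (f b - f b') ≤ C * lsNorm s (b - b')

namespace LsLipschitz
variable {d s : ℕ} {C : ℝ} {f : (Fin d → ℝ) → Fin d → ℝ}

theorem sum {ι : Type*} {t : Finset ι} {C : ι → ℝ} {f : ι → (Fin d → ℝ) → Fin d → ℝ} (hs : 1 ≤ s)
    (h : ∀ i ∈ t, LsLipschitz s (C i) (f i)) :
    LsLipschitz s (∑ i ∈ t, C i) (fun b => ∑ i ∈ t, f i b) := by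
  intro b b'
  rw [← Finset.sum_sub_distrib, Finset.sum_mul]
  exact (lsNorm_sum_le hs _ _).trans (Finset.sum_le_sum fun i hi => h i hi b b')

theorem mono {C' : ℝ} (h : LsLipschitz s C f) (hC : C ≤ C') : LsLipschitz s C' f := fun b b' =>
  (h b b').trans (mul_le_mul_of_nonneg_right hC (lsNorm_nonneg _ _))

theorem continuous (hs : 1 ≤ s) (hC : 0 ≤ C) (h : LsLipschitz s C f) : Continuous f :=
  continuous_of_lsNorm_lipschitz hs hC h

theorem memLp_sub (hs : 1 ≤ s) (hC : 0 ≤ C) (h : LsLipschitz s C f) {Ω : Type*}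
    [MeasurableSpace Ω] {P : Measure Ω} {p : ℝ≥0∞} {X Y : Ω → Fin d → ℝ} (hX : Measurable X)
    (hY : Measurable Y) (hXY : MemLp (fun ω => X ω - Y ω) p P) :
    MemLp (fun ω => f (X ω) - f (Y ω)) p P := by
  have hm : Measurable fun ω => f (X ω) - f (Y ω) :=
    ((h.continuous hs hC).measurable.comp hX).sub ((h.continuous hs hC).measurable.comp hY)
  refine ((memLp_lsNorm hs hXY).const_mul C).mono hm.aestronglyMeasurable
    (ae_of_all _ fun ω => ?_)
  exact (norm_le_lsNorm hs _).trans ((h _ _).trans (le_abs_self _))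

theorem memLp_comp (hs : 1 ≤ s) (hC : 0 ≤ C) (h : LsLipschitz s C f) {Ω : Type*}
    [MeasurableSpace Ω] {P : Measure Ω} [IsFiniteMeasure P] {p : ℝ≥0∞} {X : Ω → Fin d → ℝ}
    (hX : Measurable X) (hXp : MemLp X p P) : MemLp (fun ω => f (X ω)) p P := by
  have h1 := h.memLp_sub hs hC (P := P) (p := p) (Y := fun _ => 0) hX measurable_const
    (by simpa using hXp)
  refine (h1.add (memLp_const (f 0))).ae_eq (ae_of_all _ fun ω => ?_)
  simp

end LsLipschitz

/-- The mean `b ↦ E[β_i | β_0 = b]` of the `i`-th SGD iterate as a function of the starting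
point. -/
noncomputable def meanIter {d : ℕ} {Ξ : Type*} [MeasurableSpace Ξ] (Q : Measure Ξ)
    (g : (Fin d → ℝ) → Ξ → ℝ) (α : ℝ) : ℕ → (Fin d → ℝ) → Fin d → ℝ
  | 0 => id
  | i + 1 => fun b => ∫ z, meanIter Q g α i (sgdStep g α b z) ∂Q

/-- The fluctuation `f(β_1) - E f(β_1)` of a function of one SGD step from `b` with sample `z`. -/
noncomputable def stepFluct {d : ℕ} {Ξ : Type*} [MeasurableSpace Ξ] (Q : Measure Ξ)
    (g : (Fin d → ℝ) → Ξ → ℝ) (α : ℝ) (f : (Fin d → ℝ) → Fin d → ℝ) (b : Fin d → ℝ) (z : Ξ) :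
    Fin d → ℝ :=
  f (sgdStep g α b z) - ∫ z', f (sgdStep g α b z') ∂Q

theorem Assumptions.measurable_sgdStep_right {d : ℕ} {Ξ : Type*} [MeasurableSpace Ξ]
    {Q : Measure Ξ} {g : (Fin d → ℝ) → Ξ → ℝ} {s : ℕ} {q μ L K : ℝ} {bstar : Fin d → ℝ} {α : ℝ}
    (A : Assumptions Q g s q μ L K bstar) (b : Fin d → ℝ) : Measurable (sgdStep g α b) :=
  (A.measurable_sgdStep α).comp (measurable_const.prodMk measurable_id)

section Step
variable {d : ℕ} {Ξ : Type*} [MeasurableSpace Ξ] {Q : Measure Ξ} [IsProbabilityMeasure Q]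
  {g : (Fin d → ℝ) → Ξ → ℝ} {s : ℕ} {q μ L K : ℝ} {bstar : Fin d → ℝ} {α C : ℝ}
  {f : (Fin d → ℝ) → Fin d → ℝ}

theorem lsNorm_integral_le_lpNorm {Ω : Type*} [MeasurableSpace Ω] {P : Measure Ω}
    [IsProbabilityMeasure P] (hs : 1 ≤ s) (hq : 1 ≤ q) {X : Ω → Fin d → ℝ}
    (hX : MemLp X (ENNReal.ofReal q) P) :
    lsNorm s (∫ ω, X ω ∂P) ≤ lpNorm (fun ω => lsNorm s (X ω)) (ENNReal.ofReal q) P := by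
  refine (lsNorm_integral_le hs _ (integrable_of_memLp_one_le hq hX)).trans ?_
  refine le_trans (le_of_eq (integral_congr_ae (ae_of_all _ fun x => ?_)))
    (integral_le_lpNorm hq (memLp_lsNorm hs hX))
  exact (abs_of_nonneg (lsNorm_nonneg _ _)).symm

theorem Assumptions.memLp_comp_sgdStep (A : Assumptions Q g s q μ L K bstar) (hs : 1 ≤ s)
    (hC : 0 ≤ C) (hf : LsLipschitz s C f) (b : Fin d → ℝ) :
    MemLp (fun z => f (sgdStep g α b z)) (ENNReal.ofReal q) Q :=
  hf.memLp_comp hs hC (A.measurable_sgdStep_right b) (by simpa using A.memLp_sgdStep_sub hs b 0)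

/-- Averaging over one SGD step improves the Lipschitz constant by the contraction factor. -/
theorem Assumptions.lsLipschitz_integral_sgdStep (A : Assumptions Q g s q μ L K bstar)
    (R : Regime d s q μ L α) (hC : 0 ≤ C) (hf : LsLipschitz s C f) :
    LsLipschitz s (C * rate α μ) fun b => ∫ z, f (sgdStep g α b z) ∂Q := by
  intro b b'
  have hs := R.one_le_s
  have h1 := fun b => A.memLp_comp_sgdStep (α := α) hs hC hf b
  rw [← integral_sub (integrable_of_memLp_one_le R.one_le_q (h1 b))
    (integrable_of_memLp_one_le R.one_le_q (h1 b'))]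
  refine (lsNorm_integral_le_lpNorm hs R.one_le_q ((h1 b).sub (h1 b'))).trans ?_
  have h2 := memLp_lsNorm hs (A.memLp_sgdStep_sub_sgdStep (α := α) hs b b')
  have e := lpNorm_const_smul (p := ENNReal.ofReal q) C
    (fun z => lsNorm s (sgdStep g α b z - sgdStep g α b' z)) Q
  rw [coe_nnnorm, Real.norm_eq_abs, abs_of_nonneg hC] at e
  refine (lpNorm_mono_real (h2.const_mul C) fun z => ?_).trans (e.le.trans ?_)
  · rw [Real.norm_eq_abs, abs_of_nonneg (lsNorm_nonneg _ _)]
    exact hf _ _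
  · rw [mul_assoc]
    exact mul_le_mul_of_nonneg_left (A.lpNorm_sgdStep_sub_le R.one_le_dim R.two_le_s R.even_s
      R.two_le_q R.L_pos R.alpha_pos R.alpha_le b b') hC

theorem Assumptions.lsLipschitz_meanIter (A : Assumptions Q g s q μ L K bstar)
    (R : Regime d s q μ L α) (i : ℕ) : LsLipschitz s (rate α μ ^ i) (meanIter Q g α i) := by
  induction i with
  | zero => intro b b'; simp [meanIter]
  | succ i ih =>
    have := A.lsLipschitz_integral_sgdStep R (pow_nonneg (R.rate_nonneg A) i) ih
    rw [← pow_succ] at this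
    exact this

theorem sum_rate_pow_le {r : ℝ} (h0 : 0 ≤ r) (h1 : r < 1) (n : ℕ) :
    ∑ i ∈ Finset.range n, r ^ i ≤ (1 - r)⁻¹ := by
  rw [← tsum_geometric_of_lt_one h0 h1]
  exact (summable_geometric_of_lt_one h0 h1).sum_le_tsum _ fun i _ => pow_nonneg h0 i

theorem Regime.one_sub_rate_inv (R : Regime d s q μ L α) : (1 - rate α μ)⁻¹ = 21 / (α * μ) := by
  have := R.alpha_pos
  have := R.mu_pos
  rw [rate]; field_simp; ring

/-- The partial sums of the mean iterates are Lipschitz uniformly in the number of summands. -/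
theorem Assumptions.lsLipschitz_sum_meanIter (A : Assumptions Q g s q μ L K bstar)
    (R : Regime d s q μ L α) (n : ℕ) :
    LsLipschitz s (21 / (α * μ)) fun b => ∑ i ∈ Finset.range n, meanIter Q g α i b :=
  (LsLipschitz.sum R.one_le_s fun i _ => A.lsLipschitz_meanIter R i).mono
    ((sum_rate_pow_le (R.rate_nonneg A) R.rate_lt_one n).trans R.one_sub_rate_inv.le)

theorem Assumptions.lsLipschitz_sum_meanIter_succ (A : Assumptions Q g s q μ L K bstar)
    (R : Regime d s q μ L α) (n : ℕ) :
    LsLipschitz s (21 / (α * μ)) fun b => ∑ i ∈ Finset.range n, meanIter Q g α (i + 1) b := by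
  have hr := R.rate_nonneg A
  refine (LsLipschitz.sum R.one_le_s fun i _ => A.lsLipschitz_meanIter R (i + 1)).mono
    (le_trans ?_ ((sum_rate_pow_le hr R.rate_lt_one n).trans R.one_sub_rate_inv.le))
  refine Finset.sum_le_sum fun i _ => ?_
  rw [pow_succ]
  exact mul_le_of_le_one_right (pow_nonneg hr i) R.rate_lt_one.le

theorem Assumptions.memLp_stepFluct (A : Assumptions Q g s q μ L K bstar) (hs : 1 ≤ s)
    (hC : 0 ≤ C) (hf : LsLipschitz s C f) (b : Fin d → ℝ) :
    MemLp (stepFluct Q g α f b) (ENNReal.ofReal q) Q :=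
  (A.memLp_comp_sgdStep hs hC hf b).sub (memLp_const _)

theorem Assumptions.integral_stepFluct (A : Assumptions Q g s q μ L K bstar)
    (hs : 1 ≤ s) (hq : 1 ≤ q) (hC : 0 ≤ C) (hf : LsLipschitz s C f) (b : Fin d → ℝ) :
    ∫ z, stepFluct Q g α f b z ∂Q = 0 := by
  simp only [stepFluct]
  rw [integral_sub (integrable_of_memLp_one_le hq (A.memLp_comp_sgdStep hs hC hf b))
    (integrable_const _)]
  simp

theorem Assumptions.measurable_stepFluct (A : Assumptions Q g s q μ L K bstar)
    (hf : Measurable f) :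
    Measurable fun p : (Fin d → ℝ) × Ξ => stepFluct Q g α f p.1 p.2 := by
  have h1 : Measurable fun p : (Fin d → ℝ) × Ξ => f (sgdStep g α p.1 p.2) :=
    hf.comp (A.measurable_sgdStep α)
  have h2 : StronglyMeasurable fun b => ∫ z', f (sgdStep g α b z') ∂Q :=
    h1.stronglyMeasurable.integral_prod_right'
  exact h1.sub (h2.measurable.comp measurable_fst)

/-- The fluctuation of a Lipschitz function is at most twice the length of the step, times the
Lipschitz constant. -/
theorem Assumptions.lpNorm_stepFluct_le (A : Assumptions Q g s q μ L K bstar)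
    (R : Regime d s q μ L α) (hC : 0 ≤ C) (hf : LsLipschitz s C f)
    {M : ℝ} (hM : M = (noiseMoment Q g s q bstar).toReal) (b : Fin d → ℝ) :
    lpNorm (fun z => lsNorm s (stepFluct Q g α f b z)) (ENNReal.ofReal q) Q
      ≤ 2 * C * α * (M + L * lsNorm s (b - bstar)) := by
  have hs := R.one_le_s
  have hq := R.one_le_q
  have hY : MemLp (fun z => f (sgdStep g α b z) - f b) (ENNReal.ofReal q) Q :=
    (A.memLp_comp_sgdStep hs hC hf b).sub (memLp_const _)
  have hNY := memLp_lsNorm hs hY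
  have h1 : lpNorm (fun z => lsNorm s (f (sgdStep g α b z) - f b)) (ENNReal.ofReal q) Q
      ≤ C * α * (M + L * lsNorm s (b - bstar)) := by
    have h2 := memLp_lsNorm hs (A.memLp_stochGrad hs b)
    have e := lpNorm_const_smul (p := ENNReal.ofReal q) (C * α)
      (fun z => lsNorm s (stochGrad g b z)) Q
    rw [coe_nnnorm, Real.norm_eq_abs, abs_of_nonneg (mul_nonneg hC R.alpha_pos.le)] at e
    refine (lpNorm_mono_real (h2.const_mul (C * α)) fun z => ?_).trans (e.le.trans ?_)
    · rw [Real.norm_eq_abs, abs_of_nonneg (lsNorm_nonneg _ _)]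
      refine (hf _ _).trans (le_of_eq ?_)
      rw [sgdStep, sub_sub_cancel_left, lsNorm_neg, lsNorm_smul hs, abs_of_pos R.alpha_pos,
        mul_assoc]
    · rw [hM]
      exact mul_le_mul_of_nonneg_left (A.lpNorm_stochGrad_le hs hq R.L_pos.le b)
        (mul_nonneg hC R.alpha_pos.le)
  set c := lsNorm s (∫ z, (f (sgdStep g α b z) - f b) ∂Q) with hc
  have hc1 : c ≤ lpNorm (fun z => lsNorm s (f (sgdStep g α b z) - f b)) (ENNReal.ofReal q) Q :=
    lsNorm_integral_le_lpNorm hs hq hY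
  have hconst : lpNorm (fun _ : Ξ => c) (ENNReal.ofReal q) Q = c := by
    rw [lpNorm_const (by simpa using R.q_pos) (IsProbabilityMeasure.ne_zero Q)]
    simp [abs_of_nonneg (lsNorm_nonneg s _), c]
  have h3 : lpNorm (fun z => lsNorm s (stepFluct Q g α f b z)) (ENNReal.ofReal q) Q ≤
      lpNorm (fun z => lsNorm s (f (sgdStep g α b z) - f b)) (ENNReal.ofReal q) Q + c := by
    refine le_trans (lpNorm_mono_real (hNY.add (memLp_const c)) fun z => ?_)
      ((lpNorm_add_le hNY (one_le_ofReal hq)).trans (by rw [hconst]))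
    rw [Real.norm_eq_abs, abs_of_nonneg (lsNorm_nonneg _ _)]
    refine le_trans (le_of_eq ?_) (lsNorm_sub_le hs _ _)
    rw [integral_sub (integrable_of_memLp_one_le hq (A.memLp_comp_sgdStep hs hC hf b))
      (integrable_const _)]
    simp [stepFluct]
  linarith

end Step

/-! ### Martingale decomposition of the sum of the iterates -/

/-- The conditional expectation of `∑_{i=1}^k β_i` given the first `j` samples, for `j ≤ k`. -/
noncomputable def condSum {d : ℕ} {Ξ : Type*} [MeasurableSpace Ξ] (Q : Measure Ξ)
    (g : (Fin d → ℝ) → Ξ → ℝ) (α : ℝ) (b : Fin d → ℝ) (x : ℕ → Ξ) (k j : ℕ) : Fin d → ℝ :=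
  ∑ i ∈ Finset.Icc 1 j, sgd g α b x i
    + ∑ i ∈ Finset.range (k - j), meanIter Q g α (i + 1) (sgd g α b x j)

section Martingale
variable {d : ℕ} {Ξ Ω 𝓦 : Type*} [MeasurableSpace Ξ] [MeasurableSpace Ω] [MeasurableSpace 𝓦]
  {Q : Measure Ξ} [IsProbabilityMeasure Q] {P : Measure Ω} [IsProbabilityMeasure P]
  {g : (Fin d → ℝ) → Ξ → ℝ} {s : ℕ} {q μ L K : ℝ} {bstar : Fin d → ℝ} {α : ℝ}
  {ξ : ℕ → Ω → Ξ} {W : Ω → 𝓦} {b₀ : Ω → Fin d → ℝ}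

/-- The increments of `condSum` are fluctuations of a uniformly Lipschitz function of the next
iterate. -/
theorem Assumptions.condSum_succ (A : Assumptions Q g s q μ L K bstar) (R : Regime d s q μ L α)
    (b : Fin d → ℝ) (x : ℕ → Ξ) {k j : ℕ} (hj : j < k) :
    condSum Q g α b x k (j + 1) = condSum Q g α b x k j
      + stepFluct Q g α (fun b => ∑ i ∈ Finset.range (k - j), meanIter Q g α i b)
        (sgd g α b x j) (x j) := by
  obtain ⟨n, hn⟩ : ∃ n, k - j = n + 1 := ⟨k - j - 1, by omega⟩
  have hn' : k - (j + 1) = n := by omega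
  have hint : ∫ z, ∑ i ∈ Finset.range (n + 1),
        meanIter Q g α i (sgdStep g α (sgd g α b x j) z) ∂Q
      = ∑ i ∈ Finset.range (n + 1), meanIter Q g α (i + 1) (sgd g α b x j) := by
    rw [integral_finsetSum _ fun i _ => integrable_of_memLp_one_le R.one_le_q
      (A.memLp_comp_sgdStep R.one_le_s (pow_nonneg (R.rate_nonneg A) i)
        (A.lsLipschitz_meanIter R i) _)]
    rfl
  rw [condSum, condSum, hn, hn', stepFluct, hint, Finset.sum_Icc_succ_top (by omega),
    Finset.sum_range_succ' (fun i => meanIter Q g α i _)]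
  change _ + sgdStep g α (sgd g α b x j) (x j) + _ = _ + (_ + sgdStep g α (sgd g α b x j) (x j) - _)
  simp only [sgd]
  abel

/-- One step of the martingale moment bound: adding a conditionally centred fluctuation increases
the square of the `L^q(ℓ^s)`-norm at most by a multiple of `max{q, s}`. -/
theorem Assumptions.lpNorm_add_stepFluct_sq_le (A : Assumptions Q g s q μ L K bstar)
    (R : Regime d s q μ L α) (hξ : IsIIDSample P Q ξ) (hW : Measurable W)
    (hind : IndepFun W (fun ω k => ξ k ω) P) (hb : Measurable[history W ξ 0] b₀)
    {M : ℝ} (hM : M = (noiseMoment Q g s q bstar).toReal) {k : ℕ} {σ : ℝ}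
    (hβ : MemLp (fun ω => sgd g α (b₀ ω) (fun i => ξ i ω) k - bstar) (ENNReal.ofReal q) P)
    (hσ : lpNorm (fun ω => lsNorm s (sgd g α (b₀ ω) (fun i => ξ i ω) k - bstar))
        (ENNReal.ofReal q) P ≤ σ)
    {C : ℝ} (hC : 0 ≤ C) {f : (Fin d → ℝ) → Fin d → ℝ} (hf : LsLipschitz s C f)
    {S : Ω → Fin d → ℝ} (hS : Measurable[history W ξ k] S) (hSp : MemLp S (ENNReal.ofReal q) P) :
    MemLp (fun ω => S ω + stepFluct Q g α f (sgd g α (b₀ ω) (fun i => ξ i ω) k) (ξ k ω))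
        (ENNReal.ofReal q) P ∧
      lpNorm (fun ω => lsNorm s
        (S ω + stepFluct Q g α f (sgd g α (b₀ ω) (fun i => ξ i ω) k) (ξ k ω)))
        (ENNReal.ofReal q) P ^ 2
      ≤ lpNorm (fun ω => lsNorm s (S ω)) (ENNReal.ofReal q) P ^ 2
        + 20 / 3 * max q s * (2 * C * α * (M + L * σ)) ^ 2 ∧
      ∫ ω, (S ω + stepFluct Q g α f (sgd g α (b₀ ω) (fun i => ξ i ω) k) (ξ k ω)) ∂P
        = ∫ ω, S ω ∂P := by
  have hs := R.one_le_s
  have hq := R.one_le_q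
  have hα := R.alpha_pos
  have hL := R.L_pos
  have hp := R.max_pos
  have hM0 : 0 ≤ M := hM ▸ ENNReal.toReal_nonneg
  have hXm := measurable_comp_prodMk (F := id) measurable_id hS
    (A.measurable_history_sgd (α := α) hb k)
  have hXm' := hXm.mono (history_le hW hξ.measurable k) le_rfl
  have hfm := (hf.continuous hs hC).measurable
  have hD := A.measurable_stepFluct (α := α) hfm
  have hFv : Measurable fun p : ((Fin d → ℝ) × (Fin d → ℝ)) × Ξ =>
      p.1.1 + stepFluct Q g α f p.1.2 p.2 :=
    (measurable_fst.comp measurable_fst).add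
      (hD.comp ((measurable_snd.comp measurable_fst).prodMk measurable_snd))
  have hN := (continuous_lsNorm (d := d) hs).measurable
  have hlaw := map_prodMk_sample hξ hW hind hXm
  have hfl := fun b => A.memLp_stepFluct (α := α) hs hC hf b
  set c := √(20 / 3 * max q (s : ℝ)) * (2 * C * α) with hc
  have hc0 : 0 ≤ c := by positivity
  have hNβ := memLp_lsNorm hs hβ
  have hHX : MemLp (fun ω => c * (M + L * lsNorm s (sgd g α (b₀ ω) (fun i => ξ i ω) k - bstar)))
      (ENNReal.ofReal q) P := ((memLp_const M).add (hNβ.const_mul L)).const_mul c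
  obtain ⟨h1, h2⟩ := memLp_and_lpNorm_sq_le_of_prod hXm' (hξ.measurable k) hlaw R.two_le_q
    (hN.comp hFv) (G := fun x => lsNorm s x.1)
    (H := fun x => c * (M + L * lsNorm s (x.2 - bstar)))
    (hN.comp measurable_fst)
    (((measurable_const).add ((hN.comp (measurable_snd.sub measurable_const)).const_mul L)).const_mul
      c) (memLp_lsNorm hs hSp) hHX
    (fun x => memLp_lsNorm hs ((memLp_const x.1).add (hfl x.2)))
    (fun x => by
      have h := lpNorm_lsNorm_add_sq_le R.two_le_s R.even_s R.two_le_q x.1 (hfl x.2)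
      rw [A.integral_stepFluct hs hq hC hf] at h
      refine h.trans ?_
      have e0 : lsDual s x.1 0 = 0 := by simp [lsDual]
      have h3 := pow_le_pow_left₀ lpNorm_nonneg (A.lpNorm_stepFluct_le R hC hf hM x.2) 2
      rw [e0, hc, mul_pow, mul_pow, Real.sq_sqrt (by positivity), mul_zero, add_zero]
      refine add_le_add_right ?_ _
      rw [mul_assoc (20 / 3 * max q (s : ℝ)), ← mul_pow]
      exact mul_le_mul_of_nonneg_left h3 (by positivity))
  have hmem := memLp_of_lsNorm hs (hFv.comp (hXm'.prodMk (hξ.measurable k))).aestronglyMeasurable h1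
  refine ⟨hmem, h2.trans (add_le_add_right ?_ _), ?_⟩
  · have h4 : lpNorm (fun ω => c * (M + L * lsNorm s
        (sgd g α (b₀ ω) (fun i => ξ i ω) k - bstar))) (ENNReal.ofReal q) P ≤ c * (M + L * σ) := by
      have e1 := lpNorm_const_smul (p := ENNReal.ofReal q) c
        (fun ω => M + L * lsNorm s (sgd g α (b₀ ω) (fun i => ξ i ω) k - bstar)) P
      rw [coe_nnnorm, Real.norm_eq_abs, abs_of_nonneg hc0] at e1
      refine e1.le.trans (mul_le_mul_of_nonneg_left ?_ hc0)
      have e2 := lpNorm_const_smul (p := ENNReal.ofReal q) L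
        (fun ω => lsNorm s (sgd g α (b₀ ω) (fun i => ξ i ω) k - bstar)) P
      rw [coe_nnnorm, Real.norm_eq_abs, abs_of_nonneg hL.le] at e2
      have hconst : lpNorm (fun _ : Ω => M) (ENNReal.ofReal q) P = M := by
        rw [lpNorm_const (by simpa using R.q_pos) (IsProbabilityMeasure.ne_zero P)]
        simp [abs_of_nonneg hM0]
      refine (lpNorm_add_le (memLp_const M) (one_le_ofReal hq)).trans ?_
      rw [hconst]
      exact add_le_add_right (e2.le.trans (mul_le_mul_of_nonneg_left hσ hL.le)) _
    refine (pow_le_pow_left₀ lpNorm_nonneg h4 2).trans (le_of_eq ?_)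
    rw [hc, mul_pow, mul_pow, Real.sq_sqrt (by positivity)]
    ring
  · have h5 := integral_comp_of_prod hXm' (hξ.measurable k) hlaw hFv
      (integrable_of_memLp_one_le hq hmem)
    refine h5.trans (integral_congr_ae (ae_of_all _ fun ω => ?_))
    simp only
    rw [integral_add (integrable_const _) (integrable_of_memLp_one_le hq (hfl _)),
      A.integral_stepFluct hs hq hC hf]
    simp

/-- Martingale bound for the sum of the iterates around its conditional mean given the starting
point. -/
theorem Assumptions.lpNorm_condSum_sub_sq_le (A : Assumptions Q g s q μ L K bstar)
    (R : Regime d s q μ L α) (hξ : IsIIDSample P Q ξ) (hW : Measurable W)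
    (hind : IndepFun W (fun ω k => ξ k ω) P) (hb : Measurable[history W ξ 0] b₀)
    {M : ℝ} (hM : M = (noiseMoment Q g s q bstar).toReal) {σ : ℝ}
    (hβ : ∀ k, MemLp (fun ω => sgd g α (b₀ ω) (fun i => ξ i ω) k - bstar) (ENNReal.ofReal q) P)
    (hσ : ∀ k, lpNorm (fun ω => lsNorm s (sgd g α (b₀ ω) (fun i => ξ i ω) k - bstar))
        (ENNReal.ofReal q) P ≤ σ) {k : ℕ} (j : ℕ) (hj : j ≤ k) :
    Measurable[history W ξ j] (fun ω => condSum Q g α (b₀ ω) (fun i => ξ i ω) k j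
        - condSum Q g α (b₀ ω) (fun i => ξ i ω) k 0) ∧
      MemLp (fun ω => condSum Q g α (b₀ ω) (fun i => ξ i ω) k j
        - condSum Q g α (b₀ ω) (fun i => ξ i ω) k 0) (ENNReal.ofReal q) P ∧
      lpNorm (fun ω => lsNorm s (condSum Q g α (b₀ ω) (fun i => ξ i ω) k j
        - condSum Q g α (b₀ ω) (fun i => ξ i ω) k 0)) (ENNReal.ofReal q) P ^ 2
      ≤ j * (20 / 3 * max q s * (42 / μ * (M + L * σ)) ^ 2) ∧
      ∫ ω, (condSum Q g α (b₀ ω) (fun i => ξ i ω) k j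
        - condSum Q g α (b₀ ω) (fun i => ξ i ω) k 0) ∂P = 0 := by
  have hα := R.alpha_pos
  have hμ := R.mu_pos
  induction j with
  | zero =>
    simp only [sub_self]
    exact ⟨measurable_const, MemLp.zero', by simp [lsNorm_zero R.one_le_s], by simp⟩
  | succ j ih =>
    obtain ⟨i1, i2, i3, i4⟩ := ih (by omega)
    have hC : 0 ≤ 21 / (α * μ) := by positivity
    have hf := A.lsLipschitz_sum_meanIter R (k - j)
    have e2 : ∀ ω, condSum Q g α (b₀ ω) (fun i => ξ i ω) k (j + 1)
        - condSum Q g α (b₀ ω) (fun i => ξ i ω) k 0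
      = (condSum Q g α (b₀ ω) (fun i => ξ i ω) k j
        - condSum Q g α (b₀ ω) (fun i => ξ i ω) k 0) + stepFluct Q g α
          (fun b => ∑ i ∈ Finset.range (k - j), meanIter Q g α i b)
          (sgd g α (b₀ ω) (fun i => ξ i ω) j) (ξ j ω) := by
      intro ω
      rw [A.condSum_succ R _ _ (by omega : j < k)]
      abel
    obtain ⟨h1, h2, h3⟩ := A.lpNorm_add_stepFluct_sq_le R hξ hW hind hb hM (hβ j) (hσ j) hC hf
      i1 i2
    have hm : Measurable[history W ξ (j + 1)] fun ω => (condSum Q g α (b₀ ω) (fun i => ξ i ω) k j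
        - condSum Q g α (b₀ ω) (fun i => ξ i ω) k 0) + stepFluct Q g α
          (fun b => ∑ i ∈ Finset.range (k - j), meanIter Q g α i b)
          (sgd g α (b₀ ω) (fun i => ξ i ω) j) (ξ j ω) := by
      have m1 := i1.mono (history_mono j.le_succ) le_rfl
      have m2 := measurable_comp_prodMk
        (A.measurable_stepFluct (α := α) (hf.continuous R.one_le_s hC).measurable)
        ((A.measurable_history_sgd (α := α) hb j).mono (history_mono j.le_succ) le_rfl)
        (measurable_history_sample j.lt_succ_self)
      exact measurable_comp_prodMk (F := fun p : (Fin d → ℝ) × (Fin d → ℝ) => p.1 + p.2)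
        (measurable_fst.add measurable_snd) m1 m2
    simp only [e2]
    refine ⟨hm, h1, h2.trans ?_, h3.trans i4⟩
    have e3 : 2 * (21 / (α * μ)) * α = 42 / μ := by field_simp; ring
    rw [e3]
    push_cast
    linarith

/-- The averaged iterates concentrate around their mean: the martingale part is of order
`√(k max{q, s})`, and the dependence on the starting point is of the order of its spread
divided by `α`. -/
theorem Assumptions.lpNorm_sum_sgd_sub_le (A : Assumptions Q g s q μ L K bstar)
    (R : Regime d s q μ L α) (hξ : IsIIDSample P Q ξ) (hW : Measurable W)
    (hind : IndepFun W (fun ω k => ξ k ω) P) (hb : Measurable[history W ξ 0] b₀)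
    {M : ℝ} (hM : M = (noiseMoment Q g s q bstar).toReal) {σ : ℝ}
    (hβ : ∀ k, MemLp (fun ω => sgd g α (b₀ ω) (fun i => ξ i ω) k - bstar) (ENNReal.ofReal q) P)
    (hσ : ∀ k, lpNorm (fun ω => lsNorm s (sgd g α (b₀ ω) (fun i => ξ i ω) k - bstar))
        (ENNReal.ofReal q) P ≤ σ) (k : ℕ) :
    lpNorm (fun ω => lsNorm s (∑ i ∈ Finset.Icc 1 k, sgd g α (b₀ ω) (fun i => ξ i ω) i
        - ∑ i ∈ Finset.Icc 1 k, ∫ ω, sgd g α (b₀ ω) (fun i => ξ i ω) i ∂P)) (ENNReal.ofReal q) P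
      ≤ √k * (√(20 / 3 * max q s) * (42 / μ * (M + L * σ))) + 42 / (α * μ) * σ := by
  have hs := R.one_le_s
  have hq := R.one_le_q
  have hα := R.alpha_pos
  have hμ := R.mu_pos
  have hL := R.L_pos
  have hp := R.max_pos
  have hM0 : 0 ≤ M := hM ▸ ENNReal.toReal_nonneg
  have hσ0 : 0 ≤ σ := lpNorm_nonneg.trans (hσ 0)
  obtain ⟨h1, h2, h3, h4⟩ := A.lpNorm_condSum_sub_sq_le R hξ hW hind hb hM hβ hσ k le_rfl
  have hC : 0 ≤ 21 / (α * μ) := by positivity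
  have hΦ := A.lsLipschitz_sum_meanIter_succ R k
  set Φ : (Fin d → ℝ) → Fin d → ℝ := fun b => ∑ i ∈ Finset.range k, meanIter Q g α (i + 1) b
    with hΦdef
  have ek : ∀ b x, condSum Q g α b x k k = ∑ i ∈ Finset.Icc 1 k, sgd g α b x i := fun b x => by
    simp [condSum]
  have e0 : ∀ b x, condSum Q g α b x k 0 = Φ b := fun b x => by simp [condSum, Φ, sgd]
  simp only [ek, e0] at h2 h3 h4
  have hbm : Measurable b₀ := hb.mono (history_le hW hξ.measurable 0) le_rfl
  have hb0 : MemLp (fun ω => b₀ ω - bstar) (ENNReal.ofReal q) P := hβ 0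
  have hσ1 : lpNorm (fun ω => lsNorm s (b₀ ω - bstar)) (ENNReal.ofReal q) P ≤ σ := hσ 0
  have hΦ1 : MemLp (fun ω => Φ (b₀ ω) - Φ bstar) (ENNReal.ofReal q) P :=
    hΦ.memLp_sub hs hC hbm measurable_const hb0
  have hint : ∀ i, Integrable (fun ω => sgd g α (b₀ ω) (fun i => ξ i ω) i) P := fun i => by
    have := (integrable_of_memLp_one_le hq (hβ i)).add (integrable_const bstar)
    refine this.congr (ae_of_all _ fun ω => ?_)
    simp
  -- the mean of the sum of the iterates is the mean of its conditional mean
  have hmean : ∑ i ∈ Finset.Icc 1 k, ∫ ω, sgd g α (b₀ ω) (fun i => ξ i ω) i ∂P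
      = ∫ ω, (Φ (b₀ ω) - Φ bstar) ∂P + Φ bstar := by
    have hΦint : Integrable (fun ω => Φ (b₀ ω)) P := by
      refine ((integrable_of_memLp_one_le hq hΦ1).add (integrable_const (Φ bstar))).congr
        (ae_of_all _ fun ω => ?_)
      simp
    rw [integral_sub (integrable_finsetSum _ fun i _ => hint i) hΦint, sub_eq_zero,
      integral_finsetSum _ fun i _ => hint i] at h4
    rw [h4, integral_sub hΦint (integrable_const _)]
    simp
  have hNΦ := memLp_lsNorm hs hΦ1
  have hΦσ : lpNorm (fun ω => lsNorm s (Φ (b₀ ω) - Φ bstar)) (ENNReal.ofReal q) P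
      ≤ 21 / (α * μ) * σ := by
    have e := lpNorm_const_smul (p := ENNReal.ofReal q) (21 / (α * μ))
      (fun ω => lsNorm s (b₀ ω - bstar)) P
    rw [coe_nnnorm, Real.norm_eq_abs, abs_of_nonneg hC] at e
    refine (lpNorm_mono_real ((memLp_lsNorm hs hb0).const_mul (21 / (α * μ))) fun ω => ?_).trans
      (e.le.trans (mul_le_mul_of_nonneg_left hσ1 hC))
    rw [Real.norm_eq_abs, abs_of_nonneg (lsNorm_nonneg _ _)]
    exact hΦ _ _
  set c := lsNorm s (∫ ω, (Φ (b₀ ω) - Φ bstar) ∂P) with hc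
  have hc1 : c ≤ 21 / (α * μ) * σ := (lsNorm_integral_le_lpNorm hs hq hΦ1).trans hΦσ
  have hconst : lpNorm (fun _ : Ω => c) (ENNReal.ofReal q) P = c := by
    rw [lpNorm_const (by simpa using R.q_pos) (IsProbabilityMeasure.ne_zero P)]
    simp [abs_of_nonneg (lsNorm_nonneg s _), c]
  have h3' : lpNorm (fun ω => lsNorm s (∑ i ∈ Finset.Icc 1 k, sgd g α (b₀ ω) (fun i => ξ i ω) i
      - Φ (b₀ ω))) (ENNReal.ofReal q) P ≤ √k * (√(20 / 3 * max q s) * (42 / μ * (M + L * σ))) := by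
    refine le_of_pow_le_pow_left₀ two_ne_zero (by positivity) (h3.trans (le_of_eq ?_))
    have e : (√k * (√(20 / 3 * max q (s : ℝ)) * (42 / μ * (M + L * σ)))) ^ 2
        = √k ^ 2 * (√(20 / 3 * max q (s : ℝ)) ^ 2 * (42 / μ * (M + L * σ)) ^ 2) := by ring
    rw [e, Real.sq_sqrt (by positivity), Real.sq_sqrt (by positivity)]
  have hN2 := memLp_lsNorm hs h2
  have hsum : lpNorm (fun ω => lsNorm s (∑ i ∈ Finset.Icc 1 k, sgd g α (b₀ ω) (fun i => ξ i ω) i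
      - ∑ i ∈ Finset.Icc 1 k, ∫ ω, sgd g α (b₀ ω) (fun i => ξ i ω) i ∂P)) (ENNReal.ofReal q) P ≤
      lpNorm (fun ω => lsNorm s (∑ i ∈ Finset.Icc 1 k, sgd g α (b₀ ω) (fun i => ξ i ω) i
      - Φ (b₀ ω))) (ENNReal.ofReal q) P +
      (lpNorm (fun ω => lsNorm s (Φ (b₀ ω) - Φ bstar)) (ENNReal.ofReal q) P + c) := by
    have a1 := lpNorm_add_le (g := fun _ : Ω => c) hNΦ (one_le_ofReal hq)
    rw [hconst] at a1
    refine le_trans (lpNorm_mono_real (hN2.add (hNΦ.add (memLp_const c))) fun ω => ?_)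
      ((lpNorm_add_le hN2 (one_le_ofReal hq)).trans (add_le_add_right a1 _))
    rw [Real.norm_eq_abs, abs_of_nonneg (lsNorm_nonneg _ _), hmean]
    have e : ∑ i ∈ Finset.Icc 1 k, sgd g α (b₀ ω) (fun i => ξ i ω) i
        - (∫ ω, (Φ (b₀ ω) - Φ bstar) ∂P + Φ bstar)
      = (∑ i ∈ Finset.Icc 1 k, sgd g α (b₀ ω) (fun i => ξ i ω) i - Φ (b₀ ω))
        + ((Φ (b₀ ω) - Φ bstar) - ∫ ω, (Φ (b₀ ω) - Φ bstar) ∂P) := by abel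
    rw [e]
    exact (lsNorm_add_le hs _ _).trans (add_le_add_right (lsNorm_sub_le hs _ _) _)
  have e4 : 42 / (α * μ) * σ = 21 / (α * μ) * σ + 21 / (α * μ) * σ := by ring
  rw [e4]
  exact hsum.trans (add_le_add h3' (add_le_add hΦσ hc1))

end Martingale

/-! ### Linearization of the gradient and bias -/

section Taylor
variable {d : ℕ} {f G : (Fin d → ℝ) → ℝ}

theorem fderiv_apply_eq_sum_pd (f : (Fin d → ℝ) → ℝ) (b x : Fin d → ℝ) :
    fderiv ℝ f b x = ∑ l, x l * pd l f b := by
  conv_lhs => rw [pi_eq_sum_univ' x, map_sum]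
  refine Finset.sum_congr rfl fun l _ => ?_
  rw [map_smul, smul_eq_mul, pd]

/-- Symmetry of second derivatives.  Differentiability of all partial derivatives makes `fderiv ℝ f`
differentiable, as the dimension is finite. -/
theorem TwiceDiff.pd_comm (hf : TwiceDiff f) (i j : Fin d) : pd i (pd j f) = pd j (pd i f) := by
  funext b
  have hd : Differentiable ℝ (fderiv ℝ f) := by
    have e : fderiv ℝ f = fun y => ∑ l, pd l f y • ContinuousLinearMap.proj (R := ℝ) l := by
      funext y
      ext x
      rw [fderiv_apply_eq_sum_pd]
      simp [mul_comm]
    rw [e]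
    exact Differentiable.fun_sum fun l _ => (hf.2 l).smul_const _
  have h := second_derivative_symmetric (fun y => (hf.1 y).hasFDerivAt) (hd b).hasFDerivAt
    (Pi.single i 1) (Pi.single j 1)
  have e : ∀ m n : Fin d, pd m (pd n f) b
      = fderiv ℝ (fderiv ℝ f) b (Pi.single m 1) (Pi.single n 1) := fun m n => by
    have h1 : HasFDerivAt (pd n f) _ b :=
      (hd b).hasFDerivAt.clm_apply (hasFDerivAt_const (Pi.single n (1 : ℝ) : Fin d → ℝ) b)
    rw [pd, h1.fderiv]
    simp
  rw [e, e, h]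

theorem hasDerivAt_comp_line (hf : Differentiable ℝ f) (b x : Fin d → ℝ) (t : ℝ) :
    HasDerivAt (fun t : ℝ => f (b + t • x)) (∑ l, x l * pd l f (b + t • x)) t := by
  have h1 : HasDerivAt (fun t : ℝ => b + t • x) x t := by
    simpa using ((hasDerivAt_id t).smul_const x).const_add b
  rw [← fderiv_apply_eq_sum_pd]
  exact (hf (b + t • x)).hasFDerivAt.comp_hasDerivAt t h1

/-- Schur's test for the third derivatives: their row sums bound the quadratic form. -/
theorem ThirdDerivBound.abs_quadratic_le {K : ℝ} (hG : ThriceDiff G) (hK : ThirdDerivBound K G)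
    (i : Fin d) (b x : Fin d → ℝ) :
    |∑ l, x l * ∑ r, x r * pd r (pd l (pd i G)) b| ≤ K * ∑ l, x l ^ 2 := by
  have hT : ∀ j, TwiceDiff (pd j G) := fun j => ⟨hG.1.2 j, fun l => hG.2 l j⟩
  have s1 : ∀ l, ∑ r, |pd r (pd l (pd i G)) b| ≤ K := fun l => by
    refine le_trans (le_of_eq (Finset.sum_congr rfl fun r _ => ?_)) (hK b l i)
    rw [(hT i).pd_comm r l, hG.1.pd_comm r i]
  have s2 : ∀ r, ∑ l, |pd r (pd l (pd i G)) b| ≤ K := fun r => by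
    refine le_trans (le_of_eq (Finset.sum_congr rfl fun l _ => ?_)) (hK b r i)
    rw [hG.1.pd_comm l i]
  have hle : |∑ l, x l * ∑ r, x r * pd r (pd l (pd i G)) b| ≤
      ∑ l, ∑ r, (x l ^ 2 / 2 * |pd r (pd l (pd i G)) b|
        + x r ^ 2 / 2 * |pd r (pd l (pd i G)) b|) := by
    refine (Finset.abs_sum_le_sum_abs _ _).trans (Finset.sum_le_sum fun l _ => ?_)
    rw [Finset.mul_sum]
    refine (Finset.abs_sum_le_sum_abs _ _).trans (Finset.sum_le_sum fun r _ => ?_)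
    rw [abs_mul, abs_mul, ← mul_assoc, ← add_mul]
    refine mul_le_mul_of_nonneg_right ?_ (abs_nonneg _)
    nlinarith [sq_nonneg (|x l| - |x r|), sq_abs (x l), sq_abs (x r)]
  refine hle.trans ?_
  simp only [Finset.sum_add_distrib]
  rw [Finset.sum_comm (f := fun l r => x r ^ 2 / 2 * |pd r (pd l (pd i G)) b|)]
  simp only [← Finset.mul_sum]
  have h1 : ∑ l, x l ^ 2 / 2 * ∑ r, |pd r (pd l (pd i G)) b| ≤ ∑ l, x l ^ 2 / 2 * K :=
    Finset.sum_le_sum fun l _ => mul_le_mul_of_nonneg_left (s1 l) (by positivity)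
  have h2 : ∑ r, x r ^ 2 / 2 * ∑ l, |pd r (pd l (pd i G)) b| ≤ ∑ r, x r ^ 2 / 2 * K :=
    Finset.sum_le_sum fun r _ => mul_le_mul_of_nonneg_left (s2 r) (by positivity)
  rw [← Finset.sum_mul, ← Finset.sum_div] at h1 h2
  linarith

/-- The action of the Hessian of `G` at `b` on a vector. -/
noncomputable def hessApply (G : (Fin d → ℝ) → ℝ) (b x : Fin d → ℝ) : Fin d → ℝ :=
  fun i => ∑ l, x l * pd l (pd i G) b

/-- Linearization of the gradient with a quadratic remainder. -/
theorem ThirdDerivBound.abs_grad_sub_hessApply_le {K : ℝ} (hG : ThriceDiff G)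
    (hK : ThirdDerivBound K G) (b x : Fin d → ℝ) (i : Fin d) :
    |grad G (b + x) i - grad G b i - hessApply G b x i| ≤ K * ∑ l, x l ^ 2 := by
  have hφ : ∀ t : ℝ, HasDerivAt (fun t : ℝ => pd i G (b + t • x) - t * hessApply G b x i)
      (∑ l, x l * pd l (pd i G) (b + t • x) - hessApply G b x i) t := fun t => by
    have h := (hasDerivAt_comp_line (hG.1.2 i) b x t).sub
      ((hasDerivAt_id t).mul_const (hessApply G b x i))
    rw [one_mul] at h
    exact h
  have hφ' : ∀ t : ℝ, HasDerivAt (fun t : ℝ => ∑ l, x l * pd l (pd i G) (b + t • x))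
      (∑ l, x l * ∑ r, x r * pd r (pd l (pd i G)) (b + t • x)) t := fun t =>
    HasDerivAt.fun_sum fun l _ => (hasDerivAt_comp_line (hG.2 l i) b x t).const_mul (x l)
  have h1 : ∀ t ∈ Set.Icc (0 : ℝ) 1,
      ‖∑ l, x l * pd l (pd i G) (b + t • x) - hessApply G b x i‖ ≤ K * ∑ l, x l ^ 2 := by
    intro t ht
    have h := (convex_Icc (0 : ℝ) 1).norm_image_sub_le_of_norm_hasDerivWithin_le
      (C := K * ∑ l, x l ^ 2) (fun u _ => (hφ' u).hasDerivWithinAt)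
      (fun u _ => hK.abs_quadratic_le hG i (b + u • x) x)
      (Set.left_mem_Icc.2 zero_le_one) ht
    have e : hessApply G b x i = ∑ l, x l * pd l (pd i G) (b + (0 : ℝ) • x) := by
      simp [hessApply]
    rw [e]
    have hKx : 0 ≤ K * ∑ l, x l ^ 2 := (abs_nonneg _).trans (hK.abs_quadratic_le hG i b x)
    refine h.trans (mul_le_of_le_one_right hKx ?_)
    rw [sub_zero, Real.norm_eq_abs, abs_of_nonneg ht.1]
    exact ht.2
  have h2 := (convex_Icc (0 : ℝ) 1).norm_image_sub_le_of_norm_hasDerivWithin_le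
    (fun u _ => (hφ u).hasDerivWithinAt) h1 (Set.left_mem_Icc.2 zero_le_one)
    (Set.right_mem_Icc.2 zero_le_one)
  simp only [one_smul, one_mul, zero_smul, zero_mul, add_zero, sub_zero, norm_one, mul_one,
    Real.norm_eq_abs] at h2
  simp only [grad]
  rwa [sub_right_comm] at h2

/-- Strong convexity in the `ℓ^s`-norm makes the Hessian bounded below in the `ℓ^s`-norm. -/
theorem StronglyConvex.mul_lsNorm_le_hessApply {s : ℕ} {μ K : ℝ} (hs : 2 ≤ s) (he : Even s)
    (hSC : StronglyConvex s μ G) (hG : ThriceDiff G) (hK : ThirdDerivBound K G)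
    (b x : Fin d → ℝ) : μ * lsNorm s x ≤ lsNorm s (hessApply G b x) := by
  have hs1 : 1 ≤ s := by omega
  set Y := ∑ i, x i ^ (s - 1) * hessApply G b x i with hY
  set C := ∑ i, |x i| ^ (s - 1) * (K * ∑ l, x l ^ 2) with hC
  -- strong convexity at `b + tx` and `b`, divided by `t^s`, in the limit `t → 0`
  have hlim : μ * lsNorm s x ^ s ≤ Y := by
    have hev : ∀ᶠ t : ℝ in 𝓝[>] 0, μ * lsNorm s x ^ s ≤ Y + t * C := by
      filter_upwards [self_mem_nhdsWithin] with t ht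
      have ht : 0 < t := ht
      have h := hSC (b + t • x) b
      rw [add_sub_cancel_left, lsNorm_smul hs1, abs_of_pos ht, mul_pow] at h
      have hts : t ^ s = t ^ (s - 1) * t := by
        rw [← pow_succ]; congr 1; omega
      have h2 : ∑ i, ((b + t • x) i - b i) ^ (s - 1) *
          (grad G (b + t • x) i - grad G b i) ≤ t ^ s * (Y + t * C) := by
        rw [hY, hC, Finset.mul_sum (a := t), ← Finset.sum_add_distrib, Finset.mul_sum]
        refine Finset.sum_le_sum fun i _ => ?_
        have h3 := hK.abs_grad_sub_hessApply_le hG b (t • x) i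
        have e1 : hessApply G b (t • x) i = t * hessApply G b x i := by
          simp only [hessApply, Pi.smul_apply, smul_eq_mul, Finset.mul_sum]
          exact Finset.sum_congr rfl fun l _ => by ring
        have e2 : ∑ l, (t • x) l ^ 2 = t ^ 2 * ∑ l, x l ^ 2 := by
          simp only [Pi.smul_apply, smul_eq_mul, Finset.mul_sum, mul_pow]
        rw [e1, e2] at h3
        have e3 : (b + t • x) i - b i = t * x i := by simp
        rw [e3, mul_pow]
        have h4 : x i ^ (s - 1) * (grad G (b + t • x) i - grad G b i - t * hessApply G b x i)
            ≤ |x i| ^ (s - 1) * (K * (t ^ 2 * ∑ l, x l ^ 2)) := by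
          refine (le_abs_self _).trans ?_
          rw [abs_mul, abs_pow]
          exact mul_le_mul_of_nonneg_left h3 (by positivity)
        have h5 := mul_le_mul_of_nonneg_left h4 (pow_pos ht (s - 1)).le
        rw [hts]
        linarith
      have h6 : t ^ s * (μ * lsNorm s x ^ s) ≤ t ^ s * (Y + t * C) := by linarith
      exact le_of_mul_le_mul_left h6 (by positivity)
    have ht : Tendsto (fun t : ℝ => Y + t * C) (𝓝[>] 0) (𝓝 (Y + 0 * C)) :=
      tendsto_nhdsWithin_of_tendsto_nhds
        ((continuous_const.add (continuous_id.mul continuous_const)).tendsto 0)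
    rw [zero_mul, add_zero] at ht
    exact ge_of_tendsto ht hev
  rcases eq_or_lt_of_le (lsNorm_nonneg s x) with h0 | hpos
  · rw [← h0, mul_zero]; exact lsNorm_nonneg _ _
  have h1 := hlim.trans ((le_abs_self _).trans (abs_sum_pow_mul_le hs he x (hessApply G b x)))
  have e : lsNorm s x ^ s = lsNorm s x ^ (s - 1) * lsNorm s x := by
    rw [← pow_succ]; congr 1; omega
  rw [e] at h1
  have h2 : lsNorm s x ^ (s - 1) * (μ * lsNorm s x)
      ≤ lsNorm s x ^ (s - 1) * lsNorm s (hessApply G b x) := by linarith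
  exact le_of_mul_le_mul_left h2 (by positivity)

end Taylor

theorem sum_Icc_one_eq_sum_range {V : Type*} [AddCommMonoid V] (f : ℕ → V) (k : ℕ) :
    ∑ i ∈ Finset.Icc 1 k, f i = ∑ i ∈ Finset.range k, f (i + 1) := by
  induction k with
  | zero => simp
  | succ k ih => rw [Finset.sum_Icc_succ_top (by omega), Finset.sum_range_succ, ih]

theorem Assumptions.memLp_grad {d : ℕ} {Ξ Ω : Type*} [MeasurableSpace Ξ] [MeasurableSpace Ω]
    {Q : Measure Ξ} [IsProbabilityMeasure Q] {P : Measure Ω} {g : (Fin d → ℝ) → Ξ → ℝ} {s : ℕ}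
    {q μ L K : ℝ} {bstar : Fin d → ℝ} (A : Assumptions Q g s q μ L K bstar) (hs : 1 ≤ s) (hq : 1 ≤ q)
    (hL : 0 ≤ L) {X : Ω → Fin d → ℝ} (hX : Measurable X)
    (hXp : MemLp (fun ω => X ω - bstar) (ENNReal.ofReal q) P) :
    MemLp (fun ω => grad (risk Q g) (X ω)) (ENNReal.ofReal q) P := by
  have h : LsLipschitz s L (grad (risk Q g)) := A.lsNorm_grad_sub_le hs hq hL
  have := h.memLp_sub hs hL hX (measurable_const (a := bstar)) hXp
  simpa [A.grad_min] using this

section Bias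
variable {d : ℕ} {Ξ Ω 𝓦 : Type*} [MeasurableSpace Ξ] [MeasurableSpace Ω] [MeasurableSpace 𝓦]
  {Q : Measure Ξ} [IsProbabilityMeasure Q] {P : Measure Ω} [IsProbabilityMeasure P]
  {g : (Fin d → ℝ) → Ξ → ℝ} {s : ℕ} {q μ L K : ℝ} {bstar : Fin d → ℝ} {α : ℝ}
  {ξ : ℕ → Ω → Ξ} {W : Ω → 𝓦} {b₀ : Ω → Fin d → ℝ}

theorem integral_sq_le_lpNorm_sq (hq : 2 ≤ q) {f : Ω → ℝ} (hf : MemLp f (ENNReal.ofReal q) P) :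
    Integrable (fun ω => f ω ^ 2) P ∧
      ∫ ω, f ω ^ 2 ∂P ≤ lpNorm f (ENNReal.ofReal q) P ^ 2 := by
  have h := memLp_sq_half (by linarith) hf
  refine ⟨integrable_of_memLp_one_le (by linarith) h, ?_⟩
  rw [← lpNorm_sq_half (by linarith) hf.1]
  refine le_trans (le_of_eq (integral_congr_ae (ae_of_all _ fun ω => ?_)))
    (integral_le_lpNorm (by linarith) h)
  exact (abs_of_nonneg (sq_nonneg _)).symm

/-- One SGD step moves the mean by the mean gradient. -/
theorem Assumptions.integral_sgd_succ (A : Assumptions Q g s q μ L K bstar)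
    (R : Regime d s q μ L α) (hξ : IsIIDSample P Q ξ) (hW : Measurable W)
    (hind : IndepFun W (fun ω k => ξ k ω) P) (hb : Measurable[history W ξ 0] b₀)
    (hβ : ∀ k, MemLp (fun ω => sgd g α (b₀ ω) (fun i => ξ i ω) k - bstar) (ENNReal.ofReal q) P)
    (k : ℕ) :
    ∫ ω, sgd g α (b₀ ω) (fun i => ξ i ω) (k + 1) ∂P =
      ∫ ω, sgd g α (b₀ ω) (fun i => ξ i ω) k ∂P
      - α • ∫ ω, grad (risk Q g) (sgd g α (b₀ ω) (fun i => ξ i ω) k) ∂P := by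
  have hs := R.one_le_s
  have hq := R.one_le_q
  have hint : ∀ i, Integrable (fun ω => sgd g α (b₀ ω) (fun i => ξ i ω) i) P := fun i => by
    refine ((integrable_of_memLp_one_le hq (hβ i)).add (integrable_const bstar)).congr
      (ae_of_all _ fun ω => ?_)
    simp
  have hm := A.measurable_sgd (α := α) hW hξ.measurable hb k
  have h := integral_comp_of_prod hm (hξ.measurable k)
    (map_prodMk_sample hξ hW hind (A.measurable_history_sgd (α := α) hb k))
    (A.measurable_sgdStep α) (hint (k + 1))
  refine h.trans ?_
  have hg : Integrable (fun ω => α • grad (risk Q g) (sgd g α (b₀ ω) (fun i => ξ i ω) k)) P :=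
    (integrable_of_memLp_one_le hq (A.memLp_grad hs hq R.L_pos.le hm (hβ k))).smul α
  rw [← integral_smul, ← integral_sub (hint k) hg]
  refine integral_congr_ae (ae_of_all _ fun ω => ?_)
  simp only [sgdStep]
  have hs2 : Integrable (fun z => α • stochGrad g (sgd g α (b₀ ω) (fun i => ξ i ω) k) z) Q :=
    (A.integrable_stochGrad hs hq _).smul α
  rw [integral_sub (integrable_const _) hs2, integral_smul, A.integral_stochGrad hs hq R.L_pos.le]
  simp

/-- Bias of the averaged iterates.  The linearized mean gradients telescope, and the remainder of
the linearization is quadratic, so that only second moments of the iterates enter. -/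
theorem Assumptions.lsNorm_sum_integral_sgd_sub_le (A : Assumptions Q g s q μ L K bstar)
    (R : Regime d s q μ L α) (hK0 : 0 ≤ K) (hξ : IsIIDSample P Q ξ) (hW : Measurable W)
    (hind : IndepFun W (fun ω k => ξ k ω) P) (hb : Measurable[history W ξ 0] b₀)
    (hβ : ∀ k, MemLp (fun ω => sgd g α (b₀ ω) (fun i => ξ i ω) k - bstar) (ENNReal.ofReal q) P)
    (k : ℕ) :
    μ * lsNorm s (∑ i ∈ Finset.Icc 1 k, ∫ ω, sgd g α (b₀ ω) (fun i => ξ i ω) i ∂P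
        - (k : ℝ) • bstar)
      ≤ lsNorm s (∫ ω, sgd g α (b₀ ω) (fun i => ξ i ω) 1 ∂P
          - ∫ ω, sgd g α (b₀ ω) (fun i => ξ i ω) (k + 1) ∂P) / α
        + (d : ℝ) ^ (1 / (s : ℝ)) * (K * (d : ℝ) ^ (1 - 2 / (s : ℝ)))
          * ∑ i ∈ Finset.Icc 1 k, lpNorm (fun ω => lsNorm s
            (sgd g α (b₀ ω) (fun i => ξ i ω) i - bstar)) (ENNReal.ofReal q) P ^ 2 := by
  have hs := R.one_le_s
  have hq := R.one_le_q
  have hα := R.alpha_pos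
  set G := risk Q g with hG
  set β : ℕ → Ω → Fin d → ℝ := fun i ω => sgd g α (b₀ ω) (fun i => ξ i ω) i with hβdef
  have hm : ∀ i, Measurable (β i) := fun i => A.measurable_sgd (α := α) hW hξ.measurable hb i
  have hδ : ∀ i, Integrable (fun ω => β i ω - bstar) P := fun i =>
    integrable_of_memLp_one_le hq (hβ i)
  have hint : ∀ i, Integrable (β i) P := fun i => by
    refine ((hδ i).add (integrable_const bstar)).congr (ae_of_all _ fun ω => ?_)
    simp
  have hgrad : ∀ i, Integrable (fun ω => grad G (β i ω)) P := fun i =>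
    integrable_of_memLp_one_le hq (A.memLp_grad hs hq R.L_pos.le (hm i) (hβ i))
  have hH : ∀ i, Integrable (fun ω => hessApply G bstar (β i ω - bstar)) P := fun i =>
    Integrable.of_eval fun j => integrable_finsetSum _ fun l _ => ((hδ i).eval l).mul_const _
  set v := ∑ i ∈ Finset.Icc 1 k, ∫ ω, β i ω ∂P - (k : ℝ) • bstar with hv
  have hv2 : v = ∑ i ∈ Finset.Icc 1 k, ∫ ω, (β i ω - bstar) ∂P := by
    have e : ∀ i, ∫ ω, (β i ω - bstar) ∂P = ∫ ω, β i ω ∂P - bstar := fun i => by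
      rw [integral_sub (hint i) (integrable_const _)]; simp
    simp only [e, Finset.sum_sub_distrib, hv]
    congr 1
    rw [Finset.sum_const, Nat.card_Icc, Nat.add_sub_cancel, Nat.cast_smul_eq_nsmul]
  set ρ : ℕ → Fin d → ℝ := fun i =>
    ∫ ω, (grad G (β i ω) - hessApply G bstar (β i ω - bstar)) ∂P with hρ
  have hHv : hessApply G bstar v = α⁻¹ • (∫ ω, β 1 ω ∂P - ∫ ω, β (k + 1) ω ∂P)
      - ∑ i ∈ Finset.Icc 1 k, ρ i := by
    have e1 : hessApply G bstar v
        = ∑ i ∈ Finset.Icc 1 k, ∫ ω, hessApply G bstar (β i ω - bstar) ∂P := by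
      funext j
      rw [Finset.sum_apply]
      have e2 : ∀ i, (∫ ω, hessApply G bstar (β i ω - bstar) ∂P) j
          = ∑ l, (∫ ω, (β i ω - bstar) ∂P) l * pd l (pd j G) bstar := fun i => by
        rw [eval_integral (fun j => (hH i).eval j)]
        simp only [hessApply]
        rw [integral_finsetSum _ fun l _ => ((hδ i).eval l).mul_const _]
        refine Finset.sum_congr rfl fun l _ => ?_
        rw [integral_mul_const, eval_integral (fun j => (hδ i).eval j)]
      simp only [e2, hv2, hessApply, Finset.sum_apply, Finset.sum_mul]
      rw [Finset.sum_comm]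
    have e3 : ∀ i, ∫ ω, grad G (β i ω) ∂P
        = α⁻¹ • (∫ ω, β i ω ∂P - ∫ ω, β (i + 1) ω ∂P) := fun i => by
      have := A.integral_sgd_succ R hξ hW hind hb hβ i
      simp only [β]
      rw [this, sub_sub_cancel, smul_smul, inv_mul_cancel₀ hα.ne', one_smul]
    have e4 : ∀ i, ∫ ω, hessApply G bstar (β i ω - bstar) ∂P
        = α⁻¹ • (∫ ω, β i ω ∂P - ∫ ω, β (i + 1) ω ∂P) - ρ i := fun i => by
      rw [← e3, hρ]
      simp only
      rw [integral_sub (hgrad i) (hH i), sub_sub_cancel]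
    rw [e1, Finset.sum_congr rfl fun i _ => e4 i, Finset.sum_sub_distrib, ← Finset.smul_sum,
      sum_Icc_one_eq_sum_range (fun i => ∫ ω, β i ω ∂P - ∫ ω, β (i + 1) ω ∂P),
      Finset.sum_range_sub' (fun i => ∫ ω, β (i + 1) ω ∂P)]
  have hρb : ∀ i, lsNorm s (ρ i) ≤ (d : ℝ) ^ (1 / (s : ℝ)) * (K * (d : ℝ) ^ (1 - 2 / (s : ℝ)))
      * lpNorm (fun ω => lsNorm s (β i ω - bstar)) (ENNReal.ofReal q) P ^ 2 := fun i => by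
    obtain ⟨j1, j2⟩ := integral_sq_le_lpNorm_sq R.two_le_q (memLp_lsNorm hs (hβ i))
    have hcK : 0 ≤ K * (d : ℝ) ^ (1 - 2 / (s : ℝ)) := by positivity
    rw [mul_assoc]
    refine (lsNorm_le_card_rpow_mul hs _).trans (mul_le_mul_of_nonneg_left ?_ (by positivity))
    refine le_trans ?_ (mul_le_mul_of_nonneg_left j2 hcK)
    refine (norm_integral_le_integral_norm _).trans ?_
    rw [← integral_const_mul]
    refine integral_mono ((hgrad i).sub (hH i)).norm (j1.const_mul _) fun ω => ?_
    refine (pi_norm_le_iff_of_nonneg (by positivity)).2 fun j => ?_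
    have h := A.thirdDerivBound.abs_grad_sub_hessApply_le A.risk_thriceDiff bstar
      (β i ω - bstar) j
    rw [add_sub_cancel, A.grad_min] at h
    simp only [Pi.zero_apply, sub_zero] at h
    refine h.trans ?_
    rw [mul_assoc]
    exact mul_le_mul_of_nonneg_left (sum_sq_le_card_rpow_mul R.two_le_s _) hK0
  refine (A.stronglyConvex.mul_lsNorm_le_hessApply R.two_le_s R.even_s A.risk_thriceDiff
    A.thirdDerivBound bstar v).trans ?_
  rw [hHv]
  refine (lsNorm_sub_le hs _ _).trans (add_le_add (le_of_eq ?_) ?_)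
  · rw [lsNorm_smul hs, abs_of_pos (inv_pos.2 hα), inv_mul_eq_div]
  · rw [Finset.mul_sum]
    exact (lsNorm_sum_le hs _ _).trans (Finset.sum_le_sum fun i _ => hρb i)

end Bias

/-! ### The exponent `s_d`, averages, and the stationary chain -/

section Exponent

theorem log_lt_sDim (d : ℕ) : Real.log d < sDim d := by
  have hne : {l : ℕ | Real.log (d : ℝ) < 2 * (l : ℝ)}.Nonempty := by
    obtain ⟨n, hn⟩ := exists_nat_gt (Real.log d)
    exact ⟨n, by simp only [Set.mem_ofPred_eq]; have : (0 : ℝ) ≤ n := n.cast_nonneg; linarith⟩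
  have := Nat.sInf_mem hne
  rw [sDim]
  push_cast
  exact this

theorem even_sDim (d : ℕ) : Even (sDim d) := even_two_mul _

theorem two_le_sDim {d : ℕ} (hd : 1 ≤ d) : 2 ≤ sDim d := by
  have h0 : 0 ≤ Real.log d := Real.log_nonneg (by exact_mod_cast hd)
  have h1 : (0 : ℝ) < sDim d := h0.trans_lt (log_lt_sDim d)
  have h2 : 0 < sDim d := by exact_mod_cast h1
  obtain ⟨l, hl⟩ := even_sDim d
  omega

/-- The choice `s > log d` makes the `ℓ^s`-norm comparable to the max-norm. -/
theorem rpow_one_div_sDim_le {d : ℕ} (hd : 1 ≤ d) : (d : ℝ) ^ (1 / (sDim d : ℝ)) ≤ 3 := by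
  have hd0 : (0 : ℝ) < d := by exact_mod_cast hd
  have hs : (0 : ℝ) < sDim d := by
    have := two_le_sDim hd
    exact_mod_cast (by omega : 0 < sDim d)
  rw [Real.rpow_def_of_pos hd0]
  refine (Real.exp_le_exp.2 ?_).trans (Real.exp_one_lt_d9.le.trans (by norm_num))
  rw [mul_one_div, div_le_one hs]
  exact (log_lt_sDim d).le

end Exponent

section Average
variable {d : ℕ} {Ξ Ω : Type*} [MeasurableSpace Ω] {P : Measure Ω} {g : (Fin d → ℝ) → Ξ → ℝ}
  {s : ℕ} {q α : ℝ}

theorem memLp_average {Y : ℕ → Ω → Fin d → ℝ} {p : ℝ≥0∞} (hY : ∀ i, MemLp (Y i) p P) (k : ℕ) :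
    MemLp (fun ω => (k : ℝ)⁻¹ • ∑ i ∈ Finset.Icc 1 k, Y i ω) p P :=
  (memLp_finsetSum _ fun i _ => hY i).const_smul (k : ℝ)⁻¹

theorem lpNorm_average_le (hs : 1 ≤ s) (hq : 1 ≤ q) {Y : ℕ → Ω → Fin d → ℝ}
    (hY : ∀ i, MemLp (Y i) (ENNReal.ofReal q) P) (k : ℕ) :
    lpNorm (fun ω => lsNorm s ((k : ℝ)⁻¹ • ∑ i ∈ Finset.Icc 1 k, Y i ω)) (ENNReal.ofReal q) P
      ≤ (∑ i ∈ Finset.Icc 1 k, lpNorm (fun ω => lsNorm s (Y i ω)) (ENNReal.ofReal q) P) / k := by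
  rw [lpNorm_smul_lsNorm hs, abs_of_nonneg (by positivity), inv_mul_eq_div]
  refine div_le_div_of_nonneg_right ?_ (Nat.cast_nonneg k)
  have hN := fun i => memLp_lsNorm hs (hY i)
  refine le_trans (lpNorm_mono_real (memLp_finsetSum (Finset.Icc 1 k) fun i _ => hN i) fun ω => ?_)
    ((lpNorm_sum_le (f := fun i ω => lsNorm s (Y i ω)) (fun i _ => hN i)
      (one_le_ofReal hq)).trans' (le_of_eq ?_))
  · rw [Real.norm_eq_abs, abs_of_nonneg (lsNorm_nonneg _ _)]
    exact lsNorm_sum_le hs _ _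
  · congr 1
    funext ω
    simp

theorem asgd_sub_eq {k : ℕ} (hk : 1 ≤ k) (b c : Fin d → ℝ) (x : ℕ → Ξ) (y : ℕ → Fin d → ℝ)
    (hy : ∀ i, sgd g α b x i - c = y i) :
    asgd g α b x k - c = (k : ℝ)⁻¹ • ∑ i ∈ Finset.Icc 1 k, y i := by
  have hk0 : (k : ℝ) ≠ 0 := by positivity
  simp only [← hy, Finset.sum_sub_distrib, asgd, smul_sub]
  congr 1
  rw [Finset.sum_const, Nat.card_Icc, Nat.add_sub_cancel, ← Nat.cast_smul_eq_nsmul ℝ, smul_smul,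
    inv_mul_cancel₀ hk0, one_smul]

theorem asgd_sub_asgd (k : ℕ) (b b' : Fin d → ℝ) (x : ℕ → Ξ) :
    asgd g α b x k - asgd g α b' x k
      = (k : ℝ)⁻¹ • ∑ i ∈ Finset.Icc 1 k, (sgd g α b x i - sgd g α b' x i) := by
  simp only [Finset.sum_sub_distrib, asgd, smul_sub]

end Average

section BiasVariance
variable {d : ℕ} {Ξ Ω 𝓦 : Type*} [MeasurableSpace Ξ] [MeasurableSpace Ω] [MeasurableSpace 𝓦]
  {Q : Measure Ξ} [IsProbabilityMeasure Q] {P : Measure Ω} [IsProbabilityMeasure P]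
  {g : (Fin d → ℝ) → Ξ → ℝ} {s : ℕ} {q μ L K : ℝ} {bstar : Fin d → ℝ} {α : ℝ}
  {ξ : ℕ → Ω → Ξ} {W : Ω → 𝓦} {b₀ b₀' : Ω → Fin d → ℝ}

/-- Bias–variance bound for the averaged iterates, in terms of the moments of the iterates. -/
theorem Assumptions.lpNorm_asgd_sub_le (A : Assumptions Q g s q μ L K bstar)
    (R : Regime d s q μ L α) (hK0 : 0 ≤ K) (hd3 : (d : ℝ) ^ (1 / (s : ℝ)) ≤ 3)
    (hξ : IsIIDSample P Q ξ) (hW : Measurable W)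
    (hind : IndepFun W (fun ω k => ξ k ω) P) (hb : Measurable[history W ξ 0] b₀)
    {M : ℝ} (hM : M = (noiseMoment Q g s q bstar).toReal) {σ : ℝ}
    (hβ : ∀ k, MemLp (fun ω => sgd g α (b₀ ω) (fun i => ξ i ω) k - bstar) (ENNReal.ofReal q) P)
    (hσ : ∀ k, lpNorm (fun ω => lsNorm s (sgd g α (b₀ ω) (fun i => ξ i ω) k - bstar))
        (ENNReal.ofReal q) P ≤ σ) {k : ℕ} (hk : 1 ≤ k) :
    lpNorm (fun ω => lsNorm s (asgd g α (b₀ ω) (fun i => ξ i ω) k - bstar)) (ENNReal.ofReal q) P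
      ≤ (√k * (√(20 / 3 * max q s) * (42 / μ * (M + L * σ))) + 42 / (α * μ) * σ
        + (lsNorm s (∫ ω, sgd g α (b₀ ω) (fun i => ξ i ω) 1 ∂P
          - ∫ ω, sgd g α (b₀ ω) (fun i => ξ i ω) (k + 1) ∂P) / α
        + 3 * (K * (d : ℝ) ^ (1 - 2 / (s : ℝ)))
          * ∑ i ∈ Finset.Icc 1 k, lpNorm (fun ω => lsNorm s
            (sgd g α (b₀ ω) (fun i => ξ i ω) i - bstar)) (ENNReal.ofReal q) P ^ 2) / μ) / k := by
  have hs := R.one_le_s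
  have hq := R.one_le_q
  have hμ := R.mu_pos
  have hkpos : (0 : ℝ) < k := by exact_mod_cast hk
  have h1 := A.lpNorm_sum_sgd_sub_le R hξ hW hind hb hM hβ hσ k
  have h2 := A.lsNorm_sum_integral_sgd_sub_le R hK0 hξ hW hind hb hβ k
  set m := ∑ i ∈ Finset.Icc 1 k, ∫ ω, sgd g α (b₀ ω) (fun i => ξ i ω) i ∂P with hm
  set c := lsNorm s (m - (k : ℝ) • bstar) with hc
  set S := ∑ i ∈ Finset.Icc 1 k, lpNorm (fun ω => lsNorm s
            (sgd g α (b₀ ω) (fun i => ξ i ω) i - bstar)) (ENNReal.ofReal q) P ^ 2 with hS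
  have hS0 : 0 ≤ S := Finset.sum_nonneg fun i _ => sq_nonneg _
  have h3 : c ≤ (lsNorm s (∫ ω, sgd g α (b₀ ω) (fun i => ξ i ω) 1 ∂P
          - ∫ ω, sgd g α (b₀ ω) (fun i => ξ i ω) (k + 1) ∂P) / α
        + 3 * (K * (d : ℝ) ^ (1 - 2 / (s : ℝ))) * S) / μ := by
    rw [le_div_iff₀ hμ, mul_comm]
    refine h2.trans (add_le_add_right ?_ _)
    exact mul_le_mul_of_nonneg_right (mul_le_mul_of_nonneg_right hd3 (by positivity)) hS0
  have hsum : MemLp (fun ω => ∑ i ∈ Finset.Icc 1 k, sgd g α (b₀ ω) (fun i => ξ i ω) i - m)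
      (ENNReal.ofReal q) P := by
    refine (memLp_finsetSum (Finset.Icc 1 k) fun i _ => (hβ i)).add
      (memLp_const ((k : ℝ) • bstar - m)) |>.ae_eq (ae_of_all _ fun ω => ?_)
    simp only [Pi.add_apply, Finset.sum_sub_distrib]
    rw [Finset.sum_const, Nat.card_Icc, Nat.add_sub_cancel, ← Nat.cast_smul_eq_nsmul ℝ]
    abel
  have hN := memLp_lsNorm hs hsum
  have hconst : lpNorm (fun _ : Ω => c) (ENNReal.ofReal q) P = c := by
    rw [lpNorm_const (by simpa using R.q_pos) (IsProbabilityMeasure.ne_zero P)]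
    simp [abs_of_nonneg (lsNorm_nonneg s _), c]
  have e1 : (fun ω => lsNorm s (asgd g α (b₀ ω) (fun i => ξ i ω) k - bstar)) = fun ω =>
      lsNorm s ((k : ℝ)⁻¹ • ((∑ i ∈ Finset.Icc 1 k, sgd g α (b₀ ω) (fun i => ξ i ω) i - m)
        + (m - (k : ℝ) • bstar))) := by
    funext ω
    rw [sub_add_sub_cancel, smul_sub, smul_smul, inv_mul_cancel₀ hkpos.ne', one_smul, asgd]
  rw [e1, lpNorm_smul_lsNorm hs, abs_of_pos (inv_pos.2 hkpos), inv_mul_eq_div]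
  refine div_le_div_of_nonneg_right ?_ hkpos.le
  refine le_trans (lpNorm_mono_real (hN.add (memLp_const c)) fun ω => ?_)
    ((lpNorm_add_le hN (one_le_ofReal hq)).trans (add_le_add h1 (hconst.le.trans h3)))
  rw [Real.norm_eq_abs, abs_of_nonneg (lsNorm_nonneg _ _)]
  exact lsNorm_add_le hs _ _

/-- The averages of two chains driven by the same samples differ by a transient of order
`1 / (αk)`. -/
theorem Assumptions.lpNorm_asgd_sub_asgd_le (A : Assumptions Q g s q μ L K bstar)
    (R : Regime d s q μ L α) (hξ : IsIIDSample P Q ξ) (hW : Measurable W)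
    (hind : IndepFun W (fun ω k => ξ k ω) P) (hb : Measurable[history W ξ 0] b₀)
    (hb' : Measurable[history W ξ 0] b₀')
    (h0 : MemLp (fun ω => b₀ ω - b₀' ω) (ENNReal.ofReal q) P) (k : ℕ) :
    MemLp (fun ω => asgd g α (b₀ ω) (fun i => ξ i ω) k - asgd g α (b₀' ω) (fun i => ξ i ω) k)
        (ENNReal.ofReal q) P ∧
      lpNorm (fun ω => lsNorm s
        (asgd g α (b₀ ω) (fun i => ξ i ω) k - asgd g α (b₀' ω) (fun i => ξ i ω) k))
        (ENNReal.ofReal q) P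
      ≤ 21 / (α * μ) * lpNorm (fun ω => lsNorm s (b₀ ω - b₀' ω)) (ENNReal.ofReal q) P / k := by
  have hr := R.rate_nonneg A
  have h := A.lpNorm_sgd_sub_sgd_le R hξ hW hind hb hb' h0
  simp only [asgd_sub_asgd]
  refine ⟨memLp_average (fun i => (h i).1) k,
    (lpNorm_average_le R.one_le_s R.one_le_q (fun i => (h i).1) k).trans
      (div_le_div_of_nonneg_right ?_ (Nat.cast_nonneg k))⟩
  refine (Finset.sum_le_sum fun i _ => (h i).2).trans ?_
  rw [← Finset.sum_mul]
  refine mul_le_mul_of_nonneg_right ?_ lpNorm_nonneg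
  rw [sum_Icc_one_eq_sum_range, ← R.one_sub_rate_inv]
  refine le_trans (Finset.sum_le_sum fun i _ => ?_) (sum_rate_pow_le hr R.rate_lt_one k)
  rw [pow_succ]
  exact mul_le_of_le_one_right (pow_nonneg hr i) R.rate_lt_one.le

end BiasVariance

section Stationary
variable {d : ℕ} {Ξ Ω 𝓦 : Type*} [MeasurableSpace Ξ] [MeasurableSpace Ω] [MeasurableSpace 𝓦]
  {Q : Measure Ξ} {P : Measure Ω} [IsProbabilityMeasure P]
  {g : (Fin d → ℝ) → Ξ → ℝ} {s : ℕ} {q μ L K : ℝ} {bstar : Fin d → ℝ} {α : ℝ}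
  {ξ : ℕ → Ω → Ξ} {W : Ω → 𝓦} {b₀ : Ω → Fin d → ℝ} {π : Measure (Fin d → ℝ)}

/-- Started in a stationary law, the chain keeps it. -/
theorem Assumptions.map_sgd_eq (A : Assumptions Q g s q μ L K bstar)
    (hξ : IsIIDSample P Q ξ) (hW : Measurable W)
    (hind : IndepFun W (fun ω k => ξ k ω) P) (hb : Measurable[history W ξ 0] b₀)
    (hπ : IsStationaryLaw Q g α s q π) (hlaw : P.map b₀ = π) (k : ℕ) :
    P.map (fun ω => sgd g α (b₀ ω) (fun i => ξ i ω) k) = π := by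
  induction k with
  | zero => exact hlaw
  | succ k ih =>
    have h := map_prodMk_sample hξ hW hind (A.measurable_history_sgd (α := α) hb k)
    rw [ih] at h
    conv_rhs => rw [← hπ.invariant, ← h]
    rw [Measure.map_map (A.measurable_sgdStep α)
      ((A.measurable_sgd (α := α) hW hξ.measurable hb k).prodMk (hξ.measurable k))]
    rfl

variable [IsProbabilityMeasure Q]

/-- Moment bound for the stationary SGD chain. -/
theorem Assumptions.lpNorm_stationary_le (A : Assumptions Q g s q μ L K bstar)
    (R : Regime d s q μ L α) (hξ : IsIIDSample P Q ξ) (hW : Measurable W)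
    (hind : IndepFun W (fun ω k => ξ k ω) P) (hb : Measurable[history W ξ 0] b₀)
    (hπ : IsStationaryLaw Q g α s q π) (hlaw : P.map b₀ = π)
    {M : ℝ} (hM : M = (noiseMoment Q g s q bstar).toReal) (k : ℕ) :
    MemLp (fun ω => sgd g α (b₀ ω) (fun i => ξ i ω) k - bstar) (ENNReal.ofReal q) P ∧
      lpNorm (fun ω => lsNorm s (sgd g α (b₀ ω) (fun i => ξ i ω) k - bstar))
        (ENNReal.ofReal q) P ≤ √(statVar s q μ M α) := by
  have hs := R.one_le_s
  have hr := R.rate_nonneg A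
  have hr1 := R.rate_lt_one
  have hN := (continuous_lsNorm (d := d) hs).measurable
  have hbm : Measurable b₀ := hb.mono (history_le hW hξ.measurable 0) le_rfl
  have hbp : MemLp b₀ (ENNReal.ofReal q) P := by
    refine memLp_of_lsNorm hs hbm.aestronglyMeasurable ⟨(hN.comp hbm).aestronglyMeasurable, ?_⟩
    have h := hπ.moment_lt_top
    rw [momentNorm, ← hlaw, eLpNorm_map_measure hN.aestronglyMeasurable hbm.aemeasurable] at h
    exact h
  have h0 : MemLp (fun ω => b₀ ω - bstar) (ENNReal.ofReal q) P := hbp.sub (memLp_const _)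
  have h := A.lpNorm_sgd_sub_min_sq_le R hξ hW hind hb h0 hM
  have hF : Measurable fun b : Fin d → ℝ => lsNorm s (b - bstar) :=
    hN.comp (measurable_id.sub measurable_const)
  -- the law of the iterates does not change, so that the moment is a fixed point of the recursion
  have heq : ∀ i, lpNorm (fun ω => lsNorm s (sgd g α (b₀ ω) (fun i => ξ i ω) i - bstar))
        (ENNReal.ofReal q) P = lpNorm (fun b => lsNorm s (b - bstar)) (ENNReal.ofReal q) π := by
    intro i
    have hm := A.measurable_sgd (α := α) hW hξ.measurable hb i
    have hFm : Measurable fun ω => lsNorm s (sgd g α (b₀ ω) (fun i => ξ i ω) i - bstar) :=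
      hF.comp hm
    rw [← toReal_eLpNorm hFm.aestronglyMeasurable,
      ← toReal_eLpNorm hF.aestronglyMeasurable, ← A.map_sgd_eq hξ hW hind hb hπ hlaw i,
      eLpNorm_map_measure hF.aestronglyMeasurable hm.aemeasurable]
    rfl
  refine ⟨(h k).1, ?_⟩
  rw [heq]
  refine Real.le_sqrt_of_sq_le ?_
  have h1 := (h 1).2
  have h00 := heq 0
  simp only [sgd] at h00
  rw [heq, h00, pow_one] at h1
  have h2 : (1 - rate α μ) * lpNorm (fun b => lsNorm s (b - bstar)) (ENNReal.ofReal q) π ^ 2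
      ≤ (1 - rate α μ) * statVar s q μ M α := by linarith
  exact le_of_mul_le_mul_left h2 (by linarith)

end Stationary

/-! ### The complexity bound for a coupled start -/

/-- The constant in the deviation bound for the averages of the stationary chain.  Its summands
come from the martingale part, from the dependence on the starting point, and from the case
`αk ≤ 1`. -/
noncomputable def devConst (μ : ℝ) : ℝ := 4600 / μ + 3192 / (μ * √μ) + 76 / √μ

/-- The constant in the bias bound, with `K + 1` instead of `K` so that it is positive for
`K = 0`. -/
noncomputable def biasConst (μ K : ℝ) : ℝ := 17220 * (K + 1) / μ ^ 2

theorem momentNorm_norm_le {Ω : Type*} [MeasurableSpace Ω] {P : Measure Ω} {d s : ℕ} {q ε : ℝ}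
    (hs : 1 ≤ s) {X : Ω → Fin d → ℝ} (hX : MemLp X (ENNReal.ofReal q) P)
    (h : lpNorm (fun ω => lsNorm s (X ω)) (ENNReal.ofReal q) P ≤ ε) :
    momentNorm q P (fun ω => ‖X ω‖) ≤ ENNReal.ofReal ε := by
  refine le_trans ?_ (ENNReal.ofReal_le_ofReal h)
  rw [ofReal_lpNorm (memLp_lsNorm hs hX), momentNorm]
  refine eLpNorm_mono_real fun ω => ?_
  rw [norm_norm]
  exact norm_le_lsNorm hs _

section Numeric
variable {d s : ℕ} {q μ L K α M : ℝ}

theorem Regime.sqrt_statVar_le (R : Regime d s q μ L α) (hM : 0 ≤ M) :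
    √(statVar s q μ M α) ≤ 76 * √(max q (s : ℝ)) * √α * M / √μ := by
  have hα := R.alpha_pos
  have hμ := R.mu_pos
  have hp := R.max_pos
  have hm : 0 < √μ := Real.sqrt_pos.2 hμ
  refine Real.sqrt_le_iff.2 ⟨by positivity, ?_⟩
  -- `76² = 5776 ≥ 5740`
  have e : (76 * √(max q (s : ℝ)) * √α * M / √μ) ^ 2
      = 5776 * (√(max q (s : ℝ)) ^ 2 * √α ^ 2 * M ^ 2) / √μ ^ 2 := by ring
  rw [e, Real.sq_sqrt hp.le, Real.sq_sqrt hα.le, Real.sq_sqrt hμ.le, statVar]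
  refine div_le_div_of_nonneg_right ?_ hμ.le
  have : 0 ≤ max q (s : ℝ) * α * M ^ 2 := by positivity
  linarith

/-- In the admissible range of learning rates the Lipschitz part of the noise of the stationary
chain is at most of the order of the noise at the minimizer. -/
theorem Regime.L_mul_sqrt_statVar_le (R : Regime d s q μ L α) (hM : 0 ≤ M) :
    L * √(statVar s q μ M α) ≤ 41 * M := by
  have hμ := R.mu_pos
  refine le_of_pow_le_pow_left₀ two_ne_zero (by positivity) ?_
  rw [mul_pow, Real.sq_sqrt (R.statVar_nonneg M), statVar]
  have h := max_mul_le_of_le_alphaMax R.two_le_q R.L_pos R.alpha_le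
  have e : L ^ 2 * (5740 * (max q (s : ℝ) * α * M ^ 2) / μ)
      = 5740 * (max q (s : ℝ) * α * L ^ 2) * M ^ 2 / μ := by ring
  rw [e, div_le_iff₀ hμ]
  nlinarith [mul_le_mul_of_nonneg_right h (sq_nonneg M), mul_nonneg hμ.le (sq_nonneg M)]

theorem sqrt_mul_max_le {p : ℝ} (hp : 0 ≤ p) : √(20 / 3 * p) ≤ 2.6 * √p := by
  refine Real.sqrt_le_iff.2 ⟨by positivity, ?_⟩
  rw [mul_pow, Real.sq_sqrt hp]
  linarith

theorem sq_le_varFactor_sq_mul (hL : 0 ≤ L) (hM : 0 ≤ M) (hα : 0 < α) :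
    M ^ 2 ≤ varFactor s q L M α ^ 2 * α := by
  have h : M / √α ≤ varFactor s q L M α := by
    rw [varFactor]; exact le_add_of_nonneg_left (by positivity)
  calc M ^ 2 = (M / √α) ^ 2 * α := by
        rw [div_pow, Real.sq_sqrt hα.le, div_mul_cancel₀ _ hα.ne']
    _ ≤ _ := mul_le_mul_of_nonneg_right (pow_le_pow_left₀ (by positivity) h 2) hα.le

/-- The exponent of `d` in `biasFactor` is larger than needed, as `q / (q - 1) ≥ 1`. -/
theorem card_rpow_mul_le_biasFactor (hd : 1 ≤ d) (hs : 2 ≤ s) (hq : 2 ≤ q) (M : ℝ) :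
    (d : ℝ) ^ (1 - 2 / (s : ℝ)) * (max q (s : ℝ) * M ^ 2) ≤ biasFactor d s q M := by
  have hs2 : (2 : ℝ) ≤ s := by exact_mod_cast hs
  have hexp : 1 - 2 / (s : ℝ) ≤ q / (q - 1) * (1 - 2 / (s : ℝ)) := by
    refine le_mul_of_one_le_left ?_ ?_
    · rw [sub_nonneg, div_le_one (by linarith)]; exact hs2
    · rw [le_div_iff₀ (by linarith)]; linarith
  have h := Real.rpow_le_rpow_of_exponent_le (by exact_mod_cast hd : (1 : ℝ) ≤ d) hexp
  have hp : 0 ≤ max q (s : ℝ) := le_trans (by linarith) (le_max_left _ _)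
  rw [biasFactor, mul_comm, mul_comm (max q (s : ℝ))]
  exact mul_le_mul_of_nonneg_left h (by positivity)

theorem max_le_mul {s : ℕ} {q : ℝ} (hs : 2 ≤ s) (hq : 2 ≤ q) : max q (s : ℝ) ≤ q * s := by
  have hs2 : (2 : ℝ) ≤ s := by exact_mod_cast hs
  exact max_le (by nlinarith) (by nlinarith)

end Numeric

section Complexity
variable {d : ℕ} {Ξ Ω 𝓦 : Type*} [MeasurableSpace Ξ] [MeasurableSpace Ω] [MeasurableSpace 𝓦]
  {Q : Measure Ξ} [IsProbabilityMeasure Q] {P : Measure Ω} [IsProbabilityMeasure P]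
  {g : (Fin d → ℝ) → Ξ → ℝ} {s : ℕ} {q μ L K : ℝ} {bstar : Fin d → ℝ} {α : ℝ}
  {ξ : ℕ → Ω → Ξ} {W : Ω → 𝓦} {b₀ : Ω → Fin d → ℝ} {π : Measure (Fin d → ℝ)}

/-- Error of the averages of the stationary chain.  When `αk ≤ 1` averaging does not help yet, and
the moment bound of a single iterate is already of order `√(max{q,s} / k)`. -/
theorem Assumptions.lpNorm_asgd_stationary_le (A : Assumptions Q g s q μ L K bstar)
    (R : Regime d s q μ L α) (hK0 : 0 ≤ K) (hd3 : (d : ℝ) ^ (1 / (s : ℝ)) ≤ 3)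
    (hξ : IsIIDSample P Q ξ) (hW : Measurable W)
    (hind : IndepFun W (fun ω k => ξ k ω) P) (hb : Measurable[history W ξ 0] b₀)
    (hπ : IsStationaryLaw Q g α s q π) (hlaw : P.map b₀ = π)
    {M : ℝ} (hM : M = (noiseMoment Q g s q bstar).toReal) {k : ℕ} (hk : 1 ≤ k) :
    MemLp (fun ω => asgd g α (b₀ ω) (fun i => ξ i ω) k - bstar) (ENNReal.ofReal q) P ∧
    lpNorm (fun ω => lsNorm s (asgd g α (b₀ ω) (fun i => ξ i ω) k - bstar)) (ENNReal.ofReal q) P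
      ≤ devConst μ * (√(max q (s : ℝ)) * M) / √k
        + 3 * (K * (d : ℝ) ^ (1 - 2 / (s : ℝ))) * statVar s q μ M α / μ := by
  have hs := R.one_le_s
  have hq := R.one_le_q
  have hμ := R.mu_pos
  have hα := R.alpha_pos
  have hp := R.max_pos
  have hM0 : 0 ≤ M := hM ▸ ENNReal.toReal_nonneg
  have hkpos : (0 : ℝ) < k := by exact_mod_cast hk
  have hx : 0 < √(k : ℝ) := Real.sqrt_pos.2 hkpos
  have hy : 0 < √α := Real.sqrt_pos.2 hα
  have hm : 0 < √μ := Real.sqrt_pos.2 hμ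
  have hxx : √(k : ℝ) * √k = k := Real.mul_self_sqrt hkpos.le
  have hT0 := R.statVar_nonneg M
  have hst := A.lpNorm_stationary_le R hξ hW hind hb hπ hlaw hM
  have hTs := R.sqrt_statVar_le hM0
  set u := √(max q (s : ℝ)) * M with hu
  have hu0 : 0 ≤ u := by positivity
  have hTs' : √(statVar s q μ M α) ≤ 76 / √μ * u * √α := by
    refine hTs.trans (le_of_eq ?_); rw [hu]; ring
  have hbias0 : 0 ≤ 3 * (K * (d : ℝ) ^ (1 - 2 / (s : ℝ))) * statVar s q μ M α / μ := by positivity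
  have hmem : MemLp (fun ω => asgd g α (b₀ ω) (fun i => ξ i ω) k - bstar)
      (ENNReal.ofReal q) P := by
    have := memLp_average (fun i => (hst i).1) k
    refine this.ae_eq (ae_of_all _ fun ω => ?_)
    exact (asgd_sub_eq hk _ _ _ _ fun i => rfl).symm
  refine ⟨hmem, ?_⟩
  rcases le_total (α * k) 1 with hαk | hαk
  · have hyx : √α ≤ 1 / √k := by
      rw [le_div_iff₀ hx, ← Real.sqrt_mul hα.le]
      exact Real.sqrt_le_one.2 hαk
    have h1 := lpNorm_average_le hs hq (fun i => (hst i).1) k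
    have e : (fun ω => lsNorm s (asgd g α (b₀ ω) (fun i => ξ i ω) k - bstar)) = fun ω =>
        lsNorm s ((k : ℝ)⁻¹ • ∑ i ∈ Finset.Icc 1 k,
          (sgd g α (b₀ ω) (fun i => ξ i ω) i - bstar)) := by
      funext ω
      rw [asgd_sub_eq hk _ _ _ _ fun i => rfl]
    rw [e]
    have h2 : (∑ i ∈ Finset.Icc 1 k, lpNorm (fun ω => lsNorm s
        (sgd g α (b₀ ω) (fun i => ξ i ω) i - bstar)) (ENNReal.ofReal q) P) / k
        ≤ √(statVar s q μ M α) := by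
      rw [div_le_iff₀ hkpos, mul_comm]
      refine (Finset.sum_le_sum fun i _ => (hst i).2).trans (le_of_eq ?_)
      simp
    have h3 : √(statVar s q μ M α) ≤ 76 / √μ * u / √k := by
      refine hTs'.trans ?_
      rw [div_eq_mul_one_div (76 / √μ * u)]
      exact mul_le_mul_of_nonneg_left hyx (by positivity)
    have h4 : 76 / √μ * u / √k ≤ devConst μ * u / √k := by
      refine div_le_div_of_nonneg_right (mul_le_mul_of_nonneg_right ?_ hu0) hx.le
      rw [devConst]
      exact le_add_of_nonneg_left (by positivity)
    linarith
  · have h := A.lpNorm_asgd_sub_le R hK0 hd3 hξ hW hind hb hM (fun i => (hst i).1)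
      (fun i => (hst i).2) hk
    -- by stationarity the telescoping sum of the means vanishes
    have hJ : lsNorm s (∫ ω, sgd g α (b₀ ω) (fun i => ξ i ω) 1 ∂P
          - ∫ ω, sgd g α (b₀ ω) (fun i => ξ i ω) (k + 1) ∂P) = 0 := by
      have e : ∀ i, ∫ ω, sgd g α (b₀ ω) (fun i => ξ i ω) i ∂P = ∫ b, b ∂π := fun i => by
        have h := integral_map (f := fun b : Fin d → ℝ => b)
          (A.measurable_sgd (α := α) hW hξ.measurable hb i).aemeasurable
          (μ := P) aestronglyMeasurable_id
        rw [A.map_sgd_eq hξ hW hind hb hπ hlaw i] at h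
        exact h.symm
      rw [e, e, sub_self, lsNorm_zero hs]
    rw [hJ, zero_div, zero_add] at h
    refine h.trans ?_
    have hyx : 1 ≤ √α * √k := by
      rw [← Real.sqrt_mul hα.le]
      exact Real.one_le_sqrt.2 hαk
    have hS : ∑ i ∈ Finset.Icc 1 k, lpNorm (fun ω => lsNorm s
        (sgd g α (b₀ ω) (fun i => ξ i ω) i - bstar)) (ENNReal.ofReal q) P ^ 2
        ≤ k * statVar s q μ M α := by
      refine (Finset.sum_le_sum fun i _ => pow_le_pow_left₀ lpNorm_nonneg (hst i).2 2).trans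
        (le_of_eq ?_)
      simp [Real.sq_sqrt hT0]
    have t1 : √k * (√(20 / 3 * max q (s : ℝ)) * (42 / μ * (M + L * √(statVar s q μ M α)))) / k
        ≤ 4600 / μ * u / √k := by
      have h1 : M + L * √(statVar s q μ M α) ≤ 42 * M := by
        linarith [R.L_mul_sqrt_statVar_le hM0]
      have h2 : √(20 / 3 * max q (s : ℝ)) * (42 / μ * (M + L * √(statVar s q μ M α)))
          ≤ 2.6 * √(max q (s : ℝ)) * (42 / μ * (42 * M)) := by
        have := R.L_pos
        exact mul_le_mul (sqrt_mul_max_le hp.le) (mul_le_mul_of_nonneg_left h1 (by positivity))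
          (by positivity) (by positivity)
      have h3 : 2.6 * √(max q (s : ℝ)) * (42 / μ * (42 * M)) ≤ 4600 / μ * u := by
        have : 2.6 * √(max q (s : ℝ)) * (42 / μ * (42 * M)) = 4586.4 / μ * u := by
          rw [hu]; ring
        rw [this]
        exact mul_le_mul_of_nonneg_right (div_le_div_of_nonneg_right (by norm_num) hμ.le) hu0
      rw [div_le_div_iff₀ hkpos hx]
      have h4 := mul_le_mul_of_nonneg_left (h2.trans h3) hkpos.le
      calc _ = (√(k : ℝ) * √k) * (√(20 / 3 * max q (s : ℝ)) * (42 / μ *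
            (M + L * √(statVar s q μ M α)))) := by ring
        _ ≤ _ := by rw [hxx]; linarith
    have t2 : 42 / (α * μ) * √(statVar s q μ M α) / k ≤ 3192 / (μ * √μ) * u / √k := by
      have h1 : 42 / (α * μ) * √(statVar s q μ M α) ≤ 42 / (α * μ) * (76 / √μ * u * √α) :=
        mul_le_mul_of_nonneg_left hTs' (by positivity)
      have h2 : 42 / (α * μ) * (76 / √μ * u * √α) = 3192 / (μ * √μ) * u / √α := by
        calc 42 / (α * μ) * (76 / √μ * u * √α) = 3192 / (μ * √μ) * u * (√α / α) := by
              field_simp; ring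
          _ = _ := by rw [Real.sqrt_div_self, ← div_eq_mul_inv]
      rw [h2] at h1
      refine (div_le_div_of_nonneg_right h1 hkpos.le).trans ?_
      rw [div_div]
      refine div_le_div_of_nonneg_left (by positivity) hx ?_
      calc √(k : ℝ) ≤ √α * √k * √k := le_mul_of_one_le_left hx.le hyx
        _ = √α * k := by rw [mul_assoc, hxx]
    have t3 : 3 * (K * (d : ℝ) ^ (1 - 2 / (s : ℝ))) * (∑ i ∈ Finset.Icc 1 k, lpNorm (fun ω =>
        lsNorm s (sgd g α (b₀ ω) (fun i => ξ i ω) i - bstar)) (ENNReal.ofReal q) P ^ 2) / μ / k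
        ≤ 3 * (K * (d : ℝ) ^ (1 - 2 / (s : ℝ))) * statVar s q μ M α / μ := by
      rw [div_div, div_le_div_iff₀ (by positivity) hμ]
      have := mul_le_mul_of_nonneg_left hS
        (by positivity : 0 ≤ 3 * (K * (d : ℝ) ^ (1 - 2 / (s : ℝ))) * μ)
      linarith
    have t4 : 0 ≤ 76 / √μ * u / √k := by positivity
    have e : devConst μ * u / √k = 4600 / μ * u / √k + 3192 / (μ * √μ) * u / √k
        + 76 / √μ * u / √k := by rw [devConst]; ring
    rw [add_div, add_div, e]
    linarith

/-- The restriction on `α` by `biasFactor` makes the bias at most `ε / 3`. -/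
theorem Regime.bias_le (R : Regime d s q μ L α) (hK0 : 0 ≤ K) {M ε : ℝ}
    (hε : α * (3 * biasConst μ K * biasFactor d s q M) ≤ ε) :
    3 * (K * (d : ℝ) ^ (1 - 2 / (s : ℝ))) * statVar s q μ M α / μ ≤ ε / 3 := by
  have hμ := R.mu_pos
  have hα := R.alpha_pos
  have hp := R.max_pos
  have h := card_rpow_mul_le_biasFactor R.one_le_dim R.two_le_s R.two_le_q M
  set D := (d : ℝ) ^ (1 - 2 / (s : ℝ)) with hD
  have hD0 : 0 ≤ D := by positivity
  have e : 3 * (K * D) * statVar s q μ M α / μ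
      = 17220 * K / μ ^ 2 * (α * (D * (max q (s : ℝ) * M ^ 2))) := by
    rw [statVar]; field_simp; ring
  have h1 : 17220 * K / μ ^ 2 ≤ biasConst μ K := by
    rw [biasConst]
    exact div_le_div_of_nonneg_right (by linarith) (by positivity)
  have hC : 0 ≤ biasConst μ K := by rw [biasConst]; positivity
  have h2 : 17220 * K / μ ^ 2 * (α * (D * (max q (s : ℝ) * M ^ 2)))
      ≤ biasConst μ K * (α * biasFactor d s q M) :=
    mul_le_mul h1 (mul_le_mul_of_nonneg_left h hα.le) (by positivity) hC
  rw [e]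
  linarith

/-- The complexity bound for an initial state coupled to the stationary chain. -/
theorem Assumptions.momentNorm_asgd_le (A : Assumptions Q g s q μ L K bstar)
    (R : Regime d s q μ L α) (hK0 : 0 ≤ K) (hd3 : (d : ℝ) ^ (1 / (s : ℝ)) ≤ 3)
    {M : ℝ} (hM : M = (noiseMoment Q g s q bstar).toReal) {ε : ℝ} (hε : 0 < ε)
    (hαε : α * (3 * biasConst μ K * biasFactor d s q M) ≤ ε)
    (hπ : IsStationaryLaw Q g α s q π) {b₀s : Ω → Fin d → ℝ} (hξ : IsIIDSample P Q ξ)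
    (hb : Measurable b₀) (hbs : Measurable b₀s) (hlaw : P.map b₀s = π)
    (hind : IndepFun (fun ω => (b₀ ω, b₀s ω)) (fun ω k => ξ k ω) P) {k : ℕ} (hk : 1 ≤ k)
    (hk1 : 9 * devConst μ ^ 2 * q * s * varFactor s q L M α ^ 2 * α / ε ^ 2 ≤ k)
    (hk2 : ENNReal.ofReal (3 * (63 / μ)) * momentNorm q P (fun ω => ‖b₀ ω - b₀s ω‖)
        / ENNReal.ofReal (α * ε) ≤ (k : ℝ≥0∞)) :
    momentNorm q P (fun ω => ‖asgd g α (b₀ ω) (fun i => ξ i ω) k - bstar‖)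
      ≤ ENNReal.ofReal ε := by
  have hs := R.one_le_s
  have hq := R.one_le_q
  have hμ := R.mu_pos
  have hα := R.alpha_pos
  have hp := R.max_pos
  have hq0 := R.q_pos
  have hM0 : 0 ≤ M := hM ▸ ENNReal.toReal_nonneg
  have hkpos : (0 : ℝ) < k := by exact_mod_cast hk
  have hx : 0 < √(k : ℝ) := Real.sqrt_pos.2 hkpos
  have hW : Measurable fun ω => (b₀ ω, b₀s ω) := hb.prodMk hbs
  have hb1 : Measurable[history (fun ω => (b₀ ω, b₀s ω)) ξ 0] b₀ :=
    measurable_fst.comp (measurable_history_init (W := fun ω => (b₀ ω, b₀s ω)) 0)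
  have hb2 : Measurable[history (fun ω => (b₀ ω, b₀s ω)) ξ 0] b₀s :=
    measurable_snd.comp (measurable_history_init (W := fun ω => (b₀ ω, b₀s ω)) 0)
  -- the initial distance has a finite moment, as the required number of steps is finite
  have hmeas : AEStronglyMeasurable (fun ω => b₀ ω - b₀s ω) P :=
    (hb.sub hbs).aestronglyMeasurable
  have hΔeq : momentNorm q P (fun ω => ‖b₀ ω - b₀s ω‖)
      = eLpNorm (fun ω => b₀ ω - b₀s ω) (ENNReal.ofReal q) P := eLpNorm_norm _
  have hC2 : 0 < 3 * (63 / μ) := by positivity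
  have hfin : eLpNorm (fun ω => b₀ ω - b₀s ω) (ENNReal.ofReal q) P ≠ ∞ := by
    intro htop
    rw [hΔeq, htop, ENNReal.mul_top (by simpa using hC2),
      ENNReal.top_div_of_ne_top ENNReal.ofReal_ne_top] at hk2
    exact absurd hk2 (by simp)
  have hΔ : MemLp (fun ω => b₀ ω - b₀s ω) (ENNReal.ofReal q) P := ⟨hmeas, hfin.lt_top⟩
  set Δ := lpNorm (fun ω => b₀ ω - b₀s ω) (ENNReal.ofReal q) P with hΔdef
  have hΔ0 : 0 ≤ Δ := lpNorm_nonneg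
  have hk2' : 3 * (63 / μ) * Δ ≤ k * (α * ε) := by
    rw [hΔeq, ← ofReal_lpNorm hΔ, ← ENNReal.ofReal_mul hC2.le,
      ← ENNReal.ofReal_div_of_pos (by positivity), ← ENNReal.ofReal_natCast,
      ENNReal.ofReal_le_ofReal_iff hkpos.le, div_le_iff₀ (by positivity)] at hk2
    exact hk2
  obtain ⟨c1, c2⟩ := A.lpNorm_asgd_sub_asgd_le R hξ hW hind hb1 hb2 hΔ k
  obtain ⟨st1, st2⟩ := A.lpNorm_asgd_stationary_le R hK0 hd3 hξ hW hind hb2 hπ hlaw hM hk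
  -- `63 = 3 · 21`, with the `3` from the comparison of `|·|_s` with the max-norm
  have hcoup : 21 / (α * μ) * lpNorm (fun ω => lsNorm s (b₀ ω - b₀s ω)) (ENNReal.ofReal q) P / k
      ≤ ε / 3 := by
    have h1 : lpNorm (fun ω => lsNorm s (b₀ ω - b₀s ω)) (ENNReal.ofReal q) P ≤ 3 * Δ := by
      have e := lpNorm_const_smul (p := ENNReal.ofReal q) (3 : ℝ)
        (fun ω => ‖b₀ ω - b₀s ω‖) P
      rw [coe_nnnorm, Real.norm_eq_abs, abs_of_pos three_pos, lpNorm_norm hmeas] at e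
      refine le_trans (lpNorm_mono_real (hΔ.norm.const_mul 3) fun ω => ?_) e.le
      rw [Real.norm_eq_abs, abs_of_nonneg (lsNorm_nonneg _ _)]
      exact (lsNorm_le_card_rpow_mul hs _).trans
        (mul_le_mul_of_nonneg_right hd3 (norm_nonneg _))
    have h2 : 21 / (α * μ) * lpNorm (fun ω => lsNorm s (b₀ ω - b₀s ω)) (ENNReal.ofReal q) P
        ≤ 21 / (α * μ) * (3 * Δ) := mul_le_mul_of_nonneg_left h1 (by positivity)
    have h3 : 21 / (α * μ) * (3 * Δ) = (3 * (63 / μ) * Δ) / (3 * α) := by field_simp; ring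
    rw [div_le_iff₀ hkpos]
    refine h2.trans ?_
    rw [h3, div_le_iff₀ (by positivity)]
    linarith
  have hdev : devConst μ * (√(max q (s : ℝ)) * M) / √k ≤ ε / 3 := by
    have hdc : 0 ≤ devConst μ := by rw [devConst]; positivity
    rw [div_le_iff₀ hx]
    refine le_of_pow_le_pow_left₀ two_ne_zero (by positivity) ?_
    rw [mul_pow, mul_pow, mul_pow, Real.sq_sqrt hp.le, Real.sq_sqrt hkpos.le]
    rw [div_le_iff₀ (by positivity)] at hk1
    have h1 : max q (s : ℝ) * M ^ 2 ≤ q * s * (varFactor s q L M α ^ 2 * α) :=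
      mul_le_mul (max_le_mul R.two_le_s R.two_le_q) (sq_le_varFactor_sq_mul R.L_pos.le hM0 hα)
        (sq_nonneg _) (by positivity)
    have h2 := mul_le_mul_of_nonneg_left h1 (sq_nonneg (devConst μ))
    nlinarith
  have hbias := R.bias_le hK0 hαε
  have hmem : MemLp (fun ω => asgd g α (b₀ ω) (fun i => ξ i ω) k - bstar)
      (ENNReal.ofReal q) P := by
    refine (c1.add st1).ae_eq (ae_of_all _ fun ω => ?_)
    simp
  refine momentNorm_norm_le hs hmem ?_
  have hN1 := memLp_lsNorm hs c1
  have hN2 := memLp_lsNorm hs st1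
  refine le_trans (lpNorm_mono_real (hN1.add hN2) fun ω => ?_)
    ((lpNorm_add_le hN1 (one_le_ofReal hq)).trans ((add_le_add c2 st2).trans (by linarith)))
  rw [Real.norm_eq_abs, abs_of_nonneg (lsNorm_nonneg _ _)]
  refine le_trans (le_of_eq ?_) (lsNorm_add_le hs _ _)
  rw [sub_add_sub_cancel]

end Complexity

/-! ### The complexity bound for a deterministic start -/

section Deterministic
variable {d : ℕ} {Ξ : Type*} [MeasurableSpace Ξ]
  {Q : Measure Ξ} [IsProbabilityMeasure Q]
  {g : (Fin d → ℝ) → Ξ → ℝ} {s : ℕ} {q μ L K : ℝ} {bstar : Fin d → ℝ} {α : ℝ}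

/-- Error of the averages for a deterministic initial state: the explicit transient terms are
of order `1 / √k` and `1 / (αk)`. -/
theorem Assumptions.lpNorm_asgd_const_le {Ω : Type*} [MeasurableSpace Ω] {P : Measure Ω}
    [IsProbabilityMeasure P] {ξ : ℕ → Ω → Ξ} (A : Assumptions Q g s q μ L K bstar)
    (R : Regime d s q μ L α) (hK0 : 0 ≤ K) (hd3 : (d : ℝ) ^ (1 / (s : ℝ)) ≤ 3)
    (hξ : IsIIDSample P Q ξ) (b : Fin d → ℝ)
    {M : ℝ} (hM : M = (noiseMoment Q g s q bstar).toReal) {σ : ℝ} (hσ0 : 0 ≤ σ)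
    (hσ : lsNorm s (b - bstar) ^ 2 + statVar s q μ M α ≤ σ ^ 2) {k : ℕ} (hk : 1 ≤ k) :
    MemLp (fun ω => asgd g α b (fun i => ξ i ω) k - bstar) (ENNReal.ofReal q) P ∧
    lpNorm (fun ω => lsNorm s (asgd g α b (fun i => ξ i ω) k - bstar)) (ENNReal.ofReal q) P
      ≤ √(20 / 3 * max q (s : ℝ)) * (42 / μ * (M + L * σ)) / √k
        + (42 * σ + 2 * σ + 3 * (K * (d : ℝ) ^ (1 - 2 / (s : ℝ)))
          * (lsNorm s (b - bstar) ^ 2 * 21 / μ)) / μ / (α * k)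
        + 3 * (K * (d : ℝ) ^ (1 - 2 / (s : ℝ))) * statVar s q μ M α / μ := by
  have hs := R.one_le_s
  have hq := R.one_le_q
  have hμ := R.mu_pos
  have hα := R.alpha_pos
  have hr := R.rate_nonneg A
  have hr1 := R.rate_lt_one
  have hkpos : (0 : ℝ) < k := by exact_mod_cast hk
  have hx : 0 < √(k : ℝ) := Real.sqrt_pos.2 hkpos
  have hT0 := R.statVar_nonneg M
  have hW : Measurable fun _ : Ω => b := measurable_const
  have hind : IndepFun (fun _ : Ω => b) (fun ω k => ξ k ω) P := indepFun_const_left _ _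
  have hb : Measurable[history (fun _ : Ω => b) ξ 0] fun _ : Ω => b := measurable_const
  have hD : lpNorm (fun _ : Ω => lsNorm s (b - bstar)) (ENNReal.ofReal q) P
      = lsNorm s (b - bstar) := by
    rw [lpNorm_const (by simpa using R.q_pos) (IsProbabilityMeasure.ne_zero P)]
    simp [abs_of_nonneg (lsNorm_nonneg s _)]
  have hst := A.lpNorm_sgd_sub_min_sq_le R hξ hW hind hb (memLp_const _) hM
  simp only [hD] at hst
  set D := lsNorm s (b - bstar) with hDdef
  have hsq : ∀ i, lpNorm (fun ω => lsNorm s (sgd g α b (fun i => ξ i ω) i - bstar))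
      (ENNReal.ofReal q) P ^ 2 ≤ rate α μ ^ i * D ^ 2 + statVar s q μ M α := fun i => by
    have h1 := (hst i).2
    have h2 : 0 ≤ rate α μ ^ i * statVar s q μ M α := mul_nonneg (pow_nonneg hr i) hT0
    linarith
  have hle : ∀ i, lpNorm (fun ω => lsNorm s (sgd g α b (fun i => ξ i ω) i - bstar))
      (ENNReal.ofReal q) P ≤ σ := fun i => by
    refine le_of_pow_le_pow_left₀ two_ne_zero hσ0 ((hsq i).trans (le_trans ?_ hσ))
    exact add_le_add_left (mul_le_of_le_one_left (sq_nonneg _) (pow_le_one₀ hr hr1.le)) _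
  have hmem : MemLp (fun ω => asgd g α b (fun i => ξ i ω) k - bstar) (ENNReal.ofReal q) P := by
    refine (memLp_average (fun i => (hst i).1) k).ae_eq (ae_of_all _ fun ω => ?_)
    exact (asgd_sub_eq hk _ _ _ _ fun i => rfl).symm
  refine ⟨hmem, (A.lpNorm_asgd_sub_le R hK0 hd3 hξ hW hind hb hM (fun i => (hst i).1) hle
    hk).trans ?_⟩
  have hmean : ∀ i, lsNorm s (∫ ω, sgd g α b (fun i => ξ i ω) i ∂P - bstar) ≤ σ := fun i => by
    have hi := integrable_of_memLp_one_le hq (hst i).1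
    have e : ∫ ω, sgd g α b (fun i => ξ i ω) i ∂P - bstar
        = ∫ ω, (sgd g α b (fun i => ξ i ω) i - bstar) ∂P := by
      have hi' : Integrable (fun ω => sgd g α b (fun i => ξ i ω) i) P := by
        refine (hi.add (integrable_const bstar)).congr (ae_of_all _ fun ω => ?_)
        simp
      rw [integral_sub hi' (integrable_const _)]
      simp
    rw [e]
    exact (lsNorm_integral_le_lpNorm hs hq (hst i).1).trans (hle i)
  have hJ : lsNorm s (∫ ω, sgd g α b (fun i => ξ i ω) 1 ∂P
      - ∫ ω, sgd g α b (fun i => ξ i ω) (k + 1) ∂P) ≤ 2 * σ := by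
    have h := lsNorm_sub_le hs (∫ ω, sgd g α b (fun i => ξ i ω) 1 ∂P - bstar)
      (∫ ω, sgd g α b (fun i => ξ i ω) (k + 1) ∂P - bstar)
    rw [sub_sub_sub_cancel_right] at h
    linarith [hmean 1, hmean (k + 1)]
  have hS : ∑ i ∈ Finset.Icc 1 k, lpNorm (fun ω => lsNorm s
      (sgd g α b (fun i => ξ i ω) i - bstar)) (ENNReal.ofReal q) P ^ 2
      ≤ 21 / (α * μ) * D ^ 2 + k * statVar s q μ M α := by
    refine (Finset.sum_le_sum fun i _ => hsq i).trans ?_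
    rw [Finset.sum_add_distrib, ← Finset.sum_mul]
    refine add_le_add (mul_le_mul_of_nonneg_right ?_ (sq_nonneg _)) (le_of_eq (by simp))
    rw [sum_Icc_one_eq_sum_range, ← R.one_sub_rate_inv]
    refine le_trans (Finset.sum_le_sum fun i _ => ?_) (sum_rate_pow_le hr hr1 k)
    rw [pow_succ]
    exact mul_le_of_le_one_right (pow_nonneg hr i) hr1.le
  set c := 3 * (K * (d : ℝ) ^ (1 - 2 / (s : ℝ))) with hc
  have hc0 : 0 ≤ c := by positivity
  set w := √(20 / 3 * max q (s : ℝ)) * (42 / μ * (M + L * σ)) with hw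
  have e1 : √k * w / k = w / √k := by
    rw [mul_comm, mul_div_assoc, Real.sqrt_div_self, ← div_eq_mul_inv]
  have h1 := div_le_div_of_nonneg_right hJ hα.le
  have h2 := mul_le_mul_of_nonneg_left hS hc0
  refine (div_le_div_of_nonneg_right (add_le_add_right (div_le_div_of_nonneg_right
    (add_le_add h1 h2) hμ.le) _) hkpos.le).trans (le_of_eq ?_)
  rw [add_assoc, add_div (√k * w), e1, add_assoc (w / √k)]
  congr 1
  field_simp
  ring

/-- With a learning rate proportional to `ε`, the number of steps needed for accuracy `ε` is of
order `1 / ε ^ 2`. -/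
theorem Assumptions.exists_complexity_const (A : Assumptions Q g (sDim d) q μ L K bstar)
    (hd : 1 ≤ d) (hq : 2 ≤ q) (hμ : 0 < μ) (hL : 0 < L) (hK0 : 0 ≤ K)
    {M : ℝ} (hM : M = (noiseMoment Q g (sDim d) q bstar).toReal) (b : Fin d → ℝ) :
    ∃ C : ℝ, 0 < C ∧ ∀ ε : ℝ, 0 < ε → ε ≤ 1 →
      ∃ α : ℝ, 0 < α ∧ α ≤ alphaMax (sDim d) q μ L / 7 ∧
        α * (3 * biasConst μ K * biasFactor d (sDim d) q M) ≤ ε ∧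
        ∀ (Ω : Type*) [MeasurableSpace Ω] (P : Measure Ω) [IsProbabilityMeasure P]
          (ξ : ℕ → Ω → Ξ), IsIIDSample P Q ξ →
        ∀ k : ℕ, 1 ≤ k → C / ε ^ 2 ≤ (k : ℝ) →
        momentNorm q P (fun ω => ‖asgd g α b (fun i => ξ i ω) k - bstar‖)
          ≤ ENNReal.ofReal ε := by
  have hs2 := two_le_sDim hd
  have hd3 := rpow_one_div_sDim_le hd
  have hev := even_sDim d
  generalize hsd : sDim d = s at *
  have hM0 : 0 ≤ M := hM ▸ ENNReal.toReal_nonneg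
  have hp : 0 < max q (s : ℝ) := lt_of_lt_of_le (by linarith) (le_max_left _ _)
  -- `α = aε` meets both restrictions on `α`, as `ε ≤ 1`
  set N := 3 * biasConst μ K * biasFactor d s q M with hN
  have hN0 : 0 ≤ N := by
    rw [hN, biasConst, biasFactor]; positivity
  have hmax : 0 < alphaMax s q μ L := by rw [alphaMax]; positivity
  set a := min (alphaMax s q μ L / 7) (1 / (N + 1)) with ha
  have ha0 : 0 < a := lt_min (by positivity) (by positivity)
  have haN : a * N ≤ 1 := by
    have h1 : a * N ≤ 1 / (N + 1) * N := mul_le_mul_of_nonneg_right (min_le_right _ _) hN0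
    have h2 : 1 / (N + 1) * N ≤ 1 := by
      rw [one_div, inv_mul_eq_div, div_le_one (by positivity)]; linarith
    exact h1.trans h2
  set D := lsNorm s (b - bstar) with hD
  have hT1 : 0 ≤ statVar s q μ M a := by rw [statVar]; positivity
  -- bounds the moments of all iterates for every `ε ≤ 1`, as `statVar` increases with `α`
  set σ := √(D ^ 2 + statVar s q μ M a) with hσ
  have hσ0 : 0 ≤ σ := Real.sqrt_nonneg _
  set Q1 := √(20 / 3 * max q (s : ℝ)) * (42 / μ * (M + L * σ)) with hQ1
  set Q2 := (42 * σ + 2 * σ + 3 * (K * (d : ℝ) ^ (1 - 2 / (s : ℝ))) * (D ^ 2 * 21 / μ)) / μ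
    with hQ2
  have hQ1n : 0 ≤ Q1 := by positivity
  have hQ2n : 0 ≤ Q2 := by positivity
  refine ⟨9 * Q1 ^ 2 + 3 * (Q2 / a) + 1, by positivity, fun ε hε hε1 => ?_⟩
  have haε : a * ε ≤ a := mul_le_of_le_one_right ha0.le hε1
  have hbias : a * ε * N ≤ ε := by
    calc a * ε * N = a * N * ε := by ring
      _ ≤ 1 * ε := mul_le_mul_of_nonneg_right haN hε.le
      _ = ε := one_mul ε
  have hα7 : a * ε ≤ alphaMax s q μ L / 7 := haε.trans (min_le_left _ _)
  refine ⟨a * ε, by positivity, hα7, hbias, fun Ω _ P _ ξ hξ k hk hkC => ?_⟩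
  have R : Regime d s q μ L (a * ε) := ⟨hd, hs2, hev, hq, hμ, hL, by positivity, hα7⟩
  have hkpos : (0 : ℝ) < k := by exact_mod_cast hk
  have hx : 0 < √(k : ℝ) := Real.sqrt_pos.2 hkpos
  have hσ2 : D ^ 2 + statVar s q μ M (a * ε) ≤ σ ^ 2 := by
    rw [hσ, Real.sq_sqrt (by positivity)]
    refine add_le_add_right ?_ _
    rw [statVar, statVar]
    gcongr
  obtain ⟨h1, h2⟩ := A.lpNorm_asgd_const_le R hK0 hd3 hξ b hM hσ0 hσ2 hk
  refine momentNorm_norm_le R.one_le_s h1 (h2.trans ?_)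
  have hb := R.bias_le hK0 hbias
  rw [div_le_iff₀ (by positivity)] at hkC
  have hQa : 0 ≤ Q2 / a := by positivity
  have t1 : Q1 / √k ≤ ε / 3 := by
    rw [div_le_iff₀ hx]
    refine le_of_pow_le_pow_left₀ two_ne_zero (by positivity) ?_
    rw [mul_pow (ε / 3), Real.sq_sqrt hkpos.le]
    linarith
  have t2 : Q2 / (a * ε * k) ≤ ε / 3 := by
    rw [mul_assoc, ← div_div, div_le_iff₀ (by positivity)]
    have := sq_nonneg Q1
    linarith
  linarith

end Deterministic

end ASGD

theorem mainTheorem9 :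
    -- `c q` depends only on `q`; `C₁`, `C₂` only on `μ`; `C₃` only on `μ` and `K`
    ∃ c : ℝ → ℝ, (∀ q, 2 ≤ q → 0 < c q) ∧
    ∀ μ : ℝ, 0 < μ → ∃ C₁ C₂ : ℝ, 0 < C₁ ∧ 0 < C₂ ∧
    ∀ K : ℝ, 0 ≤ K → ∃ C₃ : ℝ, 0 < C₃ ∧
    ∀ (q : ℝ), 2 ≤ q → ∀ (d : ℕ), 1 ≤ d →
    ∀ (Ξ : Type*) [MeasurableSpace Ξ] (Q : Measure Ξ) [IsProbabilityMeasure Q]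
      (g : (Fin d → ℝ) → Ξ → ℝ) (bstar : Fin d → ℝ) (L : ℝ), 0 < L →
    ASGD.Assumptions Q g (ASGD.sDim d) q μ L K bstar →
    ∀ M : ℝ, M = (ASGD.noiseMoment Q g (ASGD.sDim d) q bstar).toReal →
    -- the complexity bound
    (∀ (α ε : ℝ), 0 < α → 0 < ε →
      α ≤ ASGD.alphaMax (ASGD.sDim d) q μ L / 7 →
      α * (3 * C₃ * ASGD.biasFactor d (ASGD.sDim d) q M) ≤ ε →
      ∀ (π : Measure (Fin d → ℝ)), ASGD.IsStationaryLaw Q g α (ASGD.sDim d) q π →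
      ∀ (Ω : Type*) [MeasurableSpace Ω] (P : Measure Ω) [IsProbabilityMeasure P]
        (ξ : ℕ → Ω → Ξ) (b₀ b₀s : Ω → Fin d → ℝ),
      ASGD.IsIIDSample P Q ξ →
      Measurable b₀ → Measurable b₀s → P.map b₀s = π →
      IndepFun (fun ω => (b₀ ω, b₀s ω)) (fun ω k => ξ k ω) P →
      ∀ k : ℕ, 1 ≤ k →
      9 * C₁ ^ 2 * c q * (ASGD.sDim d : ℝ) * ASGD.varFactor (ASGD.sDim d) q L M α ^ 2 * α / ε ^ 2
        ≤ (k : ℝ) →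
      ENNReal.ofReal (3 * C₂) * ASGD.momentNorm q P (fun ω => ‖b₀ ω - b₀s ω‖)
        / ENNReal.ofReal (α * ε) ≤ (k : ℝ≥0∞) →
      ASGD.momentNorm q P (fun ω => ‖ASGD.asgd g α (b₀ ω) (fun i => ξ i ω) k - bstar‖)
        ≤ ENNReal.ofReal ε) ∧
    -- the resulting iteration complexity of order `1 / ε ^ 2`
    (∀ b : Fin d → ℝ, ∃ A : ℝ, 0 < A ∧ ∀ ε : ℝ, 0 < ε → ε ≤ 1 →
      ∃ α : ℝ, 0 < α ∧ α ≤ ASGD.alphaMax (ASGD.sDim d) q μ L / 7 ∧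
        α * (3 * C₃ * ASGD.biasFactor d (ASGD.sDim d) q M) ≤ ε ∧
        ∀ (Ω : Type*) [MeasurableSpace Ω] (P : Measure Ω) [IsProbabilityMeasure P]
          (ξ : ℕ → Ω → Ξ), ASGD.IsIIDSample P Q ξ →
        ∀ k : ℕ, 1 ≤ k → A / ε ^ 2 ≤ (k : ℝ) →
        ASGD.momentNorm q P (fun ω => ‖ASGD.asgd g α b (fun i => ξ i ω) k - bstar‖)
          ≤ ENNReal.ofReal ε) := by
  refine ⟨fun q => q, fun q hq => two_pos.trans_le hq, fun μ hμ =>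
    ⟨ASGD.devConst μ, 63 / μ, by rw [ASGD.devConst]; positivity, by positivity, fun K hK =>
    ⟨ASGD.biasConst μ K, by rw [ASGD.biasConst]; positivity, ?_⟩⟩⟩
  intro q hq d hd Ξ _ Q _ g bstar L hL A M hM
  refine ⟨?_, A.exists_complexity_const hd hq hμ hL hK hM⟩
  intro α ε hα hε hα7 hαε π hπ Ω _ P _ ξ b₀ b₀s hξ hb hbs hlaw hind k hk hk1 hk2
  exact A.momentNorm_asgd_le ⟨hd, ASGD.two_le_sDim hd, ASGD.even_sDim d, hq, hμ, hL, hα, hα7⟩ hK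
    (ASGD.rpow_one_div_sDim_le hd) hM hε hαε hπ hξ hb hbs hlaw hind hk hk1 hk2
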